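/- Let $k$ be a field of characteristic zero. For quartic forms $q_1,q_2\in k[x,y,z]_4$ let $$J(q_1,q_2)=q_1\bigl(w\partial_y-v\partial_z,\;u\partial_z-w\partial_x,\;v\partial_x-u\partial_y\bigr)\,q_2(x,y,z)\in k[u,v,w]_4,$$ and let $h(q)=J(q,q)$. Let $h\colon \mathbb P^{14}_k\dashrightarrow(\mathbb P^{14}_k)^\vee$, $[q]\mapsto[h(q)]$, be the induced rational map from the space $\mathbb P(k[x,y,z]_4)$ of plane quartics to the space $\mathbb P(k[u,v,w]_4)$ of quartics in the dual plane. Let $\widetilde{\mathbb P}\subset\mathbb P^{14}_k\times_k(\mathbb P^{14}_k)^\vee$ be the closure of the graph of this rational map, and let $H\colon\widetilde{\mathbb P}\to(\mathbb P^{14}_k)^\vee$ be the second projection. Let $\mathrm{Fer}$ and $\mathrm{Fer}'$ be the Fermat quartics $x^4+y^4+z^4=0$ and $u^4+v^4+w^4=0$, and let $$\begin{aligned} C_0&\colon\ x^4+y^4+z^4-6(x^2y^2+x^2z^2+y^2z^2)=0,\\ C_1&\colon\ x^4+y^4+z^4-6(x^2y^2-x^2z^2-y^2z^2)=0,\\ C_2&\colon\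 x^4+y^4+z^4-6(-x^2y^2+x^2z^2-y^2z^2)=0,\\ C_3&\colon\ x^4+y^4+z^4-6(-x^2y^2-x^2z^2+y^2z^2)=0. \end{aligned}$$ Theorem. The rational map $h$ is defined at $\mathrm{Fer},C_0,C_1,C_2,C_3$ and sends each of them to $\mathrm{Fer}'$. The scheme-theoretic fiber of $H$ over the $k$-rational point $[\mathrm{Fer}']$ consists of exactly five points, the pairs $(C,\mathrm{Fer}')$ with $C\in\{\mathrm{Fer},C_0,C_1,C_2,C_3\}$. The point given by $\mathrm{Fer}$ has multiplicity $11$ and each of the points given by $C_0,C_1,C_2,C_3$ has multiplicity $1$, where the multiplicity of a point is the length of the local ring of the fiber at that point. -/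

import Mathlib

universe u

namespace HarmonicQuartic

open MvPolynomial CategoryTheory CategoryTheory.Limits AlgebraicGeometry

noncomputable section

attribute [local instance] MvPolynomial.gradedAlgebra

/-! ### The bilinear map `J` and the harmonic form of a ternary form -/

section Forms

variable {R : Type u} [CommRing R]

/-- The three first-order operators that are substituted for `x`, `y`, `z`, acting on polynomials
in `x`, `y`, `z` with coefficients in `R[u, v, w]`:
`polarOp 0 = w ∂_y - v ∂_z`, `polarOp 1 = u ∂_z - w ∂_x`, `polarOp 2 = v ∂_x - u ∂_y`
(the indices `i`, `i + 1`, `i + 2` are taken modulo `3`). They commute with each other. -/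
def polarOp (i : Fin 3) :
    Module.End (MvPolynomial (Fin 3) R) (MvPolynomial (Fin 3) (MvPolynomial (Fin 3) R)) :=
  (X (i + 2) : MvPolynomial (Fin 3) R) • (pderiv (i + 1)).toLinearMap
    - (X (i + 1) : MvPolynomial (Fin 3) R) • (pderiv (i + 2)).toLinearMap

/-- The polynomial `q₁ (w ∂_y - v ∂_z, u ∂_z - w ∂_x, v ∂_x - u ∂_y) q₂ (x, y, z)`, as a polynomial
in `x`, `y`, `z` over `R[u, v, w]`. -/
def polarize (q₁ q₂ : MvPolynomial (Fin 3) R) : MvPolynomial (Fin 3) (MvPolynomial (Fin 3) R) :=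
  ∑ m ∈ q₁.support, C (C (coeff m q₁)) *
    (polarOp 0 ^ m 0 * polarOp 1 ^ m 1 * polarOp 2 ^ m 2 : Module.End (MvPolynomial (Fin 3) R)
      (MvPolynomial (Fin 3) (MvPolynomial (Fin 3) R))) (MvPolynomial.map C q₂)

/-- The bilinear map `J(q₁, q₂)`, with values in `R[u, v, w]`. When `q₁` and `q₂` are forms of the
same degree, `polarize q₁ q₂` does not involve `x`, `y`, `z`, so that it is equal to its constant
coefficient. -/
def J (q₁ q₂ : MvPolynomial (Fin 3) R) : MvPolynomial (Fin 3) R :=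
  constantCoeff (polarize q₁ q₂)

/-- The harmonic form `h(q) = J(q, q)` of a ternary form `q`. -/
def harmonicForm (q : MvPolynomial (Fin 3) R) : MvPolynomial (Fin 3) R :=
  J q q

end Forms

/-- The exponents of the fifteen monomials of degree `4` in three variables. -/
abbrev Mon : Type := {m : Fin 3 →₀ ℕ // m ∈ Finset.finsuppAntidiag Finset.univ 4}

/-- The fifteen coefficients of a ternary quartic. -/
def coeffs {R : Type u} [CommRing R] (q : MvPolynomial (Fin 3) R) : Mon → R :=
  fun m => coeff m.1 q

/-- The ternary quartic with given coefficients. -/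
def ofCoeffs {R : Type u} [CommRing R] (a : Mon → R) : MvPolynomial (Fin 3) R :=
  ∑ m : Mon, monomial m.1 (a m)

/-! ### Projective space -/

section Projective

variable (ι : Type) (k : Type u) [Field k]

/-- Projective space over `k` with homogeneous coordinates indexed by `ι`. -/
abbrev projSpace : Scheme.{u} := Proj (homogeneousSubmodule ι k)

/-- The structure morphism of projective space. -/
def projSpaceToBase : projSpace ι k ⟶ Spec (.of k) :=
  Proj.toSpecZero (homogeneousSubmodule ι k) ≫
    Spec.map (CommRingCat.ofHom (algebraMap k (homogeneousSubmodule ι k 0)))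

variable {ι} {k} {R : Type u} [CommRing R] [Algebra k R]

/-- The ring homomorphism from the homogeneous coordinate ring to `R` that sends the coordinates to
the given elements `c i` of `R`. -/
def evalHom (c : ι → R) : MvPolynomial ι k →+* Γ(Spec (.of R), ⊤) :=
  (Scheme.ΓSpecIso (.of R)).inv.hom.comp (aeval c : MvPolynomial ι k →ₐ[k] R).toRingHom

lemma evalHom_irrelevant (c : ι → R) (hc : Ideal.span (Set.range c) = ⊤) :
    (HomogeneousIdeal.irrelevant (homogeneousSubmodule ι k)).toIdeal.map (evalHom c) = ⊤ := by
  have h : (Ideal.span (Set.range c)).map (Scheme.ΓSpecIso (.of R)).inv.hom = ⊤ := by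
    rw [hc, Ideal.map_top]
  rw [eq_top_iff, ← h, Ideal.map_span, Ideal.span_le]
  rintro _ ⟨_, ⟨i, rfl⟩, rfl⟩
  have hX : (X i : MvPolynomial ι k) ∈
      (HomogeneousIdeal.irrelevant (homogeneousSubmodule ι k)).toIdeal := by
    change GradedRing.projZeroRingHom (homogeneousSubmodule ι k) (X i) = 0
    rw [GradedRing.projZeroRingHom_apply]
    exact DirectSum.decompose_of_mem_ne _ (isHomogeneous_X k i) one_ne_zero
  have := Ideal.mem_map_of_mem (evalHom c) hX
  simpa [evalHom] using this

/-- The `R`-valued point `[c]` of projective space with homogeneous coordinates `c i`, for elements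
`c i` of a `k`-algebra `R` that generate the unit ideal. -/
def projPoint (c : ι → R) (hc : Ideal.span (Set.range c) = ⊤) : Spec (.of R) ⟶ projSpace ι k :=
  Proj.fromOfGlobalSections (homogeneousSubmodule ι k) (evalHom c) (evalHom_irrelevant c hc)

lemma projPoint_toBase (c : ι → R) (hc : Ideal.span (Set.range c) = ⊤) :
    projPoint c hc ≫ projSpaceToBase ι k = Spec.map (CommRingCat.ofHom (algebraMap k R)) := by
  have h : (evalHom c).comp (algebraMap (homogeneousSubmodule ι k 0) (MvPolynomial ι k)) =
      (Scheme.ΓSpecIso (.of R)).inv.hom.comp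
        ((aeval c : MvPolynomial ι k →ₐ[k] R).toRingHom.comp
          (algebraMap (homogeneousSubmodule ι k 0) (MvPolynomial ι k))) := rfl
  rw [projPoint, projSpaceToBase, Proj.fromOfGlobalSections_toSpecZero_assoc, h,
    CommRingCat.ofHom_comp, Spec.map_comp, CommRingCat.ofHom_hom, Category.assoc,
    ← Category.assoc (Scheme.toSpecΓ _)]
  have h₁ : (Spec (.of R)).toSpecΓ ≫ Spec.map (Scheme.ΓSpecIso (.of R)).inv = 𝟙 _ := by
    simp
  rw [h₁, Category.id_comp, ← Spec.map_comp, ← CommRingCat.ofHom_comp]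
  congr 2
  ext x
  exact (aeval c : MvPolynomial ι k →ₐ[k] R).commutes x

end Projective

/-! ### The graph of `h`, its closure and the morphism `H` -/

section Graph

variable (k : Type u) [Field k]

/-- The projective space of ternary quartics: the quartic `q` has the homogeneous coordinates
`coeffs q`. It serves for the curves in the plane and for those in the dual plane. -/
abbrev QuarticSpace : Scheme.{u} := projSpace Mon k

/-- The product over `k` of the space of quartics in the plane and of the space of quartics in the
dual plane. -/
abbrev QuarticPairs : Scheme.{u} := pullback (projSpaceToBase Mon k) (projSpaceToBase Mon k)

/-- The coefficients of the harmonic form of the universal quartic: fifteen quadratic forms in the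
fifteen coefficients of a quartic. The rational map `h` sends a point with homogeneous coordinates
`a` to the point with homogeneous coordinates `harmonicCoeffs k m`, evaluated at `a`. -/
def harmonicCoeffs : Mon → MvPolynomial Mon k :=
  coeffs (harmonicForm (ofCoeffs (X : Mon → MvPolynomial Mon k)))

/-- The ring of regular functions on the open set of those quartic forms `q` for which the
coefficient `i.1` of `q` and the coefficient `i.2` of the harmonic form of `q` do not vanish. -/
abbrev ChartRing (i : Mon × Mon) : Type u :=
  Localization.Away (X i.1 * harmonicCoeffs k i.2 : MvPolynomial Mon k)

variable {k}

lemma span_chart_left (i : Mon × Mon) :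
    Ideal.span (Set.range fun m : Mon => algebraMap (MvPolynomial Mon k) (ChartRing k i) (X m)) =
      ⊤ := by
  refine Ideal.eq_top_of_isUnit_mem _ (Ideal.subset_span ⟨i.1, rfl⟩) ?_
  exact isUnit_of_dvd_unit (map_dvd _ (dvd_mul_right _ _))
    (IsLocalization.Away.algebraMap_isUnit (X i.1 * harmonicCoeffs k i.2))

lemma span_chart_right (i : Mon × Mon) :
    Ideal.span (Set.range fun m : Mon =>
      algebraMap (MvPolynomial Mon k) (ChartRing k i) (harmonicCoeffs k m)) = ⊤ := by
  refine Ideal.eq_top_of_isUnit_mem _ (Ideal.subset_span ⟨i.2, rfl⟩) ?_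
  exact isUnit_of_dvd_unit (map_dvd _ (dvd_mul_left _ _))
    (IsLocalization.Away.algebraMap_isUnit (X i.1 * harmonicCoeffs k i.2))

/-- The morphism `q ↦ ([q], [h(q)])` on the open set of quartic forms `q` for which the
coefficient `i.1` of `q` and the coefficient `i.2` of `h(q)` do not vanish. -/
def graphChart (i : Mon × Mon) : Spec (.of (ChartRing k i)) ⟶ QuarticPairs k :=
  pullback.lift (projPoint _ (span_chart_left i)) (projPoint _ (span_chart_right i))
    (by rw [projPoint_toBase, projPoint_toBase])

variable (k)

/-- The morphism `q ↦ ([q], [h(q)])` on the disjoint union of the open sets of quartic forms `q` with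
a chosen nonzero coefficient of `q` and a chosen nonzero coefficient of `h(q)`. As these open sets
cover the locus where `q` and `h(q)` are nonzero, its image is the graph of the rational map `h`. -/
def graphMap : (∐ fun i : Mon × Mon => Spec (.of (ChartRing k i))) ⟶ QuarticPairs k :=
  Sigma.desc graphChart

/-- The closure of the graph of the rational map `h` (the closed subscheme that is the
scheme-theoretic image of the graph). -/
abbrev GraphClosure : Scheme.{u} := (graphMap k).image

/-- The first projection from the closure of the graph, to the space of quartics in the plane. -/
def graphFst : GraphClosure k ⟶ QuarticSpace k :=
  (graphMap k).imageι ≫ pullback.fst _ _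

/-- The morphism `H`, the second projection from the closure of the graph, to the space of quartics
in the dual plane. -/
def H : GraphClosure k ⟶ QuarticSpace k :=
  (graphMap k).imageι ≫ pullback.snd _ _

end Graph

/-! ### The quartics -/

section Quartics

variable {k : Type u} [Field k]

lemma span_coeffs (q : MvPolynomial (Fin 3) k) (hq : q.IsHomogeneous 4) (h0 : q ≠ 0) :
    Ideal.span (Set.range (coeffs q)) = ⊤ := by
  obtain ⟨m, hm⟩ := ne_zero_iff.mp h0
  have hd : m ∈ Finset.finsuppAntidiag Finset.univ 4 := by
    have h : m.degree = 4 := by rw [Finsupp.degree_eq_weight_one]; exact hq hm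
    rw [Finset.mem_finsuppAntidiag]
    exact ⟨by rw [← h, Finsupp.degree_eq_sum], Finset.subset_univ _⟩
  exact Ideal.eq_top_of_isUnit_mem _ (Ideal.subset_span ⟨⟨m, hd⟩, rfl⟩) (isUnit_iff_ne_zero.mpr hm)

/-- The `k`-rational point `[q]` of the space of quartics that corresponds to a quartic form `q`. -/
def quarticPoint (q : MvPolynomial (Fin 3) k) (hq : q.IsHomogeneous 4) (h0 : q ≠ 0) :
    QuarticSpace k :=
  projPoint (coeffs q) (span_coeffs q hq h0) (IsLocalRing.closedPoint k)

variable (k)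

/-- The Fermat quartic form. Its variables stand for `x, y, z` or for `u, v, w`. -/
def fermat : MvPolynomial (Fin 3) k := X 0 ^ 4 + X 1 ^ 4 + X 2 ^ 4

/-- The quartic forms that define `C₀`, `C₁`, `C₂`, `C₃`. -/
def companion : Fin 4 → MvPolynomial (Fin 3) k :=
  ![(X 0 ^ 4 + X 1 ^ 4 + X 2 ^ 4)
      - 6 * (X 0 ^ 2 * X 1 ^ 2 + X 0 ^ 2 * X 2 ^ 2 + X 1 ^ 2 * X 2 ^ 2),
    (X 0 ^ 4 + X 1 ^ 4 + X 2 ^ 4)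
      - 6 * (X 0 ^ 2 * X 1 ^ 2 - X 0 ^ 2 * X 2 ^ 2 - X 1 ^ 2 * X 2 ^ 2),
    (X 0 ^ 4 + X 1 ^ 4 + X 2 ^ 4)
      - 6 * (- (X 0 ^ 2 * X 1 ^ 2) + X 0 ^ 2 * X 2 ^ 2 - X 1 ^ 2 * X 2 ^ 2),
    (X 0 ^ 4 + X 1 ^ 4 + X 2 ^ 4)
      - 6 * (- (X 0 ^ 2 * X 1 ^ 2) - X 0 ^ 2 * X 2 ^ 2 + X 1 ^ 2 * X 2 ^ 2)]

lemma fermat_isHomogeneous : (fermat k).IsHomogeneous 4 :=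
  ((isHomogeneous_X_pow 0 4).add (isHomogeneous_X_pow 1 4)).add (isHomogeneous_X_pow 2 4)

lemma fermat_ne_zero : fermat k ≠ 0 := fun h => by
  have := congrArg (eval ![1, 0, 0]) h
  simp [fermat] at this

lemma companion_isHomogeneous (j : Fin 4) : (companion k j).IsHomogeneous 4 := by
  have hF := fermat_isHomogeneous k
  have h6 : (6 : MvPolynomial (Fin 3) k).IsHomogeneous 0 := by
    simpa only [map_ofNat] using isHomogeneous_C (Fin 3) (6 : k)
  have hX (a b : Fin 3) : (X a ^ 2 * X b ^ 2 : MvPolynomial (Fin 3) k).IsHomogeneous 4 :=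
    (isHomogeneous_X_pow a 2).mul (isHomogeneous_X_pow b 2)
  have key (p : MvPolynomial (Fin 3) k) (hp : p.IsHomogeneous 4) :
      (fermat k - 6 * p).IsHomogeneous 4 :=
    hF.sub (by simpa using h6.mul hp)
  fin_cases j
  · exact key _ (((hX 0 1).add (hX 0 2)).add (hX 1 2))
  · exact key _ (((hX 0 1).sub (hX 0 2)).sub (hX 1 2))
  · exact key _ (((hX 0 1).neg.add (hX 0 2)).sub (hX 1 2))
  · exact key _ (((hX 0 1).neg.sub (hX 0 2)).add (hX 1 2))

lemma companion_ne_zero (j : Fin 4) : companion k j ≠ 0 := fun h => by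
  have := congrArg (eval ![1, 0, 0]) h
  fin_cases j <;> simp [companion] at this

/-- The point of the space of quartics given by the Fermat quartic. -/
def fermatPoint : QuarticSpace k := quarticPoint _ (fermat_isHomogeneous k) (fermat_ne_zero k)

/-- The points of the space of quartics given by `C₀`, `C₁`, `C₂`, `C₃`. -/
def companionPoint (j : Fin 4) : QuarticSpace k :=
  quarticPoint _ (companion_isHomogeneous k j) (companion_ne_zero k j)

/-- The scheme-theoretic fiber of `H` over the Fermat quartic in the dual plane. -/
abbrev FermatFiber : Scheme.{u} := (H k).fiber (fermatPoint k)

variable {k}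

/-- The plane quartic `C` that underlies a point `(C, D)` of the fiber. -/
def curveOf (x : FermatFiber k) : QuarticSpace k :=
  ((H k).fiberι (fermatPoint k) ≫ graphFst k) x

/-- The multiplicity of a point of a zero-dimensional scheme: the length of its local ring. -/
def multiplicity {Z : Scheme.{u}} (x : Z) : ℕ∞ :=
  Module.length (Z.presheaf.stalk x) (Z.presheaf.stalk x)

end Quartics

end

end HarmonicQuartic

namespace HarmonicQuartic

open MvPolynomial CategoryTheory CategoryTheory.Limits AlgebraicGeometry

noncomputable section

set_option linter.unusedSimpArgs false

attribute [local instance] MvPolynomial.gradedAlgebra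

/-! ### The harmonic form as fifteen explicit quadratic forms. -/

section ExplicitForm

/-! Pair quartics with dual quartics by letting one differentiate the other. The trilinear form
`⟨q₁, J(q₂, q₃)⟩` is symmetric: on fourth powers of linear forms it is a constant times the fourth
power of their determinant. So `I(q) = ⟨q, h(q)⟩` is an `SL₃`-invariant cubic whose derivative is
`3⟨·, h(q)⟩`, and its infinitesimal invariance says that `⟨ξ q, h(q)⟩ = 0` for every traceless `ξ`.
In coordinates: the 3 × 3 matrix `contraction` of `q` with `h(q)` is scalar (`contraction_quad`,
`contraction_quad_diag`). These equations are bilinear in the pair, so they pass to the closure of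
the graph (`equation_of_graphClosure`). They still carry information where `h(q) = 0`, whereas the
proportionality of `h(q)` to the second quartic becomes void there.

Over `Fer'` they are eight linear conditions on `q`: the coefficients of `x³y`, `x³z` and their
analogues vanish, and those of `x⁴`, `y⁴`, `z⁴` agree. Together with proportionality they exclude a
zero coefficient of `x⁴`. After normalization exactly the quartics `sixVec a b c l m n` with
`FermatRel` remain. Conversely, `FermatRel` gives `h(q) = 48 (1 + 3 a²) Fer'`, and `1 + 3 a²` is a
unit because `a⁶ = a⁴`; such quartics, over any `k`-algebra, therefore lie on the graph itself.
Hence the fiber, with its nilpotents, is the spectrum of `FermatRing` (`exists_fiber_iso`).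

In that ring `a⁴` is idempotent. On the part where it equals `1`, one has `l = m = n = 0`, `a² = b²
= 1` and `c = -a b`: four reduced points (`length_companion`). On the complementary part `a`, `b`,
`c` equal `-2l²`, `-2m²`, `-2n²`, and the remaining relations in `l, m, n` leave eleven spanning
monomials. Their independence is an instance of Macaulay duality: the local Gorenstein algebra of
`l⁴ + m⁴ + n⁴ - 4 l m n` is a quotient, and there the monomials have a dual family under the socle
pairing (`length_fermat`). -/

/-- The exponent of the monomial `x ^ i * y ^ j * z ^ l`. -/
def expo (i j l : ℕ) : Fin 3 →₀ ℕ := Finsupp.equivFunOnFinite.symm ![i, j, l]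

@[simp] lemma expo_zero (i j l : ℕ) : expo i j l 0 = i := rfl
@[simp] lemma expo_one (i j l : ℕ) : expo i j l 1 = j := rfl
@[simp] lemma expo_two (i j l : ℕ) : expo i j l 2 = l := rfl

/-- The exponent `(i, j, l)` of degree `4`. -/
def mon (i j l : ℕ) (h : i + j + l = 4 := by norm_num) : Mon :=
  ⟨expo i j l, by simp [Finset.mem_finsuppAntidiag, Fin.sum_univ_three, h]⟩

@[simp] lemma mon_zero (i j l : ℕ) (h : i + j + l = 4) : (mon i j l h).1 0 = i := rfl
@[simp] lemma mon_one (i j l : ℕ) (h : i + j + l = 4) : (mon i j l h).1 1 = j := rfl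
@[simp] lemma mon_two (i j l : ℕ) (h : i + j + l = 4) : (mon i j l h).1 2 = l := rfl

lemma Mon.sum_eq (m : Mon) : m.1 0 + m.1 1 + m.1 2 = 4 := by
  have := (Finset.mem_finsuppAntidiag.mp m.2).1
  rwa [Fin.sum_univ_three] at this

lemma Mon.ext' {m n : Mon} (h₀ : m.1 0 = n.1 0) (h₁ : m.1 1 = n.1 1) : m = n := by
  have hm := m.sum_eq
  have hn := n.sum_eq
  refine Subtype.ext (Finsupp.ext fun i => ?_)
  fin_cases i
  · exact h₀
  · exact h₁
  · change m.1 2 = n.1 2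
    omega

/-- The fifteen exponents in lexicographic order. -/
def monList : Fin 15 → Mon :=
  ![mon 4 0 0, mon 3 1 0, mon 3 0 1, mon 2 2 0, mon 2 1 1, mon 2 0 2, mon 1 3 0, mon 1 2 1,
    mon 1 1 2, mon 1 0 3, mon 0 4 0, mon 0 3 1, mon 0 2 2, mon 0 1 3, mon 0 0 4]

lemma Mon.forall {P : Mon → Prop} (h : ∀ i, P (monList i)) (m : Mon) : P m := by
  have hm := m.sum_eq
  have h0 : m.1 0 ≤ 4 := by omega
  have h1 : m.1 1 ≤ 4 - m.1 0 := by omega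
  have key (i : Fin 15) (e₀ : m.1 0 = (monList i).1 0) (e₁ : m.1 1 = (monList i).1 1) : P m :=
    Mon.ext' e₀ e₁ ▸ h i
  generalize m.1 0 = a at *
  generalize m.1 1 = b at *
  interval_cases a <;> interval_cases b
  · exact key 14 rfl rfl
  · exact key 13 rfl rfl
  · exact key 12 rfl rfl
  · exact key 11 rfl rfl
  · exact key 10 rfl rfl
  · exact key 9 rfl rfl
  · exact key 8 rfl rfl
  · exact key 7 rfl rfl
  · exact key 6 rfl rfl
  · exact key 5 rfl rfl
  · exact key 4 rfl rfl
  · exact key 3 rfl rfl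
  · exact key 2 rfl rfl
  · exact key 1 rfl rfl
  · exact key 0 rfl rfl

lemma monList_bijective : Function.Bijective monList := by
  refine ⟨fun i j h => ?_, fun m => Mon.forall (P := fun m => ∃ i, monList i = m) (fun i => ⟨i,
    rfl⟩) m⟩
  -- The first two exponents determine the third, so injectivity can be decided on tables of
  -- numerals.
  have key : ∀ i j : Fin 15,
      ((![4, 3, 3, 2, 2, 2, 1, 1, 1, 1, 0, 0, 0, 0, 0] : Fin 15 → ℕ) i,
        (![0, 1, 0, 2, 1, 0, 3, 2, 1, 0, 4, 3, 2, 1, 0] : Fin 15 → ℕ) i) =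
      ((![4, 3, 3, 2, 2, 2, 1, 1, 1, 1, 0, 0, 0, 0, 0] : Fin 15 → ℕ) j,
        (![0, 1, 0, 2, 1, 0, 3, 2, 1, 0, 4, 3, 2, 1, 0] : Fin 15 → ℕ) j) → i = j := by decide
  have hl (i : Fin 15) : ((monList i).1 0, (monList i).1 1) =
      ((![4, 3, 3, 2, 2, 2, 1, 1, 1, 1, 0, 0, 0, 0, 0] : Fin 15 → ℕ) i,
        (![0, 1, 0, 2, 1, 0, 3, 2, 1, 0, 4, 3, 2, 1, 0] : Fin 15 → ℕ) i) := by
    fin_cases i <;> rfl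
  exact key i j (by rw [← hl, ← hl, h])

/-- The vector indexed by `Mon` with the given entries, in lexicographic order. -/
def monVec {α : Type*} (v : Fin 15 → α) (m : Mon) : α :=
  v ((Equiv.ofBijective _ monList_bijective).symm m)

@[simp] lemma monVec_monList {α : Type*} (v : Fin 15 → α) (i : Fin 15) :
    monVec v (monList i) = v i :=
  congrArg v ((Equiv.ofBijective _ monList_bijective).symm_apply_apply i)

@[simp] lemma monVec_400 {α : Type*} (v : Fin 15 → α) : monVec v (mon 4 0 0) = v 0 :=
  monVec_monList v 0

@[simp] lemma monVec_310 {α : Type*} (v : Fin 15 → α) : monVec v (mon 3 1 0) = v 1 :=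
  monVec_monList v 1

@[simp] lemma monVec_301 {α : Type*} (v : Fin 15 → α) : monVec v (mon 3 0 1) = v 2 :=
  monVec_monList v 2

@[simp] lemma monVec_220 {α : Type*} (v : Fin 15 → α) : monVec v (mon 2 2 0) = v 3 :=
  monVec_monList v 3

@[simp] lemma monVec_211 {α : Type*} (v : Fin 15 → α) : monVec v (mon 2 1 1) = v 4 :=
  monVec_monList v 4

@[simp] lemma monVec_202 {α : Type*} (v : Fin 15 → α) : monVec v (mon 2 0 2) = v 5 :=
  monVec_monList v 5

@[simp] lemma monVec_130 {α : Type*} (v : Fin 15 → α) : monVec v (mon 1 3 0) = v 6 :=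
  monVec_monList v 6

@[simp] lemma monVec_121 {α : Type*} (v : Fin 15 → α) : monVec v (mon 1 2 1) = v 7 :=
  monVec_monList v 7

@[simp] lemma monVec_112 {α : Type*} (v : Fin 15 → α) : monVec v (mon 1 1 2) = v 8 :=
  monVec_monList v 8

@[simp] lemma monVec_103 {α : Type*} (v : Fin 15 → α) : monVec v (mon 1 0 3) = v 9 :=
  monVec_monList v 9

@[simp] lemma monVec_040 {α : Type*} (v : Fin 15 → α) : monVec v (mon 0 4 0) = v 10 :=
  monVec_monList v 10

@[simp] lemma monVec_031 {α : Type*} (v : Fin 15 → α) : monVec v (mon 0 3 1) = v 11 :=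
  monVec_monList v 11

@[simp] lemma monVec_022 {α : Type*} (v : Fin 15 → α) : monVec v (mon 0 2 2) = v 12 :=
  monVec_monList v 12

@[simp] lemma monVec_013 {α : Type*} (v : Fin 15 → α) : monVec v (mon 0 1 3) = v 13 :=
  monVec_monList v 13

@[simp] lemma monVec_004 {α : Type*} (v : Fin 15 → α) : monVec v (mon 0 0 4) = v 14 :=
  monVec_monList v 14

lemma Mon.sum_univ {M : Type*} [AddCommMonoid M] (f : Mon → M) :
    ∑ m, f m = ∑ i, f (monList i) :=
  (Function.Bijective.sum_comp monList_bijective f).symm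

variable {R : Type u} [CommRing R]

@[simp] lemma coeffs_ofCoeffs (a : Mon → R) : coeffs (ofCoeffs a) = a := by
  classical
  funext m
  simp [coeffs, ofCoeffs, coeff_sum, coeff_monomial]

lemma coeff_ofCoeffs (a : Mon → R) (m : Mon) : coeff m.1 (ofCoeffs a) = a m :=
  congrFun (coeffs_ofCoeffs a) m

lemma support_ofCoeffs (a : Mon → R) (m : Fin 3 →₀ ℕ) (hm : m ∈ (ofCoeffs a).support) :
    m ∈ Finset.finsuppAntidiag Finset.univ 4 := by
  classical
  by_contra h
  refine mem_support_iff.mp hm ?_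
  rw [ofCoeffs, coeff_sum]
  refine Finset.sum_eq_zero fun n _ => ?_
  rw [coeff_monomial, if_neg]
  rintro rfl
  exact h n.2

/-- The value of an operator `polarOp 0 ^ i * polarOp 1 ^ j * polarOp 2 ^ l` on a form of degree
`i + j + l`. -/
def polarValue (m : Fin 3 →₀ ℕ) (q : MvPolynomial (Fin 3) R) : MvPolynomial (Fin 3) R :=
  constantCoeff ((polarOp 0 ^ m 0 * polarOp 1 ^ m 1 * polarOp 2 ^ m 2 :
    Module.End (MvPolynomial (Fin 3) R)
      (MvPolynomial (Fin 3) (MvPolynomial (Fin 3) R))) (MvPolynomial.map C q))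

/-- The definition sums over the support, which depends on the coefficients; zero coefficients
contribute nothing, so the sum may run over all fifteen exponents, uniformly in the coefficients. -/
lemma harmonicForm_ofCoeffs_eq_sum (a : Mon → R) :
    harmonicForm (ofCoeffs a) = ∑ m : Mon, C (a m) * polarValue m.1 (ofCoeffs a) := by
  classical
  rw [harmonicForm, J, polarize, map_sum]
  have h (m : Mon) : C (a m) * polarValue m.1 (ofCoeffs a) =
      (fun n => C (coeff n (ofCoeffs a)) * polarValue n (ofCoeffs a)) m.1 := by
    simp only [coeff_ofCoeffs]
  simp_rw [h]
  rw [Finset.sum_coe_sort (Finset.finsuppAntidiag Finset.univ 4)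
    (fun n => C (coeff n (ofCoeffs a)) * polarValue n (ofCoeffs a))]
  refine (Finset.sum_congr rfl fun m _ => ?_).trans
    (Finset.sum_subset (fun m hm => support_ofCoeffs a m hm) fun m _ hm => ?_)
  · rw [map_mul, constantCoeff_C, polarValue]
  · rw [notMem_support_iff.mp hm, C_0, zero_mul]

/-- The number of times that `t` occurs among `i`, `j`, `l`, `s`. -/
def occ (t i j l s : Fin 3) : ℕ :=
  (if i = t then 1 else 0) + (if j = t then 1 else 0) + (if l = t then 1 else 0) +
    (if s = t then 1 else 0)

lemma occ_sum : ∀ i j l s : Fin 3, occ 0 i j l s + occ 1 i j l s + occ 2 i j l s = 4 := by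
  decide

/-- The constant term of a fourth partial derivative of a quartic. -/
lemma constantCoeff_pderiv_four (a : Mon → R) (i j l s : Fin 3) :
    constantCoeff (pderiv i (pderiv j (pderiv l (pderiv s (MvPolynomial.map C (ofCoeffs a)))))) =
      C (coeff (expo (occ 0 i j l s) (occ 1 i j l s) (occ 2 i j l s)) (ofCoeffs a)) *
        ((((occ 0 i j l s).factorial * (occ 1 i j l s).factorial * (occ 2 i j l s).factorial) : ℕ) :
          MvPolynomial (Fin 3) R) := by
  have hm : Finsupp.single i 1 + Finsupp.single j 1 + Finsupp.single l 1 + Finsupp.single s 1 =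
      (mon (occ 0 i j l s) (occ 1 i j l s) (occ 2 i j l s) (occ_sum i j l s)).1 := by
    ext t
    simp only [Finsupp.add_apply, Finsupp.single_apply]
    fin_cases t <;> rfl
  -- Each derivative contributes one more than the number of later-applied derivatives in the same
  -- direction; regrouped by direction, the product of these factors is a product of factorials.
  have hw : ∀ i j l s : Fin 3,
      (((if i = s then 1 else 0) + (if j = s then 1 else 0) + (if l = s then 1 else 0) + 1) *
        (((if i = l then 1 else 0) + (if j = l then 1 else 0) + 1) *
          ((if i = j then 1 else 0) + 1))) =
        (occ 0 i j l s).factorial * (occ 1 i j l s).factorial * (occ 2 i j l s).factorial := by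
    decide
  rw [constantCoeff_eq]
  simp only [coeff_pderiv, coeff_map, zero_add, Finsupp.coe_zero, Pi.zero_apply, Nat.cast_zero,
    mul_one]
  rw [hm, ← hw]
  change C (coeff (expo _ _ _) _) * _ * _ * _ = _
  simp only [Finsupp.add_apply, Finsupp.single_apply]
  push_cast
  ring

lemma coeff_expo_ofCoeffs (a : Mon → R) {i j l : ℕ} (h : i + j + l = 4) :
    coeff (expo i j l) (ofCoeffs a) = a (mon i j l h) :=
  coeff_ofCoeffs a (mon i j l h)

lemma constantCoeff_smul' (c : MvPolynomial (Fin 3) R)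
    (p : MvPolynomial (Fin 3) (MvPolynomial (Fin 3) R)) :
    constantCoeff (c • p) = c * constantCoeff p := by
  rw [smul_eq_C_mul, map_mul, constantCoeff_C]

lemma polarOp_zero (p : MvPolynomial (Fin 3) (MvPolynomial (Fin 3) R)) :
    polarOp 0 p = (X 2 : MvPolynomial (Fin 3) R) • pderiv 1 p
      - (X 1 : MvPolynomial (Fin 3) R) • pderiv 2 p := rfl

lemma polarOp_one (p : MvPolynomial (Fin 3) (MvPolynomial (Fin 3) R)) :
    polarOp 1 p = (X 0 : MvPolynomial (Fin 3) R) • pderiv 2 p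
      - (X 2 : MvPolynomial (Fin 3) R) • pderiv 0 p := rfl

lemma polarOp_two (p : MvPolynomial (Fin 3) (MvPolynomial (Fin 3) R)) :
    polarOp 2 p = (X 1 : MvPolynomial (Fin 3) R) • pderiv 0 p
      - (X 0 : MvPolynomial (Fin 3) R) • pderiv 1 p := rfl

/-- The fifteen coefficients of the harmonic form of the quartic with coefficients `a`. -/
def quad (a : Mon → R) : Mon → R :=
  monVec ![
    48 * (a (mon 0 0 4) * a (mon 0 4 0)) + 4 * a (mon 0 2 2) ^ 2
      - 12 * (a (mon 0 1 3) * a (mon 0 3 1)),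
    12 * (a (mon 0 1 3) * a (mon 1 2 1)) + 12 * (a (mon 0 3 1) * a (mon 1 0 3))
      - 48 * (a (mon 0 0 4) * a (mon 1 3 0)) - 8 * (a (mon 0 2 2) * a (mon 1 1 2)),
    12 * (a (mon 0 1 3) * a (mon 1 3 0)) + 12 * (a (mon 0 3 1) * a (mon 1 1 2))
      - 8 * (a (mon 0 2 2) * a (mon 1 2 1)) - 48 * (a (mon 0 4 0) * a (mon 1 0 3)),
    48 * (a (mon 0 0 4) * a (mon 2 2 0)) + 8 * (a (mon 0 2 2) * a (mon 2 0 2))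
      + 4 * a (mon 1 1 2) ^ 2 - 12 * (a (mon 0 1 3) * a (mon 2 1 1))
      - 12 * (a (mon 1 0 3) * a (mon 1 2 1)),
    16 * (a (mon 0 2 2) * a (mon 2 1 1)) + 36 * (a (mon 1 0 3) * a (mon 1 3 0))
      - 24 * (a (mon 0 1 3) * a (mon 2 2 0)) - 24 * (a (mon 0 3 1) * a (mon 2 0 2))
      - 4 * (a (mon 1 1 2) * a (mon 1 2 1)),
    8 * (a (mon 0 2 2) * a (mon 2 2 0)) + 48 * (a (mon 0 4 0) * a (mon 2 0 2))
      + 4 * a (mon 1 2 1) ^ 2 - 12 * (a (mon 0 3 1) * a (mon 2 1 1))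
      - 12 * (a (mon 1 1 2) * a (mon 1 3 0)),
    12 * (a (mon 0 1 3) * a (mon 3 0 1)) + 12 * (a (mon 1 0 3) * a (mon 2 1 1))
      - 48 * (a (mon 0 0 4) * a (mon 3 1 0)) - 8 * (a (mon 1 1 2) * a (mon 2 0 2)),
    36 * (a (mon 0 1 3) * a (mon 3 1 0)) + 16 * (a (mon 1 2 1) * a (mon 2 0 2))
      - 24 * (a (mon 0 2 2) * a (mon 3 0 1)) - 24 * (a (mon 1 0 3) * a (mon 2 2 0))
      - 4 * (a (mon 1 1 2) * a (mon 2 1 1)),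
    36 * (a (mon 0 3 1) * a (mon 3 0 1)) + 16 * (a (mon 1 1 2) * a (mon 2 2 0))
      - 24 * (a (mon 0 2 2) * a (mon 3 1 0)) - 4 * (a (mon 1 2 1) * a (mon 2 1 1))
      - 24 * (a (mon 1 3 0) * a (mon 2 0 2)),
    12 * (a (mon 0 3 1) * a (mon 3 1 0)) + 12 * (a (mon 1 3 0) * a (mon 2 1 1))
      - 48 * (a (mon 0 4 0) * a (mon 3 0 1)) - 8 * (a (mon 1 2 1) * a (mon 2 2 0)),
    48 * (a (mon 0 0 4) * a (mon 4 0 0)) + 4 * a (mon 2 0 2) ^ 2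
      - 12 * (a (mon 1 0 3) * a (mon 3 0 1)),
    12 * (a (mon 1 0 3) * a (mon 3 1 0)) + 12 * (a (mon 1 1 2) * a (mon 3 0 1))
      - 48 * (a (mon 0 1 3) * a (mon 4 0 0)) - 8 * (a (mon 2 0 2) * a (mon 2 1 1)),
    48 * (a (mon 0 2 2) * a (mon 4 0 0)) + 8 * (a (mon 2 0 2) * a (mon 2 2 0))
      + 4 * a (mon 2 1 1) ^ 2 - 12 * (a (mon 1 1 2) * a (mon 3 1 0))
      - 12 * (a (mon 1 2 1) * a (mon 3 0 1)),
    12 * (a (mon 1 2 1) * a (mon 3 1 0)) + 12 * (a (mon 1 3 0) * a (mon 3 0 1))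
      - 48 * (a (mon 0 3 1) * a (mon 4 0 0)) - 8 * (a (mon 2 1 1) * a (mon 2 2 0)),
    48 * (a (mon 0 4 0) * a (mon 4 0 0)) + 4 * a (mon 2 2 0) ^ 2
      - 12 * (a (mon 1 3 0) * a (mon 3 1 0))]

lemma monomial_mon (i j l : ℕ) (h : i + j + l = 4) (c : R) :
    monomial (mon i j l h).1 c = C c * (X 0 ^ i * X 1 ^ j * X 2 ^ l) := by
  rw [monomial_eq, Finsupp.prod_fintype _ _ (by simp), Fin.prod_univ_three]
  rfl

lemma ofCoeffs_eq (a : Mon → R) :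
    ofCoeffs a = C (a (mon 4 0 0)) * (X 0 ^ 4 * X 1 ^ 0 * X 2 ^ 0) +
      C (a (mon 3 1 0)) * (X 0 ^ 3 * X 1 ^ 1 * X 2 ^ 0) +
      C (a (mon 3 0 1)) * (X 0 ^ 3 * X 1 ^ 0 * X 2 ^ 1) +
      C (a (mon 2 2 0)) * (X 0 ^ 2 * X 1 ^ 2 * X 2 ^ 0) +
      C (a (mon 2 1 1)) * (X 0 ^ 2 * X 1 ^ 1 * X 2 ^ 1) +
      C (a (mon 2 0 2)) * (X 0 ^ 2 * X 1 ^ 0 * X 2 ^ 2) +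
      C (a (mon 1 3 0)) * (X 0 ^ 1 * X 1 ^ 3 * X 2 ^ 0) +
      C (a (mon 1 2 1)) * (X 0 ^ 1 * X 1 ^ 2 * X 2 ^ 1) +
      C (a (mon 1 1 2)) * (X 0 ^ 1 * X 1 ^ 1 * X 2 ^ 2) +
      C (a (mon 1 0 3)) * (X 0 ^ 1 * X 1 ^ 0 * X 2 ^ 3) +
      C (a (mon 0 4 0)) * (X 0 ^ 0 * X 1 ^ 4 * X 2 ^ 0) +
      C (a (mon 0 3 1)) * (X 0 ^ 0 * X 1 ^ 3 * X 2 ^ 1) +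
      C (a (mon 0 2 2)) * (X 0 ^ 0 * X 1 ^ 2 * X 2 ^ 2) +
      C (a (mon 0 1 3)) * (X 0 ^ 0 * X 1 ^ 1 * X 2 ^ 3) +
      C (a (mon 0 0 4)) * (X 0 ^ 0 * X 1 ^ 0 * X 2 ^ 4) := by
  simp only [ofCoeffs, Mon.sum_univ, Fin.sum_univ_succ, Fin.sum_univ_zero, monList,
    Matrix.cons_val_zero, Matrix.cons_val_succ, monomial_mon]
  ring

lemma ofCoeffs_monVec (v : Fin 15 → R) : ofCoeffs (monVec v) =
C (v 0) * (X 0 ^ 4 * X 1 ^ 0 * X 2 ^ 0) +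
      C (v 1) * (X 0 ^ 3 * X 1 ^ 1 * X 2 ^ 0) +
      C (v 2) * (X 0 ^ 3 * X 1 ^ 0 * X 2 ^ 1) +
      C (v 3) * (X 0 ^ 2 * X 1 ^ 2 * X 2 ^ 0) +
      C (v 4) * (X 0 ^ 2 * X 1 ^ 1 * X 2 ^ 1) +
      C (v 5) * (X 0 ^ 2 * X 1 ^ 0 * X 2 ^ 2) +
      C (v 6) * (X 0 ^ 1 * X 1 ^ 3 * X 2 ^ 0) +
      C (v 7) * (X 0 ^ 1 * X 1 ^ 2 * X 2 ^ 1) +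
      C (v 8) * (X 0 ^ 1 * X 1 ^ 1 * X 2 ^ 2) +
      C (v 9) * (X 0 ^ 1 * X 1 ^ 0 * X 2 ^ 3) +
      C (v 10) * (X 0 ^ 0 * X 1 ^ 4 * X 2 ^ 0) +
      C (v 11) * (X 0 ^ 0 * X 1 ^ 3 * X 2 ^ 1) +
      C (v 12) * (X 0 ^ 0 * X 1 ^ 2 * X 2 ^ 2) +
      C (v 13) * (X 0 ^ 0 * X 1 ^ 1 * X 2 ^ 3) +
      C (v 14) * (X 0 ^ 0 * X 1 ^ 0 * X 2 ^ 4) := by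
  simp only [ofCoeffs_eq, monVec_400, monVec_310, monVec_301, monVec_220, monVec_211, monVec_202,
    monVec_130, monVec_121, monVec_112, monVec_103, monVec_040, monVec_031, monVec_022, monVec_013,
    monVec_004]

lemma polarValue_400 (a : Mon → R) : polarValue (mon 4 0 0).1 (ofCoeffs a) =
      C (a (mon 0 4 0)) * 24 * (X 2 ^ 4) + C (a (mon 0 2 2)) * 24 * (X 1 ^ 2 * X 2 ^ 2) +
      C (a (mon 0 0 4)) * 24 * (X 1 ^ 4) - C (a (mon 0 3 1)) * 24 * (X 1 * X 2 ^ 3) -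
      C (a (mon 0 1 3)) * 24 * (X 1 ^ 3 * X 2) := by
  simp only [polarValue, mon_zero, mon_one, mon_two, pow_succ, pow_zero, one_mul,
    Module.End.mul_apply, polarOp_zero, polarOp_one, polarOp_two, map_sub, map_smul,
    constantCoeff_smul']
  simp [constantCoeff_pderiv_four, occ, Nat.factorial, coeff_expo_ofCoeffs]
  ring

lemma polarValue_310 (a : Mon → R) : polarValue (mon 3 1 0).1 (ofCoeffs a) =
      C (a (mon 1 2 1)) * 6 * (X 1 * X 2 ^ 3) + C (a (mon 1 0 3)) * 6 * (X 1 ^ 3 * X 2) +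
      C (a (mon 0 3 1)) * 6 * (X 0 * X 2 ^ 3) + C (a (mon 0 1 3)) * 18 * (X 0 * X 1 ^ 2 * X 2) -
      C (a (mon 1 3 0)) * 6 * (X 2 ^ 4) - C (a (mon 1 1 2)) * 6 * (X 1 ^ 2 * X 2 ^ 2) -
      C (a (mon 0 2 2)) * 12 * (X 0 * X 1 * X 2 ^ 2) - C (a (mon 0 0 4)) * 24 * (X 0 * X 1 ^ 3) := by
  simp only [polarValue, mon_zero, mon_one, mon_two, pow_succ, pow_zero, one_mul,
    Module.End.mul_apply, polarOp_zero, polarOp_one, polarOp_two, map_sub, map_smul,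
    constantCoeff_smul']
  simp [constantCoeff_pderiv_four, occ, Nat.factorial, coeff_expo_ofCoeffs]
  ring

lemma polarValue_301 (a : Mon → R) : polarValue (mon 3 0 1).1 (ofCoeffs a) =
      C (a (mon 1 3 0)) * 6 * (X 1 * X 2 ^ 3) + C (a (mon 1 1 2)) * 6 * (X 1 ^ 3 * X 2) +
      C (a (mon 0 3 1)) * 18 * (X 0 * X 1 * X 2 ^ 2) + C (a (mon 0 1 3)) * 6 * (X 0 * X 1 ^ 3) -
      C (a (mon 1 2 1)) * 6 * (X 1 ^ 2 * X 2 ^ 2) - C (a (mon 1 0 3)) * 6 * (X 1 ^ 4) -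
      C (a (mon 0 4 0)) * 24 * (X 0 * X 2 ^ 3) - C (a (mon 0 2 2)) * 12 * (X 0 * X 1 ^ 2 * X 2) := by
  simp only [polarValue, mon_zero, mon_one, mon_two, pow_succ, pow_zero, one_mul,
    Module.End.mul_apply, polarOp_zero, polarOp_one, polarOp_two, map_sub, map_smul,
    constantCoeff_smul']
  simp [constantCoeff_pderiv_four, occ, Nat.factorial, coeff_expo_ofCoeffs]
  ring

lemma polarValue_220 (a : Mon → R) : polarValue (mon 2 2 0).1 (ofCoeffs a) =
      C (a (mon 2 2 0)) * 4 * (X 2 ^ 4) + C (a (mon 2 0 2)) * 4 * (X 1 ^ 2 * X 2 ^ 2) +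
      C (a (mon 1 1 2)) * 8 * (X 0 * X 1 * X 2 ^ 2) + C (a (mon 0 2 2)) * 4 * (X 0 ^ 2 * X 2 ^ 2) +
      C (a (mon 0 0 4)) * 24 * (X 0 ^ 2 * X 1 ^ 2) - C (a (mon 2 1 1)) * 4 * (X 1 * X 2 ^ 3) -
      C (a (mon 1 2 1)) * 4 * (X 0 * X 2 ^ 3) - C (a (mon 1 0 3)) * 12 * (X 0 * X 1 ^ 2 * X 2) -
      C (a (mon 0 1 3)) * 12 * (X 0 ^ 2 * X 1 * X 2) := by
  simp only [polarValue, mon_zero, mon_one, mon_two, pow_succ, pow_zero, one_mul,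
    Module.End.mul_apply, polarOp_zero, polarOp_one, polarOp_two, map_sub, map_smul,
    constantCoeff_smul']
  simp [constantCoeff_pderiv_four, occ, Nat.factorial, coeff_expo_ofCoeffs]
  ring

lemma polarValue_211 (a : Mon → R) : polarValue (mon 2 1 1).1 (ofCoeffs a) =
      C (a (mon 2 1 1)) * 4 * (X 1 ^ 2 * X 2 ^ 2) + C (a (mon 1 3 0)) * 6 * (X 0 * X 2 ^ 3) +
      C (a (mon 1 0 3)) * 6 * (X 0 * X 1 ^ 3) + C (a (mon 0 2 2)) * 8 * (X 0 ^ 2 * X 1 * X 2) -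
      C (a (mon 2 2 0)) * 4 * (X 1 * X 2 ^ 3) - C (a (mon 2 0 2)) * 4 * (X 1 ^ 3 * X 2) -
      C (a (mon 1 2 1)) * 2 * (X 0 * X 1 * X 2 ^ 2) -
      C (a (mon 1 1 2)) * 2 * (X 0 * X 1 ^ 2 * X 2) - C (a (mon 0 3 1)) * 6 * (X 0 ^ 2 * X 2 ^ 2) -
      C (a (mon 0 1 3)) * 6 * (X 0 ^ 2 * X 1 ^ 2) := by
  simp only [polarValue, mon_zero, mon_one, mon_two, pow_succ, pow_zero, one_mul,
    Module.End.mul_apply, polarOp_zero, polarOp_one, polarOp_two, map_sub, map_smul,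
    constantCoeff_smul']
  simp [constantCoeff_pderiv_four, occ, Nat.factorial, coeff_expo_ofCoeffs]
  ring

lemma polarValue_202 (a : Mon → R) : polarValue (mon 2 0 2).1 (ofCoeffs a) =
      C (a (mon 2 2 0)) * 4 * (X 1 ^ 2 * X 2 ^ 2) + C (a (mon 2 0 2)) * 4 * (X 1 ^ 4) +
      C (a (mon 1 2 1)) * 8 * (X 0 * X 1 ^ 2 * X 2) + C (a (mon 0 4 0)) * 24 * (X 0 ^ 2 * X 2 ^ 2) +
      C (a (mon 0 2 2)) * 4 * (X 0 ^ 2 * X 1 ^ 2) - C (a (mon 2 1 1)) * 4 * (X 1 ^ 3 * X 2) -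
      C (a (mon 1 3 0)) * 12 * (X 0 * X 1 * X 2 ^ 2) - C (a (mon 1 1 2)) * 4 * (X 0 * X 1 ^ 3) -
      C (a (mon 0 3 1)) * 12 * (X 0 ^ 2 * X 1 * X 2) := by
  simp only [polarValue, mon_zero, mon_one, mon_two, pow_succ, pow_zero, one_mul,
    Module.End.mul_apply, polarOp_zero, polarOp_one, polarOp_two, map_sub, map_smul,
    constantCoeff_smul']
  simp [constantCoeff_pderiv_four, occ, Nat.factorial, coeff_expo_ofCoeffs]
  ring

lemma polarValue_130 (a : Mon → R) : polarValue (mon 1 3 0).1 (ofCoeffs a) =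
      C (a (mon 3 0 1)) * 6 * (X 1 * X 2 ^ 3) + C (a (mon 2 1 1)) * 6 * (X 0 * X 2 ^ 3) +
      C (a (mon 1 0 3)) * 18 * (X 0 ^ 2 * X 1 * X 2) + C (a (mon 0 1 3)) * 6 * (X 0 ^ 3 * X 2) -
      C (a (mon 3 1 0)) * 6 * (X 2 ^ 4) - C (a (mon 2 0 2)) * 12 * (X 0 * X 1 * X 2 ^ 2) -
      C (a (mon 1 1 2)) * 6 * (X 0 ^ 2 * X 2 ^ 2) - C (a (mon 0 0 4)) * 24 * (X 0 ^ 3 * X 1) := by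
  simp only [polarValue, mon_zero, mon_one, mon_two, pow_succ, pow_zero, one_mul,
    Module.End.mul_apply, polarOp_zero, polarOp_one, polarOp_two, map_sub, map_smul,
    constantCoeff_smul']
  simp [constantCoeff_pderiv_four, occ, Nat.factorial, coeff_expo_ofCoeffs]
  ring

lemma polarValue_121 (a : Mon → R) : polarValue (mon 1 2 1).1 (ofCoeffs a) =
      C (a (mon 3 1 0)) * 6 * (X 1 * X 2 ^ 3) + C (a (mon 2 0 2)) * 8 * (X 0 * X 1 ^ 2 * X 2) +
      C (a (mon 1 2 1)) * 4 * (X 0 ^ 2 * X 2 ^ 2) + C (a (mon 0 1 3)) * 6 * (X 0 ^ 3 * X 1) -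
      C (a (mon 3 0 1)) * 6 * (X 1 ^ 2 * X 2 ^ 2) - C (a (mon 2 2 0)) * 4 * (X 0 * X 2 ^ 3) -
      C (a (mon 2 1 1)) * 2 * (X 0 * X 1 * X 2 ^ 2) -
      C (a (mon 1 1 2)) * 2 * (X 0 ^ 2 * X 1 * X 2) - C (a (mon 1 0 3)) * 6 * (X 0 ^ 2 * X 1 ^ 2) -
      C (a (mon 0 2 2)) * 4 * (X 0 ^ 3 * X 2) := by
  simp only [polarValue, mon_zero, mon_one, mon_two, pow_succ, pow_zero, one_mul,
    Module.End.mul_apply, polarOp_zero, polarOp_one, polarOp_two, map_sub, map_smul,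
    constantCoeff_smul']
  simp [constantCoeff_pderiv_four, occ, Nat.factorial, coeff_expo_ofCoeffs]
  ring

lemma polarValue_112 (a : Mon → R) : polarValue (mon 1 1 2).1 (ofCoeffs a) =
      C (a (mon 3 0 1)) * 6 * (X 1 ^ 3 * X 2) + C (a (mon 2 2 0)) * 8 * (X 0 * X 1 * X 2 ^ 2) +
      C (a (mon 1 1 2)) * 4 * (X 0 ^ 2 * X 1 ^ 2) + C (a (mon 0 3 1)) * 6 * (X 0 ^ 3 * X 2) -
      C (a (mon 3 1 0)) * 6 * (X 1 ^ 2 * X 2 ^ 2) - C (a (mon 2 1 1)) * 2 * (X 0 * X 1 ^ 2 * X 2) -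
      C (a (mon 2 0 2)) * 4 * (X 0 * X 1 ^ 3) - C (a (mon 1 3 0)) * 6 * (X 0 ^ 2 * X 2 ^ 2) -
      C (a (mon 1 2 1)) * 2 * (X 0 ^ 2 * X 1 * X 2) - C (a (mon 0 2 2)) * 4 * (X 0 ^ 3 * X 1) := by
  simp only [polarValue, mon_zero, mon_one, mon_two, pow_succ, pow_zero, one_mul,
    Module.End.mul_apply, polarOp_zero, polarOp_one, polarOp_two, map_sub, map_smul,
    constantCoeff_smul']
  simp [constantCoeff_pderiv_four, occ, Nat.factorial, coeff_expo_ofCoeffs]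
  ring

lemma polarValue_103 (a : Mon → R) : polarValue (mon 1 0 3).1 (ofCoeffs a) =
      C (a (mon 3 1 0)) * 6 * (X 1 ^ 3 * X 2) + C (a (mon 2 1 1)) * 6 * (X 0 * X 1 ^ 3) +
      C (a (mon 1 3 0)) * 18 * (X 0 ^ 2 * X 1 * X 2) + C (a (mon 0 3 1)) * 6 * (X 0 ^ 3 * X 1) -
      C (a (mon 3 0 1)) * 6 * (X 1 ^ 4) - C (a (mon 2 2 0)) * 12 * (X 0 * X 1 ^ 2 * X 2) -
      C (a (mon 1 2 1)) * 6 * (X 0 ^ 2 * X 1 ^ 2) - C (a (mon 0 4 0)) * 24 * (X 0 ^ 3 * X 2) := by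
  simp only [polarValue, mon_zero, mon_one, mon_two, pow_succ, pow_zero, one_mul,
    Module.End.mul_apply, polarOp_zero, polarOp_one, polarOp_two, map_sub, map_smul,
    constantCoeff_smul']
  simp [constantCoeff_pderiv_four, occ, Nat.factorial, coeff_expo_ofCoeffs]
  ring

lemma polarValue_040 (a : Mon → R) : polarValue (mon 0 4 0).1 (ofCoeffs a) =
      C (a (mon 4 0 0)) * 24 * (X 2 ^ 4) + C (a (mon 2 0 2)) * 24 * (X 0 ^ 2 * X 2 ^ 2) +
      C (a (mon 0 0 4)) * 24 * (X 0 ^ 4) - C (a (mon 3 0 1)) * 24 * (X 0 * X 2 ^ 3) -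
      C (a (mon 1 0 3)) * 24 * (X 0 ^ 3 * X 2) := by
  simp only [polarValue, mon_zero, mon_one, mon_two, pow_succ, pow_zero, one_mul,
    Module.End.mul_apply, polarOp_zero, polarOp_one, polarOp_two, map_sub, map_smul,
    constantCoeff_smul']
  simp [constantCoeff_pderiv_four, occ, Nat.factorial, coeff_expo_ofCoeffs]
  ring

lemma polarValue_031 (a : Mon → R) : polarValue (mon 0 3 1).1 (ofCoeffs a) =
      C (a (mon 3 1 0)) * 6 * (X 0 * X 2 ^ 3) + C (a (mon 3 0 1)) * 18 * (X 0 * X 1 * X 2 ^ 2) +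
      C (a (mon 1 1 2)) * 6 * (X 0 ^ 3 * X 2) + C (a (mon 1 0 3)) * 6 * (X 0 ^ 3 * X 1) -
      C (a (mon 4 0 0)) * 24 * (X 1 * X 2 ^ 3) - C (a (mon 2 1 1)) * 6 * (X 0 ^ 2 * X 2 ^ 2) -
      C (a (mon 2 0 2)) * 12 * (X 0 ^ 2 * X 1 * X 2) - C (a (mon 0 1 3)) * 6 * (X 0 ^ 4) := by
  simp only [polarValue, mon_zero, mon_one, mon_two, pow_succ, pow_zero, one_mul,
    Module.End.mul_apply, polarOp_zero, polarOp_one, polarOp_two, map_sub, map_smul,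
    constantCoeff_smul']
  simp [constantCoeff_pderiv_four, occ, Nat.factorial, coeff_expo_ofCoeffs]
  ring

lemma polarValue_022 (a : Mon → R) : polarValue (mon 0 2 2).1 (ofCoeffs a) =
      C (a (mon 4 0 0)) * 24 * (X 1 ^ 2 * X 2 ^ 2) + C (a (mon 2 2 0)) * 4 * (X 0 ^ 2 * X 2 ^ 2) +
      C (a (mon 2 1 1)) * 8 * (X 0 ^ 2 * X 1 * X 2) + C (a (mon 2 0 2)) * 4 * (X 0 ^ 2 * X 1 ^ 2) +
      C (a (mon 0 2 2)) * 4 * (X 0 ^ 4) - C (a (mon 3 1 0)) * 12 * (X 0 * X 1 * X 2 ^ 2) -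
      C (a (mon 3 0 1)) * 12 * (X 0 * X 1 ^ 2 * X 2) - C (a (mon 1 2 1)) * 4 * (X 0 ^ 3 * X 2) -
      C (a (mon 1 1 2)) * 4 * (X 0 ^ 3 * X 1) := by
  simp only [polarValue, mon_zero, mon_one, mon_two, pow_succ, pow_zero, one_mul,
    Module.End.mul_apply, polarOp_zero, polarOp_one, polarOp_two, map_sub, map_smul,
    constantCoeff_smul']
  simp [constantCoeff_pderiv_four, occ, Nat.factorial, coeff_expo_ofCoeffs]
  ring

lemma polarValue_013 (a : Mon → R) : polarValue (mon 0 1 3).1 (ofCoeffs a) =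
      C (a (mon 3 1 0)) * 18 * (X 0 * X 1 ^ 2 * X 2) + C (a (mon 3 0 1)) * 6 * (X 0 * X 1 ^ 3) +
      C (a (mon 1 3 0)) * 6 * (X 0 ^ 3 * X 2) + C (a (mon 1 2 1)) * 6 * (X 0 ^ 3 * X 1) -
      C (a (mon 4 0 0)) * 24 * (X 1 ^ 3 * X 2) - C (a (mon 2 2 0)) * 12 * (X 0 ^ 2 * X 1 * X 2) -
      C (a (mon 2 1 1)) * 6 * (X 0 ^ 2 * X 1 ^ 2) - C (a (mon 0 3 1)) * 6 * (X 0 ^ 4) := by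
  simp only [polarValue, mon_zero, mon_one, mon_two, pow_succ, pow_zero, one_mul,
    Module.End.mul_apply, polarOp_zero, polarOp_one, polarOp_two, map_sub, map_smul,
    constantCoeff_smul']
  simp [constantCoeff_pderiv_four, occ, Nat.factorial, coeff_expo_ofCoeffs]
  ring

lemma polarValue_004 (a : Mon → R) : polarValue (mon 0 0 4).1 (ofCoeffs a) =
      C (a (mon 4 0 0)) * 24 * (X 1 ^ 4) + C (a (mon 2 2 0)) * 24 * (X 0 ^ 2 * X 1 ^ 2) +
      C (a (mon 0 4 0)) * 24 * (X 0 ^ 4) - C (a (mon 3 1 0)) * 24 * (X 0 * X 1 ^ 3) -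
      C (a (mon 1 3 0)) * 24 * (X 0 ^ 3 * X 1) := by
  simp only [polarValue, mon_zero, mon_one, mon_two, pow_succ, pow_zero, one_mul,
    Module.End.mul_apply, polarOp_zero, polarOp_one, polarOp_two, map_sub, map_smul,
    constantCoeff_smul']
  simp [constantCoeff_pderiv_four, occ, Nat.factorial, coeff_expo_ofCoeffs]
  ring

/-- The only use of the differential operators. From here on, `h` is the polynomial map `quad`,
which makes sense over every ring and commutes with ring homomorphisms. -/
theorem harmonicForm_ofCoeffs (a : Mon → R) : harmonicForm (ofCoeffs a) = ofCoeffs (quad a) := by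
  rw [harmonicForm_ofCoeffs_eq_sum, Mon.sum_univ, quad, ofCoeffs_monVec]
  simp only [Fin.sum_univ_succ, Fin.sum_univ_zero, monList,
    Matrix.cons_val_zero, Matrix.cons_val_succ, polarValue_400, polarValue_310, polarValue_301,
      polarValue_220, polarValue_211, polarValue_202, polarValue_130, polarValue_121,
      polarValue_112, polarValue_103, polarValue_040, polarValue_031, polarValue_022,
      polarValue_013, polarValue_004]
  simp only [Matrix.cons_val, map_add, map_sub, map_neg, map_mul, map_pow, map_ofNat]
  ring

end ExplicitForm

/-! ### The contraction identities and the relations that characterize the fiber. -/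

section Equations

variable {R : Type u} [CommRing R]

lemma map_quad {S : Type*} [CommRing S] (φ : R →+* S) (a : Mon → R) (u : Mon) :
    φ (quad a u) = quad (fun m => φ (a m)) u := by
  revert u
  refine Mon.forall fun i => ?_
  simp only [quad, monVec_monList]
  fin_cases i <;> simp [_root_.map_ofNat]

lemma harmonicCoeffs_eq (k : Type u) [Field k] : harmonicCoeffs k = quad X := by
  rw [harmonicCoeffs, harmonicForm_ofCoeffs, coeffs_ofCoeffs]

/-- Homogeneity of degree two, needed to compare homogeneous coordinates that are normalized
differently. -/
lemma quad_smul (c : R) (a : Mon → R) (u : Mon) :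
    quad (fun m => c * a m) u = c ^ 2 * quad a u := by
  revert u
  refine Mon.forall fun i => ?_
  simp only [quad, monVec_monList]
  fin_cases i <;> simp only [Fin.reduceFinMk, Fin.mk_one, Fin.zero_eta, Matrix.cons_val] <;> ring

/-- The matrix of the `𝔤𝔩₃`-equivariant contraction of a quartic in the plane with coefficients `a`
and a quartic in the dual plane with coefficients `b`. -/
def contraction (a b : Mon → R) : Fin 3 → Fin 3 → R :=
  ![![48 * (a (mon 4 0 0) * b (mon 4 0 0)) + 9 * (a (mon 3 1 0) * b (mon 3 1 0)) +
      9 * (a (mon 3 0 1) * b (mon 3 0 1)) + 4 * (a (mon 2 2 0) * b (mon 2 2 0)) +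
      2 * (a (mon 2 1 1) * b (mon 2 1 1)) + 4 * (a (mon 2 0 2) * b (mon 2 0 2)) +
      3 * (a (mon 1 3 0) * b (mon 1 3 0)) + 1 * (a (mon 1 2 1) * b (mon 1 2 1)) +
      1 * (a (mon 1 1 2) * b (mon 1 1 2)) + 3 * (a (mon 1 0 3) * b (mon 1 0 3)),
     12 * (a (mon 4 0 0) * b (mon 3 1 0)) + 6 * (a (mon 3 1 0) * b (mon 2 2 0)) +
      3 * (a (mon 3 0 1) * b (mon 2 1 1)) + 6 * (a (mon 2 2 0) * b (mon 1 3 0)) +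
      2 * (a (mon 2 1 1) * b (mon 1 2 1)) + 2 * (a (mon 2 0 2) * b (mon 1 1 2)) +
      12 * (a (mon 1 3 0) * b (mon 0 4 0)) + 3 * (a (mon 1 2 1) * b (mon 0 3 1)) +
      2 * (a (mon 1 1 2) * b (mon 0 2 2)) + 3 * (a (mon 1 0 3) * b (mon 0 1 3)),
     12 * (a (mon 4 0 0) * b (mon 3 0 1)) + 3 * (a (mon 3 1 0) * b (mon 2 1 1)) +
      6 * (a (mon 3 0 1) * b (mon 2 0 2)) + 2 * (a (mon 2 2 0) * b (mon 1 2 1)) +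
      2 * (a (mon 2 1 1) * b (mon 1 1 2)) + 6 * (a (mon 2 0 2) * b (mon 1 0 3)) +
      3 * (a (mon 1 3 0) * b (mon 0 3 1)) + 2 * (a (mon 1 2 1) * b (mon 0 2 2)) +
      3 * (a (mon 1 1 2) * b (mon 0 1 3)) + 12 * (a (mon 1 0 3) * b (mon 0 0 4))],
    ![12 * (a (mon 3 1 0) * b (mon 4 0 0)) + 6 * (a (mon 2 2 0) * b (mon 3 1 0)) +
      3 * (a (mon 2 1 1) * b (mon 3 0 1)) + 6 * (a (mon 1 3 0) * b (mon 2 2 0)) +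
      2 * (a (mon 1 2 1) * b (mon 2 1 1)) + 2 * (a (mon 1 1 2) * b (mon 2 0 2)) +
      12 * (a (mon 0 4 0) * b (mon 1 3 0)) + 3 * (a (mon 0 3 1) * b (mon 1 2 1)) +
      2 * (a (mon 0 2 2) * b (mon 1 1 2)) + 3 * (a (mon 0 1 3) * b (mon 1 0 3)),
     3 * (a (mon 3 1 0) * b (mon 3 1 0)) + 4 * (a (mon 2 2 0) * b (mon 2 2 0)) +
      1 * (a (mon 2 1 1) * b (mon 2 1 1)) + 9 * (a (mon 1 3 0) * b (mon 1 3 0)) +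
      2 * (a (mon 1 2 1) * b (mon 1 2 1)) + 1 * (a (mon 1 1 2) * b (mon 1 1 2)) +
      48 * (a (mon 0 4 0) * b (mon 0 4 0)) + 9 * (a (mon 0 3 1) * b (mon 0 3 1)) +
      4 * (a (mon 0 2 2) * b (mon 0 2 2)) + 3 * (a (mon 0 1 3) * b (mon 0 1 3)),
     3 * (a (mon 3 1 0) * b (mon 3 0 1)) + 2 * (a (mon 2 2 0) * b (mon 2 1 1)) +
      2 * (a (mon 2 1 1) * b (mon 2 0 2)) + 3 * (a (mon 1 3 0) * b (mon 1 2 1)) +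
      2 * (a (mon 1 2 1) * b (mon 1 1 2)) + 3 * (a (mon 1 1 2) * b (mon 1 0 3)) +
      12 * (a (mon 0 4 0) * b (mon 0 3 1)) + 6 * (a (mon 0 3 1) * b (mon 0 2 2)) +
      6 * (a (mon 0 2 2) * b (mon 0 1 3)) + 12 * (a (mon 0 1 3) * b (mon 0 0 4))],
    ![12 * (a (mon 3 0 1) * b (mon 4 0 0)) + 3 * (a (mon 2 1 1) * b (mon 3 1 0)) +
      6 * (a (mon 2 0 2) * b (mon 3 0 1)) + 2 * (a (mon 1 2 1) * b (mon 2 2 0)) +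
      2 * (a (mon 1 1 2) * b (mon 2 1 1)) + 6 * (a (mon 1 0 3) * b (mon 2 0 2)) +
      3 * (a (mon 0 3 1) * b (mon 1 3 0)) + 2 * (a (mon 0 2 2) * b (mon 1 2 1)) +
      3 * (a (mon 0 1 3) * b (mon 1 1 2)) + 12 * (a (mon 0 0 4) * b (mon 1 0 3)),
     3 * (a (mon 3 0 1) * b (mon 3 1 0)) + 2 * (a (mon 2 1 1) * b (mon 2 2 0)) +
      2 * (a (mon 2 0 2) * b (mon 2 1 1)) + 3 * (a (mon 1 2 1) * b (mon 1 3 0)) +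
      2 * (a (mon 1 1 2) * b (mon 1 2 1)) + 3 * (a (mon 1 0 3) * b (mon 1 1 2)) +
      12 * (a (mon 0 3 1) * b (mon 0 4 0)) + 6 * (a (mon 0 2 2) * b (mon 0 3 1)) +
      6 * (a (mon 0 1 3) * b (mon 0 2 2)) + 12 * (a (mon 0 0 4) * b (mon 0 1 3)),
     3 * (a (mon 3 0 1) * b (mon 3 0 1)) + 1 * (a (mon 2 1 1) * b (mon 2 1 1)) +
      4 * (a (mon 2 0 2) * b (mon 2 0 2)) + 1 * (a (mon 1 2 1) * b (mon 1 2 1)) +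
      2 * (a (mon 1 1 2) * b (mon 1 1 2)) + 9 * (a (mon 1 0 3) * b (mon 1 0 3)) +
      3 * (a (mon 0 3 1) * b (mon 0 3 1)) + 4 * (a (mon 0 2 2) * b (mon 0 2 2)) +
      9 * (a (mon 0 1 3) * b (mon 0 1 3)) + 48 * (a (mon 0 0 4) * b (mon 0 0 4))]]

lemma map_contraction {S : Type*} [CommRing S] (φ : R →+* S) (a b : Mon → R) (i j : Fin 3) :
    φ (contraction a b i j) = contraction (fun m => φ (a m)) (fun m => φ (b m)) i j := by
  fin_cases i <;> fin_cases j <;> simp [contraction, _root_.map_ofNat]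

/-- The contraction of a quartic with its harmonic form is a scalar matrix. -/
lemma contraction_quad (a : Mon → R) (c : R) {i j : Fin 3} (hij : i ≠ j) :
    contraction a (fun m => c * quad a m) i j = 0 := by
  fin_cases i <;> fin_cases j <;> first | exact absurd rfl hij | skip
  all_goals
    simp only [contraction, quad, monVec_400, monVec_310, monVec_301, monVec_220, monVec_211,
      monVec_202, monVec_130, monVec_121, monVec_112, monVec_103, monVec_040, monVec_031,
      monVec_022, monVec_013, monVec_004]
    simp only [Fin.reduceFinMk, Fin.mk_one, Fin.zero_eta, Matrix.cons_val]
    ring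

/-- Infinitesimal invariance of the cubic `⟨q, h(q)⟩` under the traceless diagonal matrices. The
common diagonal value is, up to a constant, that cubic itself. -/
lemma contraction_quad_diag (a : Mon → R) (c : R) (i : Fin 3) :
    contraction a (fun m => c * quad a m) i i = contraction a (fun m => c * quad a m) 0 0 := by
  fin_cases i <;> [rfl; skip; skip]
  all_goals
    simp only [contraction, quad, monVec_400, monVec_310, monVec_301, monVec_220, monVec_211,
      monVec_202, monVec_130, monVec_121, monVec_112, monVec_103, monVec_040, monVec_031,
      monVec_022, monVec_013, monVec_004]
    simp only [Fin.reduceFinMk, Fin.mk_one, Fin.zero_eta, Matrix.cons_val]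
    ring

/-- The coefficients of the Fermat quartic. -/
def fermatVec : Mon → R := monVec ![1, 0, 0, 0, 0, 0, 0, 0, 0, 0, 1, 0, 0, 0, 1]

/-- The coefficients of the quartic
`x⁴ + y⁴ + z⁴ + 6 (a y² z² + b x² z² + c x² y²) + 12 x y z (l x + m y + n z)`. -/
def sixVec (a b c l m n : R) : Mon → R :=
  monVec ![1, 0, 0, 6 * c, 12 * l, 6 * b, 0, 12 * m, 12 * n, 0, 1, 0, 6 * a, 0, 1]

/-- The conditions under which the harmonic form of the quartic with coefficients
`sixVec a b c l m n` is a multiple of the Fermat quartic. -/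
structure FermatRel (a b c l m n : R) : Prop where
  ab : a ^ 2 = b ^ 2
  bc : b ^ 2 = c ^ 2
  an : a * n = 0
  am : a * m = 0
  bn : b * n = 0
  bl : b * l = 0
  cm : c * m = 0
  cl : c * l = 0
  nn : c + a * b + 2 * n ^ 2 = 0
  mm : b + a * c + 2 * m ^ 2 = 0
  ll : a + b * c + 2 * l ^ 2 = 0
  al : 2 * (a * l) = m * n
  bm : 2 * (b * m) = l * n
  cn : 2 * (c * n) = l * m

lemma map_sixVec {S : Type*} [CommRing S] (φ : R →+* S) (a b c l m n : R) (u : Mon) :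
    φ (sixVec a b c l m n u) = sixVec (φ a) (φ b) (φ c) (φ l) (φ m) (φ n) u := by
  revert u
  refine Mon.forall fun i => ?_
  simp only [sixVec, monVec_monList]
  fin_cases i <;> simp [_root_.map_ofNat]

lemma map_fermatVec {S : Type*} [CommRing S] (φ : R →+* S) (u : Mon) :
    φ (fermatVec u) = fermatVec u := by
  revert u
  refine Mon.forall fun i => ?_
  simp only [fermatVec, monVec_monList]
  fin_cases i <;> simp [_root_.map_ofNat]

/-- Each coefficient of `h(q)` off the Fermat monomials is a multiple by `±288` or `±576` of one
relation. The relations between squares make the coefficients at `u⁴`, `v⁴`, `w⁴` equal, and their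
common value is `48 + 144 a²`. -/
lemma FermatRel.quad_sixVec {a b c l m n : R} (h : FermatRel a b c l m n) :
    quad (sixVec a b c l m n) = fun u => 48 * (1 + 3 * a ^ 2) * fermatVec u := by
  obtain ⟨ab, bc, an, am, bn, bl, cm, cl, nn, mm, ll, al, bm, cn⟩ := h
  funext u
  revert u
  refine Mon.forall fun i => ?_
  simp only [quad, sixVec, fermatVec, monVec_monList, monVec_400, monVec_310, monVec_301,
    monVec_220, monVec_211, monVec_202, monVec_130, monVec_121, monVec_112, monVec_103, monVec_040,
    monVec_031, monVec_022, monVec_013, monVec_004]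
  fin_cases i <;> simp only [Fin.reduceFinMk, Fin.mk_one, Fin.zero_eta, Matrix.cons_val]
  · ring
  · linear_combination (-576) * an
  · linear_combination (-576) * am
  · linear_combination 288 * nn
  · linear_combination 576 * al
  · linear_combination 288 * mm
  · linear_combination (-576) * bn
  · linear_combination 576 * bm
  · linear_combination 576 * cn
  · linear_combination (-576) * cm
  · linear_combination (-144) * ab
  · linear_combination (-576) * bl
  · linear_combination 288 * ll
  · linear_combination (-576) * cl
  · linear_combination (-144) * ab - 144 * bc

end Equations

/-! ### Solving the equations over the Fermat quartic. -/

section FermatEquations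

variable {R : Type u} [CommRing R]

/-- The equations in the coefficients `a` that the closure of the graph imposes on a pair of
quartics with coefficients `a` and `fermatVec`. -/
structure InFermatFiber (a : Mon → R) : Prop where
  off_diag : ∀ i j, i ≠ j → contraction a fermatVec i j = 0
  diag : ∀ i, contraction a fermatVec i i = contraction a fermatVec 0 0
  minors : ∀ u v, quad a u * fermatVec v = quad a v * fermatVec u

/-- The number `576 = 2⁶ · 3²` serves as a common multiple of the numerical factors that occur
below; it divides `6⁶ = 81 · 576`. -/
lemma eq_zero_of_isUnit_six (h6 : IsUnit (6 : R)) {x : R} (h : 576 * x = 0) : x = 0 := by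
  refine (h6.pow 6).mul_right_eq_zero.mp ?_
  linear_combination 81 * h

/-- The linear equations and the quadratic equations in a useful form. -/
structure FermatEqs (a : Mon → R) : Prop where
  h310 : a (mon 3 1 0) = 0
  h301 : a (mon 3 0 1) = 0
  h130 : a (mon 1 3 0) = 0
  h031 : a (mon 0 3 1) = 0
  h103 : a (mon 1 0 3) = 0
  h013 : a (mon 0 1 3) = 0
  h040 : a (mon 0 4 0) = a (mon 4 0 0)
  h004 : a (mon 0 0 4) = a (mon 4 0 0)

lemma InFermatFiber.eqs (h6 : IsUnit (6 : R)) {a : Mon → R} (h : InFermatFiber a) :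
    FermatEqs a := by
  have e01 := h.off_diag 0 1 (by decide)
  have e02 := h.off_diag 0 2 (by decide)
  have e10 := h.off_diag 1 0 (by decide)
  have e12 := h.off_diag 1 2 (by decide)
  have e20 := h.off_diag 2 0 (by decide)
  have e21 := h.off_diag 2 1 (by decide)
  have e1 := h.diag 1
  have e2 := h.diag 2
  simp only [contraction, fermatVec, monVec_400, monVec_310, monVec_301, monVec_220, monVec_211,
    monVec_202, monVec_130, monVec_121, monVec_112, monVec_103, monVec_040, monVec_031, monVec_022,
    monVec_013, monVec_004, Matrix.cons_val] at e01 e02 e10 e12 e20 e21 e1 e2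
  constructor
  · exact eq_zero_of_isUnit_six h6 (by linear_combination 48 * e10)
  · exact eq_zero_of_isUnit_six h6 (by linear_combination 48 * e20)
  · exact eq_zero_of_isUnit_six h6 (by linear_combination 48 * e01)
  · exact eq_zero_of_isUnit_six h6 (by linear_combination 48 * e21)
  · exact eq_zero_of_isUnit_six h6 (by linear_combination 48 * e02)
  · exact eq_zero_of_isUnit_six h6 (by linear_combination 48 * e12)
  · exact sub_eq_zero.mp (eq_zero_of_isUnit_six h6 (by linear_combination 12 * e1))
  · exact sub_eq_zero.mp (eq_zero_of_isUnit_six h6 (by linear_combination 12 * e2))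

/-- The linear equations leave six free coefficients. The fourteen relations are then, up to units,
the minors that compare each coefficient of `h(q)` with the one at `u⁴`. -/
lemma InFermatFiber.exists_rel (h6 : IsUnit (6 : R)) {v : Mon → R} (h : InFermatFiber v)
    (h1 : v (mon 4 0 0) = 1) :
    ∃ a b c l m n : R, FermatRel a b c l m n ∧ v = sixVec a b c l m n := by
  obtain ⟨i, hi⟩ := h6.exists_right_inv
  -- The inverse of `6` is `i`, so `3 * i ^ 2` is the inverse of `12`.
  have hv : v = sixVec (i * v (mon 0 2 2)) (i * v (mon 2 0 2)) (i * v (mon 2 2 0))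
      (3 * i ^ 2 * v (mon 2 1 1)) (3 * i ^ 2 * v (mon 1 2 1)) (3 * i ^ 2 * v (mon 1 1 2)) := by
    obtain ⟨h310, h301, h130, h031, h103, h013, h040, h004⟩ := h.eqs h6
    rw [h1] at h040 h004
    funext u
    revert u
    refine Mon.forall fun j => ?_
    rw [sixVec, monVec_monList, monList]
    fin_cases j <;> simp only [Fin.reduceFinMk, Fin.mk_one, Fin.zero_eta, Matrix.cons_val]
    · exact h1
    · exact h310
    · exact h301
    · linear_combination (-v (mon 2 2 0)) * hi
    · linear_combination (-v (mon 2 1 1)) * (6 * i + 1) * hi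
    · linear_combination (-v (mon 2 0 2)) * hi
    · exact h130
    · linear_combination (-v (mon 1 2 1)) * (6 * i + 1) * hi
    · linear_combination (-v (mon 1 1 2)) * (6 * i + 1) * hi
    · exact h103
    · exact h040
    · exact h031
    · linear_combination (-v (mon 0 2 2)) * hi
    · exact h013
    · exact h004
  refine ⟨_, _, _, _, _, _, ?_, hv⟩
  generalize i * v (mon 0 2 2) = a, i * v (mon 2 0 2) = b, i * v (mon 2 2 0) = c,
    3 * i ^ 2 * v (mon 2 1 1) = l, 3 * i ^ 2 * v (mon 1 2 1) = m,
      3 * i ^ 2 * v (mon 1 1 2) = n at hv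
  have q (u : Mon) := h.minors u (mon 4 0 0)
  have q0 := q (mon 0 4 0)
  have q1 := q (mon 0 0 4)
  have q2 := q (mon 3 1 0)
  have q3 := q (mon 3 0 1)
  have q4 := q (mon 1 3 0)
  have q5 := q (mon 0 3 1)
  have q6 := q (mon 1 0 3)
  have q7 := q (mon 0 1 3)
  have q8 := q (mon 2 2 0)
  have q9 := q (mon 2 0 2)
  have q10 := q (mon 0 2 2)
  have q11 := q (mon 2 1 1)
  have q12 := q (mon 1 2 1)
  have q13 := q (mon 1 1 2)
  clear q h1 h
  subst hv
  simp only [quad, fermatVec, sixVec, monVec_400, monVec_310, monVec_301, monVec_220, monVec_211,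
    monVec_202, monVec_130, monVec_121, monVec_112, monVec_103, monVec_040, monVec_031, monVec_022,
    monVec_013, monVec_004, Matrix.cons_val]
    at q0 q1 q2 q3 q4 q5 q6 q7 q8 q9 q10 q11 q12 q13
  constructor
  · exact sub_eq_zero.mp (eq_zero_of_isUnit_six h6 (by linear_combination (-4) * q0))
  · exact sub_eq_zero.mp (eq_zero_of_isUnit_six h6 (by linear_combination 4 * q0 - 4 * q1))
  · exact eq_zero_of_isUnit_six h6 (by linear_combination -q2)
  · exact eq_zero_of_isUnit_six h6 (by linear_combination -q3)
  · exact eq_zero_of_isUnit_six h6 (by linear_combination -q4)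
  · exact eq_zero_of_isUnit_six h6 (by linear_combination -q5)
  · exact eq_zero_of_isUnit_six h6 (by linear_combination -q6)
  · exact eq_zero_of_isUnit_six h6 (by linear_combination -q7)
  · exact eq_zero_of_isUnit_six h6 (by linear_combination 2 * q8)
  · exact eq_zero_of_isUnit_six h6 (by linear_combination 2 * q9)
  · exact eq_zero_of_isUnit_six h6 (by linear_combination 2 * q10)
  · exact sub_eq_zero.mp (eq_zero_of_isUnit_six h6 (by linear_combination q11))
  · exact sub_eq_zero.mp (eq_zero_of_isUnit_six h6 (by linear_combination q12))
  · exact sub_eq_zero.mp (eq_zero_of_isUnit_six h6 (by linear_combination q13))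

/-- If the coefficient of `x⁴` vanishes, so do those of `y⁴` and `z⁴`, and the surviving equations
are homogeneous quadrics in the six other coefficients whose only common zero over a field is the
origin. This confines the fiber to a single affine chart. -/
lemma InFermatFiber.apply_ne_zero {K : Type u} [Field K] (h6 : IsUnit (6 : K)) {v : Mon → K}
    (h : InFermatFiber v) (hv : v ≠ 0) : v (mon 4 0 0) ≠ 0 := by
  intro h400
  obtain ⟨h310, h301, h130, h031, h103, h013, h040, h004⟩ := h.eqs h6
  rw [h400] at h040 h004
  have q (u : Mon) := h.minors u (mon 4 0 0)
  have q0 := q (mon 0 4 0)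
  have q1 := q (mon 0 0 4)
  have q2 := q (mon 3 1 0)
  have q3 := q (mon 3 0 1)
  have q8 := q (mon 2 2 0)
  have q9 := q (mon 2 0 2)
  have q10 := q (mon 0 2 2)
  simp only [quad, fermatVec, monVec_400, monVec_310, monVec_301, monVec_220, monVec_211,
    monVec_202, monVec_130, monVec_121, monVec_112, monVec_103, monVec_040, monVec_031, monVec_022,
    monVec_013, monVec_004, Matrix.cons_val, h310, h301, h130,
    h031, h103, h013, h040, h004, h400] at q0 q1 q2 q3 q8 q9 q10
  set a := v (mon 0 2 2)
  set b := v (mon 2 0 2)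
  set c := v (mon 2 2 0)
  set l := v (mon 2 1 1)
  set m := v (mon 1 2 1)
  set n := v (mon 1 1 2)
  have cancel {x : K} (h : 576 * x = 0) : x = 0 := eq_zero_of_isUnit_six h6 h
  have ab : a ^ 2 - b ^ 2 = 0 := cancel (by linear_combination (-144) * q0)
  have ac : a ^ 2 - c ^ 2 = 0 := cancel (by linear_combination (-144) * q1)
  have an : a * n = 0 := cancel (by linear_combination (-72) * q2)
  have am : a * m = 0 := cancel (by linear_combination (-72) * q3)
  have nn : 2 * (a * b) + n ^ 2 = 0 := cancel (by linear_combination 144 * q8)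
  have mm : 2 * (a * c) + m ^ 2 = 0 := cancel (by linear_combination 144 * q9)
  have ll : 2 * (b * c) + l ^ 2 = 0 := cancel (by linear_combination 144 * q10)
  -- If `a ≠ 0`, then `a n = 0` gives `n = 0`, then `2 a b + n² = 0` gives `b = 0`, which
  -- contradicts `a² = b²`.
  have ha : a = 0 := by
    by_contra ha
    have hn : n = 0 := (mul_eq_zero.mp an).resolve_left ha
    have hb : b = 0 := by
      refine (mul_eq_zero.mp (cancel (x := a * b) ?_)).resolve_left ha
      linear_combination 288 * nn - 288 * n * hn
    refine ha (pow_eq_zero_iff two_ne_zero |>.mp ?_)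
    linear_combination ab + b * hb
  have hb : b = 0 := pow_eq_zero_iff two_ne_zero |>.mp (by linear_combination a * ha - ab)
  have hc : c = 0 := pow_eq_zero_iff two_ne_zero |>.mp (by linear_combination a * ha - ac)
  have hn : n = 0 := pow_eq_zero_iff two_ne_zero |>.mp (by linear_combination nn - 2 * b * ha)
  have hm : m = 0 := pow_eq_zero_iff two_ne_zero |>.mp (by linear_combination mm - 2 * c * ha)
  have hl : l = 0 := pow_eq_zero_iff two_ne_zero |>.mp (by linear_combination ll - 2 * c * hb)
  refine hv (funext fun u => ?_)
  revert u
  refine Mon.forall fun j => ?_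
  rw [monList]
  fin_cases j <;> assumption

end FermatEquations

/-! ### The five quartics and their harmonic forms. -/

section Examples

variable (k : Type u) [Field k]

lemma ofCoeffs_fermatVec : ofCoeffs (fermatVec : Mon → k) = fermat k := by
  rw [fermatVec, ofCoeffs_monVec, fermat]
  simp only [Matrix.cons_val, map_zero, map_one]
  ring

lemma ofCoeffs_sixVec_quadratic (a b c : k) :
    ofCoeffs (sixVec a b c 0 0 0) = fermat k +
      6 * (C c * (X 0 ^ 2 * X 1 ^ 2) + C b * (X 0 ^ 2 * X 2 ^ 2) + C a * (X 1 ^ 2 * X 2 ^ 2)) := by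
  rw [sixVec, ofCoeffs_monVec, fermat]
  simp only [Matrix.cons_val, map_zero, map_one, mul_zero, map_mul, _root_.map_ofNat]
  ring

lemma sixVec_zero : sixVec (0 : k) 0 0 0 0 0 = fermatVec := by
  simp only [sixVec, fermatVec, mul_zero]

/-- The signs in the equations of the curves `C₀`, `C₁`, `C₂`, `C₃`: the coefficients of `y² z²`,
`x² z²`, `x² y²`, divided by `6`. -/
def signs : Fin 4 → k × k × k := ![(-1, -1, -1), (1, 1, -1), (1, -1, 1), (-1, 1, 1)]

/-- The coefficients of `C₀`, `C₁`, `C₂`, `C₃`. -/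
def companionVec (j : Fin 4) : Mon → k := sixVec (signs k j).1 (signs k j).2.1 (signs k j).2.2 0 0 0

lemma ofCoeffs_companionVec (j : Fin 4) : ofCoeffs (companionVec k j) = companion k j := by
  rw [companionVec, ofCoeffs_sixVec_quadratic, fermat, companion]
  fin_cases j <;> simp [signs] <;> ring

lemma fermatRel_zero : FermatRel (0 : k) 0 0 0 0 0 := by
  constructor <;> simp

lemma fermatRel_signs (j : Fin 4) :
    FermatRel (signs k j).1 (signs k j).2.1 (signs k j).2.2 0 0 0 := by
  fin_cases j <;> constructor <;> simp [signs]

lemma coeffs_fermat : coeffs (fermat k) = fermatVec := by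
  rw [← ofCoeffs_fermatVec, coeffs_ofCoeffs]

lemma coeffs_companion (j : Fin 4) : coeffs (companion k j) = companionVec k j := by
  rw [← ofCoeffs_companionVec, coeffs_ofCoeffs]

lemma ofCoeffs_smul (c : k) (a : Mon → k) : ofCoeffs (fun u => c * a u) = C c * ofCoeffs a := by
  simp only [ofCoeffs, Finset.mul_sum, C_mul_monomial]

lemma FermatRel.harmonicForm_eq {a b c l m n : k} (h : FermatRel a b c l m n) :
    harmonicForm (ofCoeffs (sixVec a b c l m n)) = C (48 * (1 + 3 * a ^ 2)) * fermat k := by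
  rw [harmonicForm_ofCoeffs, h.quad_sixVec, ofCoeffs_smul, ofCoeffs_fermatVec]

theorem harmonicForm_fermat [CharZero k] :
    ∃ c : k, c ≠ 0 ∧ harmonicForm (fermat k) = C c * fermat k := by
  have h := (fermatRel_zero k).harmonicForm_eq
  rw [sixVec_zero, ofCoeffs_fermatVec] at h
  exact ⟨_, by norm_num, h⟩

theorem harmonicForm_companion [CharZero k] (j : Fin 4) :
    ∃ c : k, c ≠ 0 ∧ harmonicForm (companion k j) = C c * fermat k := by
  have h := (fermatRel_signs k j).harmonicForm_eq
  rw [← companionVec, ofCoeffs_companionVec] at h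
  exact ⟨_, by fin_cases j <;> norm_num [signs], h⟩

end Examples

/-! ### Points of projective space with values in a ring. -/

section ProjPoints

lemma basicOpen_eq_top_of_isUnit {R : Type*} [CommRing R] {f : R} (hf : IsUnit f) :
    PrimeSpectrum.basicOpen f = ⊤ :=
  top_le_iff.mp fun p _ h => p.2.ne_top (Ideal.eq_top_of_isUnit_mem _ h hf)

/-- Since `g t` is already invertible in `R`, the map of localizations factors through `R`. -/
lemma localization_map_eq_comp_lift {A G R : Type*} [CommRing A] [CommRing G] [CommRing R]
    (f : A →+* G) (i : R →+* G) (g : A →+* R) (hf : f = i.comp g) (t : A) (ht : IsUnit (g t))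
    (hle : Submonoid.powers t ≤ (Submonoid.powers (f t)).comap f) :
    (IsLocalization.map (Localization.Away (f t)) f hle : Localization.Away t →+* _) =
      (algebraMap G (Localization.Away (f t))).comp (i.comp (IsLocalization.Away.lift t ht)) := by
  refine IsLocalization.ringHom_ext (M := Submonoid.powers t) ?_
  ext x
  simp [hf]

variable {ι : Type} {k : Type u} [Field k] {R : Type u} [CommRing R] [Algebra k R]

lemma X_mem (m : ι) : (X m : MvPolynomial ι k) ∈ homogeneousSubmodule ι k 1 :=
  isHomogeneous_X k m

/-- The ring homomorphism from the coordinate ring of the chart `X m ≠ 0` of projective space that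
corresponds to the point `[c]`. -/
def awayEval (c : ι → R) (m : ι) (hm : IsUnit (c m)) :
    HomogeneousLocalization.Away (homogeneousSubmodule ι k) (X m : MvPolynomial ι k) →+* R :=
  (IsLocalization.Away.lift (S := Localization.Away (X m : MvPolynomial ι k))
    (X m : MvPolynomial ι k) (g := (aeval c : MvPolynomial ι k →ₐ[k] R).toRingHom)
    (by simpa using hm)).comp (algebraMap _ _)

/-- The inclusion of the chart `X m ≠ 0` into projective space. -/
def chart (m : ι) :
    Spec (.of (HomogeneousLocalization.Away (homogeneousSubmodule ι k) (X m : MvPolynomial ι k))) ⟶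
      projSpace ι k :=
  Proj.awayι (homogeneousSubmodule ι k) (X m) (X_mem m) one_pos

instance (m : ι) : IsOpenImmersion (chart (k := k) m) :=
  inferInstanceAs (IsOpenImmersion (Proj.awayι _ _ _ _))

lemma opensRange_chart (m : ι) :
    (chart (k := k) m).opensRange = Proj.basicOpen (homogeneousSubmodule ι k) (X m) :=
  Proj.opensRange_awayι _ _ _ _

lemma projPoint_preimage (c : ι → R) (hc : Ideal.span (Set.range c) = ⊤) (m : ι) :
    projPoint (k := k) c hc ⁻¹ᵁ Proj.basicOpen (homogeneousSubmodule ι k) (X m) =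
      PrimeSpectrum.basicOpen (c m) := by
  rw [projPoint, Proj.fromOfGlobalSections_preimage_basicOpen _ _ _ one_pos (X_mem m)]
  rw [evalHom, RingHom.comp_apply]
  simp only [AlgHom.toRingHom_eq_coe, RingHom.coe_coe, aeval_X]
  exact basicOpen_eq_of_affine (R := .of R) (c m)

/-- If one coordinate is a unit, its nonvanishing locus is the whole source, so the morphism glued
from all charts is determined by its restriction to one. This turns questions about points into
questions about ring homomorphisms. -/
lemma projPoint_eq_chart (c : ι → R) (hc : Ideal.span (Set.range c) = ⊤) (m : ι)
    (hm : IsUnit (c m)) :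
    projPoint (k := k) c hc = Spec.map (CommRingCat.ofHom (awayEval c m hm)) ≫ chart m := by
  have htop : (Spec (.of R)).basicOpen (evalHom (k := k) c (X m)) = ⊤ := by
    have := Proj.fromOfGlobalSections_preimage_basicOpen (homogeneousSubmodule ι k) (evalHom c)
      (evalHom_irrelevant c hc) one_pos (X_mem m)
    rw [← this]
    refine (projPoint_preimage c hc m).trans ?_
    exact basicOpen_eq_top_of_isUnit hm
  have : IsIso ((Spec (.of R)).basicOpen (evalHom (k := k) c (X m))).ι := by
    rw [htop]; exact inferInstanceAs (IsIso (Scheme.topIso _).hom)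
  rw [← cancel_epi ((Spec (.of R)).basicOpen (evalHom (k := k) c (X m))).ι]
  have h1 := Proj.fromOfGlobalSections_resLE (homogeneousSubmodule ι k) (evalHom c)
    (evalHom_irrelevant c hc) one_pos (X_mem m)
  have h2 := congrArg (· ≫ (Proj.basicOpen (homogeneousSubmodule ι k) (X m)).ι) h1
  simp only [Scheme.Hom.resLE_comp_ι] at h2
  refine h2.trans ?_
  simp only [Proj.toBasicOpenOfGlobalSections, Category.assoc, Proj.basicOpenIsoSpec_inv_ι]
  rw [← chart]
  rw [localization_map_eq_comp_lift (evalHom (k := k) c) (Scheme.ΓSpecIso (.of R)).inv.hom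
    (aeval c : MvPolynomial ι k →ₐ[k] R).toRingHom rfl (X m) (by simpa using hm),
    RingHom.comp_assoc, RingHom.comp_assoc, ← awayEval]
  rw [CommRingCat.ofHom_comp, CommRingCat.ofHom_comp, CommRingCat.ofHom_hom, Spec.map_comp,
    Spec.map_comp]
  simp only [Category.assoc, basicOpenIsoSpecAway_hom_SpecMap_assoc]
  have hr := morphismRestrict_ι_assoc (Spec (.of R)).toSpecΓ
    (PrimeSpectrum.basicOpen ((evalHom (k := k) c) (X m)))
    (Spec.map (Scheme.ΓSpecIso (.of R)).inv ≫ Spec.map (CommRingCat.ofHom (awayEval c m hm)) ≫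
      chart (k := k) m)
  refine (congrArg (fun f => ((Spec (CommRingCat.of R)).isoOfEq _).inv ≫ f) hr).trans ?_
  have h₁ : (Spec (.of R)).toSpecΓ ≫ Spec.map (Scheme.ΓSpecIso (.of R)).inv = 𝟙 _ := by
    simp
  rw [reassoc_of% h₁, Scheme.isoOfEq_inv_ι_assoc]

/-- The coordinate `X j / X m` on the chart `X m ≠ 0`. -/
def frac (m j : ι) :
    HomogeneousLocalization.Away (homogeneousSubmodule ι k) (X m : MvPolynomial ι k) :=
  HomogeneousLocalization.Away.mk (homogeneousSubmodule ι k) (X_mem m) 1 (X j)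
    (by simpa using X_mem j)

lemma val_frac_mul (m j : ι) : (frac (k := k) m j).val *
    algebraMap (MvPolynomial ι k) (Localization.Away (X m : MvPolynomial ι k)) (X m) =
      algebraMap (MvPolynomial ι k) _ (X j) := by
  rw [frac, HomogeneousLocalization.Away.val_mk, Localization.mk_eq_mk']
  simp

lemma frac_self (m : ι) : frac (k := k) m m = 1 := by
  refine HomogeneousLocalization.val_injective _ ?_
  refine (IsLocalization.Away.algebraMap_isUnit
    (S := Localization.Away (X m : MvPolynomial ι k))
    (X m : MvPolynomial ι k)).mul_left_injective ?_
  simp only [val_frac_mul, HomogeneousLocalization.val_one, one_mul]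

lemma awayEval_frac (c : ι → R) (m : ι) (hm : IsUnit (c m)) (j : ι) :
    awayEval (k := k) c m hm (frac m j) * c m = c j := by
  have h := val_frac_mul (k := k) m j
  have h2 := congrArg (IsLocalization.Away.lift (S := Localization.Away (X m : MvPolynomial ι k))
    (X m : MvPolynomial ι k) (g := (aeval c : MvPolynomial ι k →ₐ[k] R).toRingHom)
    (by simpa using hm)) h
  rw [map_mul, IsLocalization.Away.lift_eq, IsLocalization.Away.lift_eq] at h2
  simpa [awayEval] using h2

/-- Homogenization: `p(x/t) tⁿ = p(x)` for a form of degree `n`. -/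
lemma eval₂_mul_pow_of_isHomogeneous {S : Type*} [CommRing S] (ρ : MvPolynomial ι k →+* S) (t : S)
    (x : ι → S) (hx : ∀ j, x j * t = ρ (X j)) {n : ℕ} {p : MvPolynomial ι k}
    (hp : p.IsHomogeneous n) : eval₂ (ρ.comp C) x p * t ^ n = ρ p := by
  conv_rhs => rw [p.as_sum, map_sum]
  rw [eval₂_eq, Finset.sum_mul]
  refine Finset.sum_congr rfl fun d hd => ?_
  have hd' : ∑ i ∈ d.support, d i = n := by
    rw [← Finsupp.degree_apply, Finsupp.degree_eq_weight_one]
    exact hp (mem_support_iff.mp hd)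
  rw [monomial_eq, map_mul, Finsupp.prod, map_prod, ← hd', ← Finset.prod_pow_eq_pow_sum, mul_assoc,
    ← Finset.prod_mul_distrib]
  simp only [← mul_pow, hx, map_pow, RingHom.comp_apply]

/-- The ring homomorphism from the scalars to the coordinate ring of the chart `X m ≠ 0`. -/
def chartScalars (m : ι) : k →+*
    HomogeneousLocalization.Away (homogeneousSubmodule ι k) (X m : MvPolynomial ι k) :=
  (HomogeneousLocalization.fromZeroRingHom (homogeneousSubmodule ι k) _).comp
    (algebraMap k (homogeneousSubmodule ι k 0))

/-- A fraction `p / X mⁿ` of degree zero is `p` evaluated at the fractions `X j / X m`; these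
therefore generate the chart ring over the scalars. -/
lemma away_ringHom_ext {S : Type*} [CommRing S] {m : ι}
    {φ ψ : HomogeneousLocalization.Away (homogeneousSubmodule ι k) (X m : MvPolynomial ι k) →+* S}
    (h : φ.comp (chartScalars m) = ψ.comp (chartScalars m))
    (hf : ∀ j, φ (frac m j) = ψ (frac m j)) : φ = ψ := by
  have key : φ.comp (eval₂Hom (chartScalars m) (frac m)) =
      ψ.comp (eval₂Hom (chartScalars m) (frac m)) := by
    ext x
    · simpa using congr($h x)
    · simpa using hf x
  ext y
  obtain ⟨n, a, ha, rfl⟩ :=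
    HomogeneousLocalization.Away.mk_surjective (homogeneousSubmodule ι k) (X_mem m) y
  have h1 : HomogeneousLocalization.Away.mk (homogeneousSubmodule ι k) (X_mem m) n a ha =
      eval₂Hom (chartScalars m) (frac m) a := by
    have ha' : a.IsHomogeneous n := by simpa using ha
    have hu : IsUnit (algebraMap (MvPolynomial ι k) (Localization.Away (X m : MvPolynomial ι k))
      (X m ^ n)) := by
      rw [map_pow]
      exact (IsLocalization.Away.algebraMap_isUnit _).pow n
    refine HomogeneousLocalization.val_injective _ (hu.mul_left_injective ?_)
    have h2 := eval₂_mul_pow_of_isHomogeneous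
      (algebraMap (MvPolynomial ι k) (Localization.Away (X m : MvPolynomial ι k)))
      (algebraMap _ _ (X m)) (fun j => (frac m j).val) (val_frac_mul m) ha'
    rw [← map_pow] at h2
    dsimp only
    rw [HomogeneousLocalization.Away.val_mk, Localization.mk_eq_mk']
    refine (IsLocalization.mk'_spec (Localization.Away (X m : MvPolynomial ι k)) a
      (⟨X m ^ n, n, rfl⟩ : Submonoid.powers (X m : MvPolynomial ι k))).trans (h2.symm.trans ?_)
    congr 1
    rw [← HomogeneousLocalization.algebraMap_apply, coe_eval₂Hom, hom_eval₂]
    rfl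
  rw [h1]
  exact congr($key a)

/-- Equal points have proportional coordinates. -/
lemma projPoint_cross {a b : ι → R} {ha : Ideal.span (Set.range a) = ⊤}
    {hb : Ideal.span (Set.range b) = ⊤} (h : projPoint (k := k) a ha = projPoint b hb) {m : ι}
    (hm : IsUnit (a m)) : IsUnit (b m) ∧ ∀ j, b j * a m = a j * b m := by
  have hbm : IsUnit (b m) := by
    have h1 := projPoint_preimage (k := k) a ha m
    rw [h, projPoint_preimage, basicOpen_eq_top_of_isUnit hm] at h1
    by_contra hb'
    obtain ⟨p, hp, hbp⟩ := exists_max_ideal_of_mem_nonunits hb'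
    have : (⟨p, hp.isPrime⟩ : PrimeSpectrum R) ∈ PrimeSpectrum.basicOpen (b m) := by
      rw [h1]; trivial
    exact this hbp
  refine ⟨hbm, fun j => ?_⟩
  rw [projPoint_eq_chart a ha m hm, projPoint_eq_chart b hb m hbm, cancel_mono] at h
  have h2 : awayEval (k := k) a m hm = awayEval b m hbm := by
    simpa using congrArg CommRingCat.Hom.hom (Spec.map_injective h)
  have ea := awayEval_frac (k := k) a m hm j
  have eb := awayEval_frac (k := k) b m hbm j
  rw [← h2] at eb
  -- Both points give the same values to the fractions `X j / X m`; clearing the two denominators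
  -- gives the cross relation.
  linear_combination (-a m) * eb + b m * ea

lemma span_range_eq_top_of_isUnit {c : ι → R} {m : ι} (hm : IsUnit (c m)) :
    Ideal.span (Set.range c) = ⊤ :=
  Ideal.eq_top_of_isUnit_mem _ (Ideal.subset_span ⟨m, rfl⟩) hm

/-- Points of projective space can be pulled back. -/
lemma specMap_projPoint {R' : Type u} [CommRing R'] [Algebra k R'] (φ : R →ₐ[k] R') (c : ι → R)
    (hc : Ideal.span (Set.range c) = ⊤) {m : ι} (hm : IsUnit (c m)) :
    Spec.map (CommRingCat.ofHom φ.toRingHom) ≫ projPoint (k := k) c hc =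
      projPoint (fun i => φ (c i)) (span_range_eq_top_of_isUnit (m := m) (hm.map φ)) := by
  rw [projPoint_eq_chart c hc m hm, projPoint_eq_chart _ _ m (hm.map φ), ← Category.assoc,
    ← Spec.map_comp, ← CommRingCat.ofHom_comp]
  congr 3
  rw [awayEval, awayEval, ← RingHom.comp_assoc]
  congr 1
  refine IsLocalization.ringHom_ext (M := Submonoid.powers (X m : MvPolynomial ι k)) ?_
  ext x <;> simp

lemma chart_toBase (m : ι) : chart m ≫ projSpaceToBase ι k =
    Spec.map (CommRingCat.ofHom (chartScalars m)) := by
  rw [chart, projSpaceToBase, Proj.awayι_toSpecZero_assoc, ← Spec.map_comp, chartScalars,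
    CommRingCat.ofHom_comp]

lemma awayEval_comp_chartScalars (c : ι → R) (m : ι) (hm : IsUnit (c m)) :
    (awayEval c m hm).comp (chartScalars m) = algebraMap k R := by
  have h1 := projPoint_toBase (k := k) c (span_range_eq_top_of_isUnit hm)
  rw [projPoint_eq_chart c _ m hm, Category.assoc, chart_toBase, ← Spec.map_comp,
    ← CommRingCat.ofHom_comp] at h1
  simpa using congrArg CommRingCat.Hom.hom (Spec.map_injective h1)

/-- A morphism from an affine scheme to a standard chart of projective space is given by
homogeneous coordinates. -/
lemma exists_eq_projPoint (f : Spec (.of R) ⟶ projSpace ι k)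
    (hf : f ≫ projSpaceToBase ι k = Spec.map (CommRingCat.ofHom (algebraMap k R))) (m : ι)
    (hm : f ⁻¹ᵁ Proj.basicOpen (homogeneousSubmodule ι k) (X m) = ⊤) :
    ∃ (c : ι → R) (h1 : c m = 1),
      f = projPoint c (span_range_eq_top_of_isUnit (m := m) (h1 ▸ isUnit_one)) := by
  have hr : Set.range f ⊆ Set.range (chart (k := k) m) := by
    rintro _ ⟨x, rfl⟩
    have hx : x ∈ f ⁻¹ᵁ Proj.basicOpen (homogeneousSubmodule ι k) (X m) := by rw [hm]; trivial
    rw [← opensRange_chart] at hx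
    exact hx
  obtain ⟨φ, hφ⟩ := Spec.map_surjective (IsOpenImmersion.lift (chart m) f hr)
  have hfac : Spec.map φ ≫ chart m = f := by rw [hφ, IsOpenImmersion.lift_fac]
  have h1 : φ.hom (frac m m) = 1 := by
    rw [frac_self, map_one]
  refine ⟨fun j => φ.hom (frac m j), h1, ?_⟩
  rw [projPoint_eq_chart _ _ m (h1 ▸ isUnit_one), ← hfac]
  congr 2
  ext1
  refine away_ringHom_ext ?_ fun j => ?_
  · rw [CommRingCat.hom_ofHom, awayEval_comp_chartScalars]
    rw [← hfac, Category.assoc, chart_toBase, ← Spec.map_comp] at hf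
    simpa using congrArg CommRingCat.Hom.hom (Spec.map_injective hf)
  · have := awayEval_frac (k := k) (fun j => φ.hom (frac m j)) m (h1 ▸ isUnit_one) j
    exact ((mul_one _).symm.trans ((congrArg (_ * ·) h1.symm).trans this)).symm

end ProjPoints

/-! ### Equations that pass from the graph to its closure. -/

section GraphClosureEquations

variable {k : Type u} [Field k]

/-- The open subset of the product of two projective spaces where `X m` and `Y n` do not vanish. -/
def pairsOpen (m n : Mon) : (QuarticPairs k).Opens :=
  pullback.fst (projSpaceToBase Mon k) (projSpaceToBase Mon k) ⁻¹ᵁ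
      Proj.basicOpen (homogeneousSubmodule Mon k) (X m) ⊓
    pullback.snd (projSpaceToBase Mon k) (projSpaceToBase Mon k) ⁻¹ᵁ
      Proj.basicOpen (homogeneousSubmodule Mon k) (X n)

/-- This open set is the image of a fiber product of two affine charts over an affine base. -/
lemma isAffineOpen_pairsOpen (m n : Mon) : IsAffineOpen (pairsOpen (k := k) m n) := by
  let i := pullback.map (chart m ≫ projSpaceToBase Mon k) (chart n ≫ projSpaceToBase Mon k)
    (projSpaceToBase Mon k) (projSpaceToBase Mon k) (chart m) (chart n) (𝟙 _) (by simp) (by simp)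
  have hi : IsOpenImmersion i := inferInstance
  have h : i.opensRange = pairsOpen m n := by
    ext1
    refine (Scheme.Pullback.range_map _ _ _ _ _ _ _ _ _).trans ?_
    have hm := congrArg (fun U : (projSpace Mon k).Opens => (U : Set (projSpace Mon k)))
      (opensRange_chart (k := k) m)
    have hn := congrArg (fun U : (projSpace Mon k).Opens => (U : Set (projSpace Mon k)))
      (opensRange_chart (k := k) n)
    exact congrArg₂ (fun A B => _ ⁻¹' A ∩ _ ⁻¹' B) hm hn
  rw [← h]
  exact isAffineOpen_opensRange i

instance {ι : Type} : IsSeparated (projSpaceToBase ι k) := by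
  rw [projSpaceToBase]; infer_instance

/-- The structure morphism of the product of two projective spaces. -/
def pairsToBase (k : Type u) [Field k] : QuarticPairs k ⟶ Spec (.of k) :=
  pullback.fst _ _ ≫ projSpaceToBase Mon k

instance : IsSeparated (pairsToBase k) := by
  rw [pairsToBase]; infer_instance

/-- The source is a finite disjoint union of affine schemes and the target is separated.
Quasi-compactness allows the scheme-theoretic image to be tested on affine opens. -/
instance : QuasiCompact (graphMap k) :=
  have : QuasiCompact (graphMap k ≫ pairsToBase k) := inferInstance
  .of_comp _ (pairsToBase k)

/-- A family of functions of two vectors that is compatible with ring homomorphisms. -/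
structure NaturalFamily where
  toFun : ∀ {S : Type u} [CommRing S], (Mon → S) → (Mon → S) → S
  map : ∀ {S S' : Type u} [CommRing S] [CommRing S'] (φ : S →+* S') (a b : Mon → S),
    φ (toFun a b) = toFun (fun m => φ (a m)) (fun m => φ (b m))

lemma app_apply_eq_zero_of_eq {X Y : Scheme.{u}} {f g : X ⟶ Y} (h : f = g) {U : Y.Opens}
    {s : Γ(Y, U)} (hs : f.app U s = 0) : g.app U s = 0 := by
  subst h; exact hs

/-- The equations of the closure of the graph. -/
lemma equation_of_graphClosure {R : Type u} [CommRing R] [Algebra k R]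
    (g : Spec (.of R) ⟶ GraphClosure k)
    {a b : Mon → R} {ha : Ideal.span (Set.range a) = ⊤} {hb : Ideal.span (Set.range b) = ⊤}
    (hga : g ≫ (graphMap k).imageι ≫ pullback.fst _ _ = projPoint a ha)
    (hgb : g ≫ (graphMap k).imageι ≫ pullback.snd _ _ = projPoint b hb)
    {m n : Mon} (ham : a m = 1) (hbn : b n = 1)
    (E : NaturalFamily.{u})
    (hE : ∀ (S : Type u) [CommRing S] (a : Mon → S) (c : S),
      E.toFun a (fun u => c * quad a u) = 0) :
    E.toFun a b = 0 := by
  have hU := isAffineOpen_pairsOpen (k := k) m n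
  obtain ⟨ρ, hρ⟩ := Spec.map_surjective
    (hU.fromSpec ≫ pullback.fst (projSpaceToBase Mon k) (projSpaceToBase Mon k) ≫
      projSpaceToBase Mon k)
  let _ : Algebra k Γ(QuarticPairs k, pairsOpen (k := k) m n) := ρ.hom.toAlgebra
  have hle1 : hU.fromSpec ⁻¹ᵁ pairsOpen (k := k) m n = ⊤ := by
    rw [hU.fromSpec_preimage_self]
  -- The tautological pair of coordinate vectors on the affine open set, normalized at `m` and `n`;
  -- `E.toFun ξ η` is then the universal form of the equation.
  obtain ⟨ξ, hξ1, hξ⟩ := exists_eq_projPoint (R := Γ(QuarticPairs k, pairsOpen (k := k) m n))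
    (hU.fromSpec ≫ pullback.fst (projSpaceToBase Mon k) (projSpaceToBase Mon k))
    (by rw [Category.assoc, ← hρ]; rfl) m (top_le_iff.mp (hle1.ge.trans fun x hx => hx.1))
  obtain ⟨η, hη1, hη⟩ := exists_eq_projPoint (R := Γ(QuarticPairs k, pairsOpen (k := k) m n))
    (hU.fromSpec ≫ pullback.snd (projSpaceToBase Mon k) (projSpaceToBase Mon k))
    (by rw [Category.assoc, ← pullback.condition, ← hρ]; rfl) n
    (top_le_iff.mp (hle1.ge.trans fun x hx => hx.2))
  -- On each chart of the graph, `η` is a scalar multiple of `quad ξ` after pulling back, so the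
  -- hypothesis on `E` makes the universal equation vanish.
  have hchart (i : Mon × Mon) : (graphChart (k := k) i).app (pairsOpen m n) (E.toFun ξ η) = 0 := by
    set V := graphChart (k := k) i ⁻¹ᵁ pairsOpen m n with hVdef
    have hfst : graphChart (k := k) i ≫ pullback.fst _ _ = projPoint _ (span_chart_left i) :=
      pullback.lift_fst _ _ _
    have hsnd : graphChart (k := k) i ≫ pullback.snd _ _ = projPoint _ (span_chart_right i) :=
      pullback.lift_snd _ _ _
    have hVeq : V = PrimeSpectrum.basicOpen (algebraMap (MvPolynomial Mon k) (ChartRing k i) (X m) *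
        algebraMap (MvPolynomial Mon k) (ChartRing k i) (harmonicCoeffs k n)) := by
      change (graphChart (k := k) i ≫ pullback.fst _ _) ⁻¹ᵁ _ ⊓
        (graphChart (k := k) i ≫ pullback.snd _ _) ⁻¹ᵁ _ = _
      rw [hfst, hsnd, projPoint_preimage, projPoint_preimage]
      exact (PrimeSpectrum.basicOpen_mul _ _).symm
    have hV : IsAffineOpen V := by
      rw [hVeq]
      exact IsAffineOpen.Spec_basicOpen (R := .of (ChartRing k i)) _
    obtain ⟨ψ, hψ⟩ := Spec.map_surjective hV.fromSpec
    have hφ := IsAffineOpen.SpecMap_appLE_fromSpec (graphChart (k := k) i) hU hV le_rfl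
    rw [← Scheme.Hom.app_eq_appLE] at hφ
    set φ := (graphChart (k := k) i).app (pairsOpen m n) with hφdef
    let _ : Algebra k Γ(Spec (.of (ChartRing k i)), V) := (φ.hom.comp ρ.hom).toAlgebra
    let φ' : Γ(QuarticPairs k, pairsOpen (k := k) m n) →ₐ[k] Γ(Spec (.of (ChartRing k i)), V) :=
      { φ.hom with commutes' := fun _ => rfl }
    let ψ' : ChartRing k i →ₐ[k] Γ(Spec (.of (ChartRing k i)), V) :=
      { ψ.hom with
        commutes' := fun r => by
          have h : CommRingCat.ofHom (algebraMap k (ChartRing k i)) ≫ ψ = ρ ≫ φ := by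
            refine Spec.map_injective ?_
            rw [Spec.map_comp, Spec.map_comp, hρ, hψ, reassoc_of% hφ, reassoc_of% hfst,
              projPoint_toBase]
          exact congr($h r) }
    have h1 := specMap_projPoint (k := k) φ' ξ
      (span_range_eq_top_of_isUnit (m := m) (by simp [hξ1])) (m := m) (by simp [hξ1])
    have h2 := specMap_projPoint (k := k) φ' η
      (span_range_eq_top_of_isUnit (m := n) (by simp [hη1])) (m := n) (by simp [hη1])
    have h3 := specMap_projPoint (k := k) ψ' _ (span_chart_left i) (m := i.1)
      (isUnit_of_dvd_unit (map_dvd _ (dvd_mul_right _ _))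
        (IsLocalization.Away.algebraMap_isUnit (X i.1 * harmonicCoeffs k i.2)))
    have h4 := specMap_projPoint (k := k) ψ' _ (span_chart_right i) (m := i.2)
      (isUnit_of_dvd_unit (map_dvd _ (dvd_mul_left _ _))
        (IsLocalization.Away.algebraMap_isUnit (X i.1 * harmonicCoeffs k i.2)))
    have h13 : Spec.map (CommRingCat.ofHom φ'.toRingHom) ≫ projPoint (k := k) ξ
        (span_range_eq_top_of_isUnit (m := m) (by simp [hξ1])) =
        Spec.map (CommRingCat.ofHom ψ'.toRingHom) ≫ projPoint _ (span_chart_left i) := by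
      rw [← hξ, ← hfst]
      change Spec.map φ ≫ _ = Spec.map ψ ≫ _
      rw [hψ, reassoc_of% hφ]
    have h24 : Spec.map (CommRingCat.ofHom φ'.toRingHom) ≫ projPoint (k := k) η
        (span_range_eq_top_of_isUnit (m := n) (by simp [hη1])) =
        Spec.map (CommRingCat.ofHom ψ'.toRingHom) ≫ projPoint _ (span_chart_right i) := by
      rw [← hη, ← hsnd]
      change Spec.map φ ≫ _ = Spec.map ψ ≫ _
      rw [hψ, reassoc_of% hφ]
    obtain ⟨ht, hcross1⟩ := projPoint_cross (h1.symm.trans (h13.trans h3)) (m := m) (by simp [hξ1])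
    obtain ⟨hs, hcross2⟩ := projPoint_cross (h2.symm.trans (h24.trans h4)) (m := n) (by simp [hη1])
    simp only [hξ1, hη1, map_one, mul_one] at hcross1 hcross2
    have hquad (j : Mon) : ψ' (algebraMap (MvPolynomial Mon k) (ChartRing k i)
        (harmonicCoeffs k j)) = ψ' (algebraMap (MvPolynomial Mon k) (ChartRing k i) (X m)) ^ 2 *
          quad (fun u => φ' (ξ u)) j := by
      rw [← quad_smul, congrFun (harmonicCoeffs_eq k) j]
      refine (map_quad (ψ'.toRingHom.comp (algebraMap (MvPolynomial Mon k) (ChartRing k i)))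
        X j).trans ?_
      congr 1
      funext u
      exact (hcross1 u).trans (mul_comm _ _)
    obtain ⟨s', hs'⟩ := hs.exists_left_inv
    -- The scalar comes from changing normalization twice: `X m` rescales `ξ` and contributes its
    -- square, and `s'` inverts the coefficient of `h` at `n`.
    have hφη : (fun u => φ' (η u)) = fun u =>
        (s' * ψ' (algebraMap (MvPolynomial Mon k) (ChartRing k i) (X m)) ^ 2) *
          quad (fun u => φ' (ξ u)) u := by
      funext u
      rw [mul_assoc, ← hquad, hcross2]
      linear_combination (-φ' (η u)) * hs'
    refine (E.map φ.hom ξ η).trans ?_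
    change E.toFun (fun u => φ' (ξ u)) (fun u => φ' (η u)) = 0
    rw [hφη]
    exact hE _ _ _
  -- Functions on the scheme-theoretic image over an affine open set inject into functions on the
  -- graph, where the equation was shown to vanish.
  have himage : (graphMap k).imageι.app (pairsOpen m n) (E.toFun ξ η) = 0 := by
    refine (graphMap k).toImage_app_injective ⟨_, hU⟩ ?_
    rw [map_zero]
    have hgraph : (graphMap k).app (pairsOpen m n) (E.toFun ξ η) = 0 := by
      refine Scheme.zero_of_zero_cover _ (sigmaOpenCover _) fun (i : Mon × Mon) => ?_
      have := app_apply_eq_zero_of_eq (f := graphChart i)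
        (g := Sigma.ι (fun i => Spec (.of (ChartRing k i))) i ≫ graphMap k)
        (by rw [graphMap]; exact (Sigma.ι_desc _ _).symm) (hchart i)
      rw [Scheme.Hom.comp_app] at this
      exact this
    have := app_apply_eq_zero_of_eq (graphMap k).toImage_imageι.symm hgraph
    rw [Scheme.Hom.comp_app] at this
    exact this
  have hZ : IsAffineOpen ((graphMap k).imageι ⁻¹ᵁ pairsOpen (k := k) m n) := hU.preimage _
  have hθ := IsAffineOpen.SpecMap_appLE_fromSpec (graphMap k).imageι hU hZ le_rfl
  rw [← Scheme.Hom.app_eq_appLE] at hθ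
  have hrange : Set.range g ⊆ Set.range hZ.fromSpec := by
    rw [hZ.range_fromSpec]
    rintro _ ⟨x, rfl⟩
    constructor
    · have : x ∈ (g ≫ (graphMap k).imageι ≫ pullback.fst _ _) ⁻¹ᵁ
          Proj.basicOpen (homogeneousSubmodule Mon k) (X m) := by
        rw [hga, projPoint_preimage, ham, PrimeSpectrum.basicOpen_one]
        trivial
      exact this
    · have : x ∈ (g ≫ (graphMap k).imageι ≫ pullback.snd _ _) ⁻¹ᵁ
          Proj.basicOpen (homogeneousSubmodule Mon k) (X n) := by
        rw [hgb, projPoint_preimage, hbn, PrimeSpectrum.basicOpen_one]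
        trivial
      exact this
  obtain ⟨θ, hθg⟩ := Spec.map_surjective (IsOpenImmersion.lift hZ.fromSpec g hrange)
  have hg : Spec.map θ ≫ hZ.fromSpec = g := by rw [hθg, IsOpenImmersion.lift_fac]
  -- The given point factors through the affine open set; `χ` specializes the universal equation to
  -- it, and the normalizations make the specialized vectors equal to `a` and `b`.
  let χ : Γ(QuarticPairs k, pairsOpen (k := k) m n) →ₐ[k] R :=
    { ((graphMap k).imageι.app (pairsOpen m n) ≫ θ).hom with
      commutes' := fun r => by
        have h : ρ ≫ (graphMap k).imageι.app (pairsOpen m n) ≫ θ =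
            CommRingCat.ofHom (algebraMap k R) := by
          refine Spec.map_injective ?_
          rw [Spec.map_comp, Spec.map_comp, hρ, Category.assoc, reassoc_of% hθ, reassoc_of% hg,
            reassoc_of% hga, projPoint_toBase]
        exact congr($h r) }
  have hχ : Spec.map (CommRingCat.ofHom χ.toRingHom) =
      Spec.map θ ≫ Spec.map ((graphMap k).imageι.app (pairsOpen m n)) := by
    rw [← Spec.map_comp]
    rfl
  have h1 := specMap_projPoint (k := k) χ ξ (span_range_eq_top_of_isUnit (m := m) (by simp [hξ1]))
    (m := m) (by simp [hξ1])
  have h2 := specMap_projPoint (k := k) χ η (span_range_eq_top_of_isUnit (m := n) (by simp [hη1]))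
    (m := n) (by simp [hη1])
  rw [← hξ, hχ, Category.assoc, reassoc_of% hθ, reassoc_of% hg, hga] at h1
  rw [← hη, hχ, Category.assoc, reassoc_of% hθ, reassoc_of% hg, hgb] at h2
  have e1 := (projPoint_cross h1 (m := m) (by simp [ham])).2
  have e2 := (projPoint_cross h2 (m := n) (by simp [hbn])).2
  simp only [hξ1, hη1, ham, hbn, map_one, mul_one] at e1 e2
  have e := E.map χ.toRingHom ξ η
  have hzero : χ.toRingHom (E.toFun ξ η) = 0 := by
    change θ.hom ((graphMap k).imageι.app (pairsOpen m n) (E.toFun ξ η)) = 0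
    rw [himage, map_zero]
  rw [hzero] at e
  rw [e]
  congr 1
  · exact funext fun u => (e1 u).symm
  · exact funext fun u => (e2 u).symm

end GraphClosureEquations

/-! ### The ring defined by the relations. -/

section FermatRing

variable (k : Type u) [Field k]

/-- The relations of `FermatRel`, in the variables `a, b, c, l, m, n = X 0, …, X 5`. -/
def fermatRelations : Fin 14 → MvPolynomial (Fin 6) k :=
  ![X 0 ^ 2 - X 1 ^ 2, X 1 ^ 2 - X 2 ^ 2, X 0 * X 5, X 0 * X 4, X 1 * X 5, X 1 * X 3, X 2 * X 4,
    X 2 * X 3, X 2 + X 0 * X 1 + 2 * X 5 ^ 2, X 1 + X 0 * X 2 + 2 * X 4 ^ 2,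
    X 0 + X 1 * X 2 + 2 * X 3 ^ 2, 2 * (X 0 * X 3) - X 4 * X 5, 2 * (X 1 * X 4) - X 3 * X 5,
    2 * (X 2 * X 5) - X 3 * X 4]

/-- The coordinate ring of the fiber: the universal `k`-algebra with elements that satisfy
`FermatRel`. -/
abbrev FermatRing : Type u := MvPolynomial (Fin 6) k ⧸ Ideal.span (Set.range (fermatRelations k))

variable {k}

/-- The generators of `FermatRing k`. -/
def FermatRing.gen (i : Fin 6) : FermatRing k := Ideal.Quotient.mk _ (X i)

open FermatRing

lemma FermatRing.fermatRel :
    FermatRel (gen 0 : FermatRing k) (gen 1) (gen 2) (gen 3) (gen 4) (gen 5) := by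
  have h (i : Fin 14) :
      Ideal.Quotient.mk (Ideal.span (Set.range (fermatRelations k))) (fermatRelations k i) = 0 :=
    Ideal.Quotient.eq_zero_iff_mem.mpr (Ideal.subset_span ⟨i, rfl⟩)
  exact
    { ab := sub_eq_zero.mp (h 0)
      bc := sub_eq_zero.mp (h 1)
      an := h 2
      am := h 3
      bn := h 4
      bl := h 5
      cm := h 6
      cl := h 7
      nn := h 8
      mm := h 9
      ll := h 10
      al := sub_eq_zero.mp (h 11)
      bm := sub_eq_zero.mp (h 12)
      cn := sub_eq_zero.mp (h 13) }

variable {S : Type*} [CommRing S] [Algebra k S]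

/-- The universal property of `FermatRing k`. -/
def FermatRel.lift {a b c l m n : S} (h : FermatRel a b c l m n) : FermatRing k →ₐ[k] S :=
  Ideal.Quotient.liftₐ _ (aeval ![a, b, c, l, m, n]) fun p hp => by
    have hle : Ideal.span (Set.range (fermatRelations k)) ≤
        RingHom.ker (aeval ![a, b, c, l, m, n] : MvPolynomial (Fin 6) k →ₐ[k] S) := by
      rw [Ideal.span_le]
      rintro _ ⟨i, rfl⟩
      obtain ⟨ab, bc, an, am, bn, bl, cm, cl, nn, mm, ll, al, bm, cn⟩ := h
      fin_cases i <;>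
        simp [fermatRelations, *]
    exact hle hp

lemma FermatRel.lift_gen {a b c l m n : S} (h : FermatRel a b c l m n) (i : Fin 6) :
    h.lift (k := k) (gen i) = ![a, b, c, l, m, n] i :=
  aeval_X _ i

lemma FermatRing.algHom_ext {φ ψ : FermatRing k →ₐ[k] S} (h : ∀ i, φ (gen i) = ψ (gen i)) :
    φ = ψ :=
  Ideal.Quotient.algHom_ext _ (MvPolynomial.algHom_ext fun i => h i)

end FermatRing

/-! ### Recovering the six parameters from a quartic. -/

section Sixes

variable {R : Type u} [CommRing R]

lemma sixVec_400 (a b c l m n : R) : sixVec a b c l m n (mon 4 0 0) = 1 := by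
  rw [sixVec, monVec_400]; simp

/-- The six parameters occur multiplied by `6` or `12`, both units. This gives the uniqueness half
of the universal property of the fiber. -/
lemma sixVec_injective (h6 : IsUnit (6 : R)) {x y : Fin 6 → R}
    (h : sixVec (x 0) (x 1) (x 2) (x 3) (x 4) (x 5) = sixVec (y 0) (y 1) (y 2) (y 3) (y 4) (y 5)) :
    x = y := by
  have h12 : IsUnit (12 : R) := by
    have : (36 : R) = 3 * 12 := by norm_num
    refine isUnit_of_dvd_unit ⟨3, ?_⟩ (h6.pow 2)
    norm_num
  have e (u : Mon) := congrFun h u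
  have e0 := e (mon 0 2 2)
  have e1 := e (mon 2 0 2)
  have e2 := e (mon 2 2 0)
  have e3 := e (mon 2 1 1)
  have e4 := e (mon 1 2 1)
  have e5 := e (mon 1 1 2)
  simp only [sixVec, monVec_022, monVec_202, monVec_220, monVec_211, monVec_121, monVec_112,
    Matrix.cons_val] at e0 e1 e2 e3 e4 e5
  funext i
  fin_cases i
  · exact h6.mul_right_injective e0
  · exact h6.mul_right_injective e1
  · exact h6.mul_right_injective e2
  · exact h12.mul_right_injective e3
  · exact h12.mul_right_injective e4
  · exact h12.mul_right_injective e5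

end Sixes

/-! ### The fiber as an affine closed subscheme of the space of quartics. -/

section Fiber

variable {k : Type u} [Field k]

lemma span_fermat : Ideal.span (Set.range (coeffs (fermat k))) = ⊤ :=
  span_coeffs _ (fermat_isHomogeneous k) (fermat_ne_zero k)

variable (k) in
/-- The Fermat quartic as a `k`-valued point. -/
def fermatMor : Spec (.of k) ⟶ QuarticSpace k := projPoint (coeffs (fermat k)) span_fermat

lemma fermatMor_toBase : fermatMor k ≫ projSpaceToBase Mon k = 𝟙 _ := by
  rw [fermatMor, projPoint_toBase]
  exact Spec.map_id _

lemma specMap_fermatMor {R : Type u} [CommRing R] [Algebra k R] :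
    Spec.map (CommRingCat.ofHom (algebraMap k R)) ≫ fermatMor k =
      projPoint fermatVec (span_range_eq_top_of_isUnit (m := mon 4 0 0)
        (by simp [fermatVec, monVec_400])) := by
  have h := specMap_projPoint (k := k) (Algebra.ofId k R) (coeffs (fermat k)) span_fermat
    (m := mon 4 0 0) (by simp [coeffs_fermat, fermatVec, monVec_400])
  refine h.trans ?_
  congr 1
  funext u
  rw [coeffs_fermat]
  exact map_fermatVec (Algebra.ofId k R).toRingHom u

variable (k) in
/-- The residue field of the point given by the Fermat quartic is `k`. -/
lemma exists_residueField_iso :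
    ∃ φ : (QuarticSpace k).residueField (fermatPoint k) ⟶ .of k, IsIso φ ∧
      Spec.map φ ≫ (QuarticSpace k).fromSpecResidueField (fermatPoint k) = fermatMor k := by
  obtain ⟨φ, hφ⟩ : ∃ φ : (QuarticSpace k).residueField (fermatPoint k) ⟶ .of k,
      Spec.map φ ≫ (QuarticSpace k).fromSpecResidueField (fermatPoint k) = fermatMor k :=
    ⟨_, Scheme.descResidueField_stalkClosedPointTo_fromSpecResidueField k (QuarticSpace k)
      (fermatMor k)⟩
  obtain ⟨θ, hθ⟩ := Spec.map_surjective
    ((QuarticSpace k).fromSpecResidueField (fermatPoint k) ≫ projSpaceToBase Mon k)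
  have h : θ ≫ φ = 𝟙 _ := by
    refine Spec.map_injective ?_
    rw [Spec.map_comp, hθ, ← Category.assoc, hφ, fermatMor_toBase, Spec.map_id]
  refine ⟨φ, ?_, hφ⟩
  rw [ConcreteCategory.isIso_iff_bijective]
  exact ⟨φ.hom.injective, fun x => ⟨θ x, congr($h x)⟩⟩

/-- Because the residue field is `k`, the inclusion of the point equals its own composite through
the base. -/
lemma fromSpecResidueField_fermatPoint :
    (QuarticSpace k).fromSpecResidueField (fermatPoint k) =
      (QuarticSpace k).fromSpecResidueField (fermatPoint k) ≫ projSpaceToBase Mon k ≫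
        fermatMor k := by
  obtain ⟨φ, _, hφ⟩ := exists_residueField_iso k
  rw [← cancel_epi (Spec.map φ), reassoc_of% hφ, hφ, ← Category.assoc, fermatMor_toBase,
    Category.id_comp]

instance : IsClosedImmersion (fermatMor k) := by
  have : IsClosedImmersion (fermatMor k ≫ projSpaceToBase Mon k) := by
    rw [fermatMor_toBase]; infer_instance
  exact .of_comp _ (projSpaceToBase Mon k)

variable (k) in
/-- The projection of the fiber to the space of quartics. -/
def curveMor : FermatFiber k ⟶ QuarticSpace k := (H k).fiberι (fermatPoint k) ≫ graphFst k

/-- On the fiber the second quartic is constant, equal to `Fer'`; a point of the fiber is thus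
determined by its first quartic. -/
lemma fiberι_imageι_snd : (H k).fiberι (fermatPoint k) ≫ (graphMap k).imageι ≫ pullback.snd _ _ =
    curveMor k ≫ projSpaceToBase Mon k ≫ fermatMor k := by
  have h : (H k).fiberι (fermatPoint k) ≫ H k = ((H k).fiberι (fermatPoint k) ≫ H k) ≫
      projSpaceToBase Mon k ≫ fermatMor k := by
    rw [Scheme.Hom.fiber_fac, Category.assoc, ← fromSpecResidueField_fermatPoint]
  refine h.trans ?_
  change ((H k).fiberι (fermatPoint k) ≫ (graphMap k).imageι ≫ pullback.snd _ _) ≫ _ = _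
  rw [curveMor, graphFst]
  simp only [Category.assoc]
  rw [pullback.condition_assoc]

instance : IsClosedImmersion ((H k).fiberι (fermatPoint k)) := by
  have : IsClosedImmersion ((QuarticSpace k).fromSpecResidueField (fermatPoint k)) := by
    obtain ⟨φ, _, hφ⟩ := exists_residueField_iso k
    rw [← MorphismProperty.cancel_left_of_respectsIso @IsClosedImmersion (Spec.map φ), hφ]
    infer_instance
  exact inferInstanceAs (IsClosedImmersion (pullback.fst _ _))

/-- Followed by the section `q ↦ (q, Fer')`, this map is the closed inclusion of the fiber in the
product. The section is a monomorphism, so the first map is already a closed immersion. -/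
instance : IsClosedImmersion (curveMor k) := by
  let s : QuarticSpace k ⟶ QuarticPairs k :=
    pullback.lift (𝟙 _) (projSpaceToBase Mon k ≫ fermatMor k)
      (by rw [Category.assoc, fermatMor_toBase, Category.id_comp, Category.comp_id])
  have hs : s ≫ pullback.fst _ _ = 𝟙 _ := pullback.lift_fst _ _ _
  have : Mono s := mono_of_mono_fac hs
  have h : curveMor k ≫ s = (H k).fiberι (fermatPoint k) ≫ (graphMap k).imageι := by
    refine pullback.hom_ext ?_ ?_
    · rw [Category.assoc, hs, Category.comp_id, curveMor, graphFst, Category.assoc]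
    · have h2 : s ≫ pullback.snd _ _ = projSpaceToBase Mon k ≫ fermatMor k :=
        pullback.lift_snd _ _ _
      rw [Category.assoc, h2, ← fiberι_imageι_snd, Category.assoc]
  have : IsClosedImmersion (curveMor k ≫ s) := by
    rw [h]; infer_instance
  exact .of_comp _ s

/-- Entries of the contraction and minors are polynomial expressions compatible with base change, so
they specialize from the closure of the graph to any ring-valued point of the fiber. -/
lemma inFermatFiber_of_eq_projPoint {R : Type u} [CommRing R] [Algebra k R]
    (g : Spec (.of R) ⟶ FermatFiber k) {a : Mon → R} {ha : Ideal.span (Set.range a) = ⊤}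
    (hg : g ≫ curveMor k = projPoint a ha) {m : Mon} (ham : a m = 1) : InFermatFiber a := by
  have hga : (g ≫ (H k).fiberι (fermatPoint k)) ≫ (graphMap k).imageι ≫ pullback.fst _ _ =
      projPoint a ha := by
    rw [← hg, curveMor, graphFst]
    simp only [Category.assoc]
  have hgb : (g ≫ (H k).fiberι (fermatPoint k)) ≫ (graphMap k).imageι ≫ pullback.snd _ _ =
      projPoint fermatVec (span_range_eq_top_of_isUnit (m := mon 4 0 0)
        (by simp [fermatVec, monVec_400])) := by
    rw [← specMap_fermatMor, ← projPoint_toBase a ha, ← hg]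
    simp only [Category.assoc]
    rw [← fiberι_imageι_snd]
  have key := equation_of_graphClosure (k := k) _ hga hgb ham (n := mon 4 0 0)
    (by simp [fermatVec, monVec_400])
  constructor
  · intro i j hij
    exact key ⟨fun a b => contraction a b i j, fun φ a b => map_contraction φ a b i j⟩
      fun S _ a c => contraction_quad a c hij
  · intro i
    exact sub_eq_zero.mp (key ⟨fun a b => contraction a b i i - contraction a b 0 0,
      fun φ a b => by rw [map_sub, map_contraction, map_contraction]⟩
      fun S _ a c => sub_eq_zero.mpr (contraction_quad_diag a c i))
  · intro u v
    exact sub_eq_zero.mp (key ⟨fun a b => quad a u * b v - quad a v * b u,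
      fun φ a b => by rw [map_sub, map_mul, map_mul, map_quad, map_quad]⟩
      fun S _ a c => by ring)

lemma iSup_basicOpen_X {ι : Type} :
    ⨆ m : ι, Proj.basicOpen (homogeneousSubmodule ι k) (X m) = ⊤ := by
  refine Proj.iSup_basicOpen_eq_top' _ _ (fun i => ⟨1, X_mem i⟩) (top_le_iff.mp fun p _ => ?_)
  induction p using MvPolynomial.induction_on with
  | C r =>
    exact (Algebra.adjoin (homogeneousSubmodule ι k 0) (Set.range (X : ι → MvPolynomial ι k))
      ).algebraMap_mem ⟨C r, isHomogeneous_C ι r⟩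
  | add p q hp hq => exact add_mem (hp trivial) (hq trivial)
  | mul_X p i hp => exact mul_mem (hp trivial) (Algebra.subset_adjoin ⟨i, rfl⟩)

variable [CharZero k]

lemma isUnit_six {R : Type*} [CommRing R] [Algebra k R] : IsUnit (6 : R) := by
  have h : IsUnit (6 : k) := by
    rw [isUnit_iff_ne_zero]; norm_num
  simpa only [_root_.map_ofNat] using h.map (algebraMap k R)

/-- It suffices to know field-valued points to locate the fiber topologically; for these
`apply_ne_zero` applies in whichever chart contains the point. -/
lemma curveMor_mem_of_field {K : Type u} [Field K] (g : Spec (.of K) ⟶ FermatFiber k) :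
    curveMor k (g (IsLocalRing.closedPoint K)) ∈
      Proj.basicOpen (homogeneousSubmodule Mon k) (X (mon 4 0 0)) := by
  obtain ⟨ρ, hρ⟩ := Spec.map_surjective (g ≫ curveMor k ≫ projSpaceToBase Mon k)
  let _ : Algebra k K := ρ.hom.toAlgebra
  have hx : curveMor k (g (IsLocalRing.closedPoint K)) ∈
      ⨆ m : Mon, Proj.basicOpen (homogeneousSubmodule Mon k) (X m) := by
    rw [iSup_basicOpen_X]; trivial
  obtain ⟨m, hm⟩ := TopologicalSpace.Opens.mem_iSup.mp hx
  obtain ⟨v, hv1, hv⟩ := exists_eq_projPoint (R := K) (g ≫ curveMor k)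
    (by rw [Category.assoc, ← hρ]; rfl) m (top_le_iff.mp fun y _ => by
      obtain rfl : y = IsLocalRing.closedPoint K := Subsingleton.elim (α := PrimeSpectrum K) _ _
      exact hm)
  have h400 := (inFermatFiber_of_eq_projPoint g hv hv1).apply_ne_zero (isUnit_six (k := k))
    (fun h0 => one_ne_zero (hv1.symm.trans (congrFun h0 m)))
  have hpre := projPoint_preimage (k := k) v
    (span_range_eq_top_of_isUnit (m := m) (hv1 ▸ isUnit_one)) (mon 4 0 0)
  rw [basicOpen_eq_top_of_isUnit (isUnit_iff_ne_zero.mpr h400), ← hv] at hpre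
  have hmem : IsLocalRing.closedPoint K ∈
      (g ≫ curveMor k) ⁻¹ᵁ Proj.basicOpen (homogeneousSubmodule Mon k) (X (mon 4 0 0)) := by
    rw [hpre]; trivial
  exact hmem

lemma curveMor_preimage :
    curveMor k ⁻¹ᵁ Proj.basicOpen (homogeneousSubmodule Mon k) (X (mon 4 0 0)) = ⊤ := by
  refine top_le_iff.mp fun x _ => ?_
  have h := curveMor_mem_of_field (K := (FermatFiber k).residueField x)
    ((FermatFiber k).fromSpecResidueField x)
  exact (congrArg (fun y => curveMor k y ∈ Proj.basicOpen (homogeneousSubmodule Mon k)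
    (X (mon 4 0 0))) (Scheme.fromSpecResidueField_apply x _)).mp h

/-- The fiber is closed in the space of quartics and lies over the affine chart where the
coefficient of `x⁴` is nonzero. -/
instance : IsAffine (FermatFiber k) := by
  have h : IsAffineOpen (Proj.basicOpen (homogeneousSubmodule Mon k) (X (mon 4 0 0))) := by
    rw [← opensRange_chart]
    exact isAffineOpen_opensRange _
  have h2 : IsAffine _ := h.preimage (curveMor k)
  rw [curveMor_preimage] at h2
  exact .of_isIso (Scheme.topIso _).inv

end Fiber

/-! ### The fiber is the spectrum of the ring of relations. -/

section UniversalProperty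

variable {k : Type u} [Field k]

/-- Proportional coordinates define the same point. -/
lemma projPoint_eq_of_cross {ι : Type} {R : Type u} [CommRing R] [Algebra k R] {a b : ι → R}
    {ha : Ideal.span (Set.range a) = ⊤} {hb : Ideal.span (Set.range b) = ⊤} {m : ι}
    (hma : IsUnit (a m)) (hmb : IsUnit (b m)) (h : ∀ j, b j * a m = a j * b m) :
    projPoint (k := k) a ha = projPoint b hb := by
  rw [projPoint_eq_chart a ha m hma, projPoint_eq_chart b hb m hmb]
  congr 3
  refine away_ringHom_ext ?_ fun j => ?_
  · rw [awayEval_comp_chartScalars, awayEval_comp_chartScalars]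
  · refine (hma.mul hmb).mul_left_injective ?_
    dsimp only
    linear_combination b m * awayEval_frac (k := k) a m hma j -
      a m * awayEval_frac (k := k) b m hmb j - h j

/-- Multiplying `ll` by `b` and `nn` by `a` kills the squares of `l` and `n` and leaves `a b = -a²
c` and `a c = -a² b`; substitute the second in the first. -/
lemma FermatRel.mul_eq_pow_mul {R : Type*} [CommRing R] {a b c l m n : R}
    (h : FermatRel a b c l m n) : a * b = a ^ 3 * b := by
  have h1 : a * b + a ^ 2 * c = 0 := by
    linear_combination b * h.ll - 2 * l * h.bl + c * h.ab
  have h2 : a * c + a ^ 2 * b = 0 := by linear_combination a * h.nn - 2 * n * h.an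
  linear_combination h1 - a * h2

/-- From `a² = b²`: `a⁴ = (a b)(a b) = (a b)(a³ b) = a⁶`. Hence `a⁴` is idempotent, which separates
the Fermat point from the other four. -/
lemma FermatRel.pow_six {R : Type*} [CommRing R] {a b c l m n : R} (h : FermatRel a b c l m n) :
    a ^ 6 = a ^ 4 := by
  linear_combination (-a * b) * h.mul_eq_pow_mul - (a ^ 2 - a ^ 4) * h.ab

lemma FermatRel.isUnit {R : Type*} [CommRing R] {a b c l m n : R} (h : FermatRel a b c l m n)
    (h2 : IsUnit (2 : R)) : IsUnit (1 + 3 * a ^ 2) := by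
  obtain ⟨i, hi⟩ := h2.exists_right_inv
  -- With `i = 1/2`, the product with `1 + 3 a²` is `1 + (27/4)(a⁶ - a⁴)`.
  refine IsUnit.of_mul_eq_one (1 - 3 * a ^ 2 + 9 * i ^ 2 * a ^ 4) ?_
  linear_combination 27 * i ^ 2 * h.pow_six + 9 * a ^ 4 * (2 * i + 1) * hi

variable [CharZero k]

/-- A quartic whose coefficients satisfy `FermatRel` defines a point of the fiber. -/
lemma FermatRel.exists_curveMor {R : Type u} [CommRing R] [Algebra k R] {a b c l m n : R}
    (h : FermatRel a b c l m n) : ∃ g : Spec (.of R) ⟶ FermatFiber k,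
      g ≫ curveMor k = projPoint (sixVec a b c l m n)
        (span_range_eq_top_of_isUnit (m := mon 4 0 0) (by simp [sixVec_400])) := by
  have hR6 : IsUnit (6 : R) := isUnit_six (k := k)
  have hR2 : IsUnit (2 : R) := isUnit_of_dvd_unit ⟨3, by norm_num⟩ hR6
  have hR48 : IsUnit (48 * (1 + 3 * a ^ 2) : R) := by
    refine .mul (isUnit_of_dvd_unit ⟨27, ?_⟩ (hR6.pow 4)) (h.isUnit hR2)
    norm_num
  let i : Mon × Mon := (mon 4 0 0, mon 4 0 0)
  -- The harmonic form is a unit multiple of `Fer'`, so the point lies in the domain of the rational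
  -- map and factors through a single chart of the graph.
  have hquad : (fun u => aeval (sixVec a b c l m n) (harmonicCoeffs k u)) =
      fun u => 48 * (1 + 3 * a ^ 2) * fermatVec u := by
    rw [← h.quad_sixVec, harmonicCoeffs_eq]
    funext u
    refine (map_quad (aeval (sixVec a b c l m n) : MvPolynomial Mon k →ₐ[k] R).toRingHom X u).trans
      ?_
    simp
  have hfer : fermatVec (R := R) (mon 4 0 0) = 1 := by simp [fermatVec, monVec_400]
  have hunit : IsUnit ((aeval (sixVec a b c l m n) : MvPolynomial Mon k →ₐ[k] R)
      (X i.1 * harmonicCoeffs k i.2)) := by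
    rw [map_mul, aeval_X, congrFun hquad, sixVec_400, hfer, one_mul, mul_one]
    exact hR48
  let φ : ChartRing k i →ₐ[k] R := IsLocalization.liftAlgHom
    (M := Submonoid.powers (X i.1 * harmonicCoeffs k i.2 : MvPolynomial Mon k))
    (f := (aeval (sixVec a b c l m n) : MvPolynomial Mon k →ₐ[k] R)) (by
      rintro ⟨_, r, rfl⟩
      rw [map_pow]
      exact hunit.pow r)
  have hφ (p : MvPolynomial Mon k) : φ (algebraMap _ _ p) = aeval (sixVec a b c l m n) p :=
    IsLocalization.lift_eq _ _
  obtain ⟨g₀, hg₀⟩ : ∃ g₀ : Spec (.of R) ⟶ GraphClosure k, g₀ ≫ (graphMap k).imageι =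
      Spec.map (CommRingCat.ofHom φ.toRingHom) ≫ graphChart i := by
    refine ⟨Spec.map (CommRingCat.ofHom φ.toRingHom) ≫
      Sigma.ι (fun i => Spec (.of (ChartRing k i))) i ≫ (graphMap k).toImage, ?_⟩
    simp only [Category.assoc, Scheme.Hom.toImage_imageι]
    rw [graphMap, Sigma.ι_desc]
  have hfst : g₀ ≫ graphFst k = projPoint (sixVec a b c l m n)
        (span_range_eq_top_of_isUnit (m := mon 4 0 0) (by simp [sixVec_400])) := by
    rw [graphFst, reassoc_of% hg₀, graphChart, pullback.lift_fst,
      specMap_projPoint (k := k) φ _ (span_chart_left i) (m := i.1)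
      (isUnit_of_dvd_unit (map_dvd _ (dvd_mul_right _ _))
        (IsLocalization.Away.algebraMap_isUnit (X i.1 * harmonicCoeffs k i.2)))]
    congr 1
    funext u
    rw [hφ, aeval_X]
  have hsnd : g₀ ≫ (graphMap k).imageι ≫ pullback.snd _ _ = projPoint fermatVec
      (span_range_eq_top_of_isUnit (m := mon 4 0 0) (by simp [hfer])) := by
    rw [reassoc_of% hg₀, graphChart, pullback.lift_snd,
      specMap_projPoint (k := k) φ _ (span_chart_right i) (m := i.2)
      (isUnit_of_dvd_unit (map_dvd _ (dvd_mul_left _ _))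
        (IsLocalization.Away.algebraMap_isUnit (X i.1 * harmonicCoeffs k i.2)))]
    refine projPoint_eq_of_cross (m := mon 4 0 0) ?_ (by simp [hfer]) fun j => ?_
    · rw [hφ, congrFun hquad, hfer, mul_one]
      exact hR48
    · rw [hφ, hφ, congrFun hquad, congrFun hquad, hfer]
      ring
  obtain ⟨θ, _, hθ⟩ := exists_residueField_iso k
  have hw : g₀ ≫ H k = (Spec.map (CommRingCat.ofHom (algebraMap k R)) ≫ Spec.map θ) ≫
      (QuarticSpace k).fromSpecResidueField (fermatPoint k) := by
    rw [Category.assoc, hθ, specMap_fermatMor]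
    exact hsnd
  obtain ⟨g, hg⟩ : ∃ g : Spec (.of R) ⟶ FermatFiber k, g ≫ (H k).fiberι (fermatPoint k) = g₀ :=
    ⟨pullback.lift g₀ _ hw, pullback.lift_fst _ _ _⟩
  exact ⟨g, by rw [← hfst, curveMor, reassoc_of% hg]⟩

open FermatRing

/-- The fiber is the spectrum of `FermatRing k`. -/
theorem exists_fiber_iso : ∃ e : Spec (.of (FermatRing k)) ⟶ FermatFiber k, IsIso e ∧
    e ≫ curveMor k =
      projPoint (k := k) (sixVec (gen 0 : FermatRing k) (gen 1) (gen 2) (gen 3) (gen 4) (gen 5))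
        (span_range_eq_top_of_isUnit (m := mon 4 0 0) (by simp [sixVec_400])) := by
  obtain ⟨e, he⟩ := (FermatRing.fermatRel (k := k)).exists_curveMor (k := k)
  refine ⟨e, ?_, he⟩
  -- The universal point of the affine fiber has coordinates of the form `sixVec` satisfying
  -- `FermatRel`; it is classified by `ψ`, the candidate inverse of `e`.
  let R : Type u := Γ(FermatFiber k, ⊤)
  let f : Spec (.of R) ⟶ FermatFiber k := (FermatFiber k).isoSpec.inv
  have : IsIso f := inferInstanceAs (IsIso (FermatFiber k).isoSpec.inv)
  obtain ⟨ρ, hρ⟩ := Spec.map_surjective (f ≫ curveMor k ≫ projSpaceToBase Mon k)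
  let _ : Algebra k R := ρ.hom.toAlgebra
  obtain ⟨v, hv1, hv⟩ := exists_eq_projPoint (R := R) (f ≫ curveMor k)
    (by rw [Category.assoc, ← hρ]; rfl) (mon 4 0 0) (by
      rw [Scheme.Hom.comp_preimage, curveMor_preimage]; rfl)
  obtain ⟨a, b, c, l, m, n, hrel, hv'⟩ :=
    (inFermatFiber_of_eq_projPoint f hv hv1).exists_rel (isUnit_six (k := k)) hv1
  subst hv'
  let ψ : FermatRing k →ₐ[k] R := hrel.lift
  -- Both morphisms have the same underlying quartic, and `curveMor k` is a monomorphism.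
  have hψ : Spec.map (CommRingCat.ofHom ψ.toRingHom) ≫ e = f := by
    rw [← cancel_mono (curveMor k), Category.assoc, he, hv,
      specMap_projPoint (k := k) ψ _ _ (m := mon 4 0 0) (by simp [sixVec_400])]
    congr 1
    funext u
    refine (map_sixVec ψ.toRingHom _ _ _ _ _ _ u).trans ?_
    congr 1 <;> exact hrel.lift_gen _
  obtain ⟨χ₀, hχ₀⟩ := Spec.map_surjective (e ≫ inv f)
  have hχ₀f : Spec.map χ₀ ≫ f = e := by rw [hχ₀]; simp
  let χ : R →ₐ[k] FermatRing k :=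
    { χ₀.hom with
      commutes' := fun r => by
        have h : ρ ≫ χ₀ = CommRingCat.ofHom (algebraMap k (FermatRing k)) := by
          refine Spec.map_injective ?_
          rw [Spec.map_comp, hρ, reassoc_of% hχ₀f, reassoc_of% he, projPoint_toBase]
        exact congr($h r) }
  -- Equality of projective points gives equality of coordinates because the coefficient of `x⁴` is
  -- `1` on both sides; injectivity of `sixVec` then compares the generators.
  have hcomp : χ.comp ψ = AlgHom.id k _ := by
    have h1 := specMap_projPoint (k := k) χ (sixVec a b c l m n)
      (span_range_eq_top_of_isUnit (m := mon 4 0 0) (by simp [sixVec_400])) (m := mon 4 0 0)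
      (by simp [sixVec_400])
    rw [← hv] at h1
    change Spec.map χ₀ ≫ f ≫ curveMor k = _ at h1
    rw [reassoc_of% hχ₀f, he] at h1
    have h2 := (projPoint_cross h1 (m := mon 4 0 0) (by simp [sixVec_400])).2
    simp only [sixVec_400, map_one, mul_one] at h2
    have h3 := sixVec_injective (isUnit_six (k := k)) (x := fun i => χ (ψ (gen i)))
      (y := gen) (by
        funext u
        rw [← h2 u]
        refine Eq.trans ?_ (map_sixVec χ.toRingHom _ _ _ _ _ _ u).symm
        congr 1 <;> exact congrArg χ (hrel.lift_gen _))
    exact algHom_ext fun i => congrFun h3 i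
  have hleft : e ≫ inv f ≫ Spec.map (CommRingCat.ofHom ψ.toRingHom) = 𝟙 _ := by
    rw [← Category.assoc, ← hχ₀, ← Spec.map_comp, ← Spec.map_id]
    congr 1
    exact CommRingCat.hom_ext (RingHom.ext fun x => congr($hcomp x))
  refine ⟨inv f ≫ Spec.map (CommRingCat.ofHom ψ.toRingHom), hleft, ?_⟩
  rw [Category.assoc, hψ, IsIso.inv_hom_id]

end UniversalProperty

/-! ### Lengths of localizations at rational points. -/

section Length

lemma length_eq_of_ringEquiv {A B : Type*} [CommRing A] [CommRing B] (e : A ≃+* B) :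
    Module.length A A = Module.length B B := by
  let _ : Algebra A B := e.toRingHom.toAlgebra
  rw [← Module.length_eq_of_surjective (R := B) (M := B) (S := A) e.surjective]
  exact LinearEquiv.length_eq
    { e with map_smul' := fun r x => map_mul e r x }

variable {k : Type*} [Field k]

/-- The length of a local algebra with residue field `k` is its dimension. -/
lemma length_eq_finrank_of_residue_surjective {T : Type*} [CommRing T] [Algebra k T]
    [IsLocalRing T] [Module.Finite k T]
    (h : Function.Surjective (algebraMap k (IsLocalRing.ResidueField T))) :
    Module.length T T = Module.finrank k T := by
  have h1 := IsLocalRing.length_restrictScalars k T T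
  have h2 : Function.Surjective
      (algebraMap (IsLocalRing.ResidueField k) (IsLocalRing.ResidueField T)) := fun y => by
    obtain ⟨x, rfl⟩ := h y
    exact ⟨algebraMap k _ x, rfl⟩
  rw [Module.length_eq_of_surjective (M := IsLocalRing.ResidueField T) h2,
    Module.length_eq_one (R := IsLocalRing.ResidueField T) (M := IsLocalRing.ResidueField T),
    mul_one, Module.length_eq_finrank] at h1
  exact h1.symm

/-- Every element is a scalar plus a nilpotent: a unit if the scalar is nonzero, and otherwise `1`
minus it is a unit. -/
lemma isLocalRing_of_isNilpotent_sub {T : Type*} [CommRing T] [Nontrivial T] [Algebra k T]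
    (h : ∀ x : T, ∃ c : k, IsNilpotent (x - algebraMap k T c)) : IsLocalRing T := by
  refine .of_isUnit_or_isUnit_one_sub_self fun x => ?_
  obtain ⟨c, hc⟩ := h x
  by_cases h0 : c = 0
  · right
    rw [h0, map_zero, sub_zero] at hc
    exact hc.isUnit_one_sub
  · left
    have := hc.isUnit_add_left_of_commute ((isUnit_iff_ne_zero.mpr h0).map (algebraMap k T))
      (Commute.all _ _)
    simpa using this

/-- A criterion to compute the length of the localization of a `k`-algebra `R` at a `k`-rational
point: it is the dimension of a quotient `T` of `R` that is local, if the kernel of `R → T` is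
annihilated by an element that is invertible at the point. -/
theorem length_localization_atPrime {R T ι : Type*} [CommRing R] [Algebra k R] [CommRing T]
    [Nontrivial T] [Algebra k T] [Fintype ι] (p : Ideal R) [p.IsPrime] (ev : R →ₐ[k] k)
    (hp : ∀ x, x ∈ p ↔ ev x = 0) (f : R →ₐ[k] T)
    (hf : Function.Surjective f) (hev : ∀ x, IsNilpotent (f x - algebraMap k T (ev x))) (s : R)
    (hs : ev s ≠ 0) (b : ι → R) (hb : LinearIndependent k fun i => f (b i))
    (hspan : ∀ x, s * x ∈ Submodule.span k (Set.range fun i => s * b i)) :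
    Module.length (Localization.AtPrime p) (Localization.AtPrime p) = Fintype.card ι := by
  have hnil (x : T) : ∃ c : k, IsNilpotent (x - algebraMap k T c) := by
    obtain ⟨y, rfl⟩ := hf x
    exact ⟨_, hev y⟩
  have := isLocalRing_of_isNilpotent_sub hnil
  have hunit (x : R) (hx : ev x ≠ 0) : IsUnit (f x) := by
    have := (hev x).isUnit_add_left_of_commute
      ((isUnit_iff_ne_zero.mpr hx).map (algebraMap k T)) (Commute.all _ _)
    simpa using this
  let _ : Algebra R T := f.toRingHom.toAlgebra
  -- Write `s x` as `∑ cᵢ s bᵢ`. Applying `f` and cancelling the unit `f s` gives a relation between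
  -- the `f bᵢ`, so all `cᵢ` vanish.
  have hker (x : R) (hx : f x = 0) : s * x = 0 := by
    have hx' := hspan x
    rw [Submodule.mem_span_range_iff_exists_fun] at hx'
    obtain ⟨c, hc⟩ := hx'
    have hc' : s * ∑ i, c i • b i = s * x := by
      rw [← hc, Finset.mul_sum]
      exact Finset.sum_congr rfl fun i _ => by rw [mul_smul_comm]
    have h0 : f s * ∑ i, c i • f (b i) = 0 := by
      have := congrArg f hc'
      rw [map_mul, map_mul, hx, mul_zero, map_sum] at this
      simpa only [map_smul] using this
    have hc0 := Fintype.linearIndependent_iff.mp hb c ((hunit s hs).mul_right_eq_zero.mp h0)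
    rw [← hc']
    simp [hc0]
  -- Elements outside `p` become units, `f` is surjective, and the single denominator `s` kills the
  -- kernel: `T` is the localization.
  have hloc : IsLocalization.AtPrime T p := by
    refine ⟨⟨fun y => hunit y ((hp y).not.mp y.2), fun z => ?_,
      fun {x y} hxy => ⟨⟨s, (hp s).not.mpr hs⟩, ?_⟩⟩⟩
    · obtain ⟨x, rfl⟩ := hf z
      exact ⟨(x, 1), by simp; rfl⟩
    · have h := hker (x - y) (by rw [map_sub]; exact sub_eq_zero.mpr hxy)
      rw [mul_sub] at h
      exact sub_eq_zero.mp h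
  let e := IsLocalization.algEquiv p.primeCompl (Localization.AtPrime p) T
  rw [length_eq_of_ringEquiv e.toRingEquiv]
  -- Cancelling `f s` from `hspan` shows that the independent family also spans `T`.
  have htop : ⊤ ≤ Submodule.span k (Set.range fun i => f (b i)) := by
    rintro z -
    obtain ⟨u, hu⟩ := (hunit s hs).exists_left_inv
    obtain ⟨x, rfl⟩ := hf z
    have hx' := hspan x
    rw [Submodule.mem_span_range_iff_exists_fun] at hx' ⊢
    obtain ⟨c, hc⟩ := hx'
    refine ⟨c, ?_⟩
    have h1 := congrArg (fun y => u * f y) hc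
    simp only [map_sum, map_smul, map_mul, Finset.mul_sum, mul_smul_comm, ← mul_assoc, hu,
      one_mul] at h1
    exact h1
  let B := Module.Basis.mk hb htop
  have : Module.Finite k T := .of_basis B
  rw [length_eq_finrank_of_residue_surjective (k := k), Module.finrank_eq_card_basis B]
  intro y
  obtain ⟨x, rfl⟩ := IsLocalRing.residue_surjective y
  obtain ⟨c, hc⟩ := hnil x
  refine ⟨c, sub_eq_zero.mp ?_⟩
  have h1 : IsLocalRing.residue T (x - algebraMap k T c) = 0 := (hc.map _).eq_zero
  rw [map_sub] at h1
  rw [← neg_eq_zero, neg_sub]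
  exact h1

end Length

/-! ### The Gorenstein model of the local ring at the Fermat quartic. -/

section Model

variable (k : Type u) [Field k]

/-- The weights that define the dual socle generator `l⁴ + m⁴ + n⁴ - 4 l m n`. -/
def socleWeight (a b c : ℕ) : ℤ :=
  if a = 4 ∧ b = 0 ∧ c = 0 ∨ a = 0 ∧ b = 4 ∧ c = 0 ∨ a = 0 ∧ b = 0 ∧ c = 4 then 1
  else if a = 1 ∧ b = 1 ∧ c = 1 then -4 else 0

/-- The linear functional on polynomials in `l, m, n` dual to `l⁴ + m⁴ + n⁴ - 4 l m n`. -/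
def socle : MvPolynomial (Fin 3) k →ₗ[k] k :=
  (basisMonomials (Fin 3) k).constr k fun d => (socleWeight (d 0) (d 1) (d 2) : k)

/-- The largest ideal on which the functional `socle` vanishes. -/
def socleIdeal : Ideal (MvPolynomial (Fin 3) k) where
  carrier := {p | ∀ q, socle k (p * q) = 0}
  zero_mem' q := by rw [zero_mul, map_zero]
  add_mem' hp hp' q := by rw [add_mul, map_add, hp, hp', add_zero]
  smul_mem' r p hp q := by
    rw [smul_eq_mul, mul_comm r, mul_assoc]
    exact hp _

variable {k}

/-- The monomial `l ^ a m ^ b n ^ c`. -/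
def lmn (a b c : ℕ) : MvPolynomial (Fin 3) k := X 0 ^ a * X 1 ^ b * X 2 ^ c

lemma lmn_mul (a b c a' b' c' : ℕ) :
    (lmn a b c * lmn a' b' c' : MvPolynomial (Fin 3) k) = lmn (a + a') (b + b') (c + c') := by
  simp only [lmn, pow_add]; ring

lemma monomial_eq_lmn (d : Fin 3 →₀ ℕ) :
    (monomial d 1 : MvPolynomial (Fin 3) k) = lmn (d 0) (d 1) (d 2) := by
  rw [monomial_eq, Finsupp.prod_fintype _ _ (fun _ => pow_zero _), Fin.prod_univ_three]
  simp [lmn]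

lemma socle_monomial (d : Fin 3 →₀ ℕ) :
    socle k (monomial d 1) = socleWeight (d 0) (d 1) (d 2) := by
  have h : (monomial d 1 : MvPolynomial (Fin 3) k) = basisMonomials (Fin 3) k d := by
    rw [coe_basisMonomials]
  rw [h, socle, Module.Basis.constr_basis]

lemma socle_lmn (a b c : ℕ) : socle k (lmn a b c) = socleWeight a b c := by
  have h := socle_monomial (k := k) (Finsupp.equivFunOnFinite.symm ![a, b, c])
  rw [monomial_eq_lmn] at h
  simpa using h

lemma mem_socleIdeal {p : MvPolynomial (Fin 3) k}
    (h : ∀ a b c, socle k (p * lmn a b c) = 0) : p ∈ socleIdeal k := by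
  intro q
  induction q using MvPolynomial.induction_on' with
  | monomial d r =>
    have : (monomial d r : MvPolynomial (Fin 3) k) = r • lmn (d 0) (d 1) (d 2) := by
      rw [← monomial_eq_lmn, smul_monomial, smul_eq_mul, mul_one]
    rw [this, mul_smul_comm, map_smul, h, smul_zero]
  | add p q hp hq => rw [mul_add, map_add, hp, hq, add_zero]

variable (k) in
/-- The local Gorenstein algebra with dual socle generator `l⁴ + m⁴ + n⁴ - 4 l m n`. -/
abbrev SocleRing : Type u := MvPolynomial (Fin 3) k ⧸ socleIdeal k

/-- The generators of `SocleRing k`. -/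
def socleGen (i : Fin 3) : SocleRing k := Ideal.Quotient.mk _ (X i)

lemma mk_lmn (a b c : ℕ) : (Ideal.Quotient.mk (socleIdeal k) (lmn a b c)) =
    socleGen 0 ^ a * socleGen 1 ^ b * socleGen 2 ^ c := by
  simp [lmn, socleGen]

/-- A relation in `SocleRing k`. -/
lemma socleRing_rel {a b c a' b' c' : ℕ} (r : ℤ)
    (h : ∀ x y z, socleWeight (a + x) (b + y) (c + z) =
      r * socleWeight (a' + x) (b' + y) (c' + z)) :
    (socleGen 0 ^ a * socleGen 1 ^ b * socleGen 2 ^ c : SocleRing k) =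
      (r : SocleRing k) * (socleGen 0 ^ a' * socleGen 1 ^ b' * socleGen 2 ^ c') := by
  rw [← mk_lmn, ← mk_lmn, ← map_intCast (Ideal.Quotient.mk (socleIdeal k)), ← map_mul,
    Ideal.Quotient.eq]
  refine mem_socleIdeal fun x y z => ?_
  rw [sub_mul, mul_assoc, lmn_mul, lmn_mul, ← zsmul_eq_mul, map_sub, map_zsmul, socle_lmn,
    socle_lmn, h, zsmul_eq_mul]
  push_cast
  ring

/-- A monomial that vanishes in `SocleRing k`. -/
lemma socleRing_zero {a b c : ℕ}
    (h : ∀ x y z, socleWeight (a + x) (b + y) (c + z) = 0) :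
    (socleGen 0 ^ a * socleGen 1 ^ b * socleGen 2 ^ c : SocleRing k) = 0 := by
  have := socleRing_rel (k := k) (a' := 0) (b' := 0) (c' := 0) 0 (fun x y z => by rw [h, zero_mul])
  simpa using this

lemma socleRing_relations :
    let l : SocleRing k := socleGen 0
    let m : SocleRing k := socleGen 1
    let n : SocleRing k := socleGen 2
    l ^ 4 = m ^ 4 ∧ m ^ 4 = n ^ 4 ∧ l ^ 2 * m = 0 ∧ l ^ 2 * n = 0 ∧ l * m ^ 2 = 0 ∧ m ^ 2 * n = 0 ∧
      l * n ^ 2 = 0 ∧ m * n ^ 2 = 0 ∧ m * n = -4 * l ^ 3 ∧ l * n = -4 * m ^ 3 ∧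
      l * m = -4 * n ^ 3 := by
  intro l m n
  have e1 := socleRing_rel (k := k) (a := 4) (b := 0) (c := 0) (a' := 0) (b' := 4) (c' := 0) 1
    (fun x y z => by unfold socleWeight; split_ifs <;> omega)
  have e2 := socleRing_rel (k := k) (a := 0) (b := 4) (c := 0) (a' := 0) (b' := 0) (c' := 4) 1
    (fun x y z => by unfold socleWeight; split_ifs <;> omega)
  have e3 := socleRing_zero (k := k) (a := 2) (b := 1) (c := 0)
    (fun x y z => by unfold socleWeight; split_ifs <;> omega)
  have e4 := socleRing_zero (k := k) (a := 2) (b := 0) (c := 1)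
    (fun x y z => by unfold socleWeight; split_ifs <;> omega)
  have e5 := socleRing_zero (k := k) (a := 1) (b := 2) (c := 0)
    (fun x y z => by unfold socleWeight; split_ifs <;> omega)
  have e6 := socleRing_zero (k := k) (a := 0) (b := 2) (c := 1)
    (fun x y z => by unfold socleWeight; split_ifs <;> omega)
  have e7 := socleRing_zero (k := k) (a := 1) (b := 0) (c := 2)
    (fun x y z => by unfold socleWeight; split_ifs <;> omega)
  have e8 := socleRing_zero (k := k) (a := 0) (b := 1) (c := 2)
    (fun x y z => by unfold socleWeight; split_ifs <;> omega)
  have e9 := socleRing_rel (k := k) (a := 0) (b := 1) (c := 1) (a' := 3) (b' := 0) (c' := 0) (-4)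
    (fun x y z => by unfold socleWeight; split_ifs <;> omega)
  have e10 := socleRing_rel (k := k) (a := 1) (b := 0) (c := 1) (a' := 0) (b' := 3) (c' := 0) (-4)
    (fun x y z => by unfold socleWeight; split_ifs <;> omega)
  have e11 := socleRing_rel (k := k) (a := 1) (b := 1) (c := 0) (a' := 0) (b' := 0) (c' := 3) (-4)
    (fun x y z => by unfold socleWeight; split_ifs <;> omega)
  simp only [pow_zero, pow_one, one_mul, mul_one, Int.cast_one, Int.cast_neg, Int.cast_ofNat]
    at e1 e2 e3 e4 e5 e6 e7 e8 e9 e10 e11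
  exact ⟨e1, e2, e3, e4, e5, e6, e7, e8, e9, e10, e11⟩

/-- The substitution `a, b, c = -2l², -2m², -2n²` solves `ll`, `mm`, `nn` because mixed products of
two squares vanish; then `2 a l = m n` becomes `m n = -4 l³`, the relation dictated by the term `-4
l m n` of the socle generator. -/
lemma socleRing_fermatRel : FermatRel (-2 * socleGen 0 ^ 2 : SocleRing k) (-2 * socleGen 1 ^ 2)
    (-2 * socleGen 2 ^ 2) (socleGen 0) (socleGen 1) (socleGen 2) := by
  obtain ⟨lm4, mn4, llm, lln, lmm, mmn, lnn, mnn, mn, ln, lm⟩ := socleRing_relations (k := k)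
  set l : SocleRing k := socleGen 0
  set m : SocleRing k := socleGen 1
  set n : SocleRing k := socleGen 2
  exact
    { ab := by linear_combination 4 * lm4
      bc := by linear_combination 4 * mn4
      an := by linear_combination (-2) * lln
      am := by linear_combination (-2) * llm
      bn := by linear_combination (-2) * mmn
      bl := by linear_combination (-2) * lmm
      cm := by linear_combination (-2) * mnn
      cl := by linear_combination (-2) * lnn
      nn := by linear_combination 4 * m * llm
      mm := by linear_combination 4 * n * lln
      ll := by linear_combination 4 * n * mmn
      al := by linear_combination - mn
      bm := by linear_combination - ln
      cn := by linear_combination - lm }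

/-- A fifth power equals a variable times the fourth power of another one, hence has a vanishing
mixed factor. -/
lemma isNilpotent_socleGen (i : Fin 3) : IsNilpotent (socleGen i : SocleRing k) := by
  obtain ⟨lm4, mn4, llm, lln, lmm, mmn, lnn, mnn, mn, ln, lm⟩ := socleRing_relations (k := k)
  refine ⟨5, ?_⟩
  fin_cases i
  · change (socleGen 0 : SocleRing k) ^ 5 = 0
    linear_combination socleGen 0 * lm4 + socleGen 1 ^ 2 * lmm
  · change (socleGen 1 : SocleRing k) ^ 5 = 0
    linear_combination (- socleGen 1) * lm4 + socleGen 0 ^ 2 * llm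
  · change (socleGen 2 : SocleRing k) ^ 5 = 0
    linear_combination (- socleGen 2) * mn4 + socleGen 1 ^ 2 * mmn

/-- The exponents of a monomial basis of `SocleRing k`. -/
def socleExp : Fin 11 → ℕ × ℕ × ℕ :=
  ![(0, 0, 0), (1, 0, 0), (0, 1, 0), (0, 0, 1), (2, 0, 0), (0, 2, 0), (0, 0, 2), (3, 0, 0),
    (0, 3, 0), (0, 0, 3), (4, 0, 0)]

/-- The exponents of the dual monomial basis of `SocleRing k`. -/
def socleDualExp : Fin 11 → ℕ × ℕ × ℕ :=
  ![(4, 0, 0), (3, 0, 0), (0, 3, 0), (0, 0, 3), (2, 0, 0), (0, 2, 0), (0, 0, 2), (1, 0, 0),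
    (0, 1, 0), (0, 0, 1), (0, 0, 0)]

/-- All listed monomials are pure powers, so a product of two never is `l m n`; only complementary
powers of one variable reach degree four. -/
lemma socleWeight_exp : ∀ i j : Fin 11,
    socleWeight ((socleExp i).1 + (socleDualExp j).1) ((socleExp i).2.1 + (socleDualExp j).2.1)
      ((socleExp i).2.2 + (socleDualExp j).2.2) = if i = j then 1 else 0 := by
  decide

/-- Pairing a linear relation with the dual monomials through `socle` isolates its coefficients. -/
lemma linearIndependent_socleExp : LinearIndependent k fun i =>
    (socleGen 0 ^ (socleExp i).1 * socleGen 1 ^ (socleExp i).2.1 * socleGen 2 ^ (socleExp i).2.2 :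
      SocleRing k) := by
  rw [Fintype.linearIndependent_iff]
  intro c hc j
  have h : ∑ i, c i • lmn (socleExp i).1 (socleExp i).2.1 (socleExp i).2.2 ∈ socleIdeal k := by
    rw [← Ideal.Quotient.eq_zero_iff_mem, ← hc, map_sum]
    refine Finset.sum_congr rfl fun i _ => ?_
    rw [← mk_lmn]
    rfl
  have h2 := h (lmn (socleDualExp j).1 (socleDualExp j).2.1 (socleDualExp j).2.2)
  rw [Finset.sum_mul, map_sum] at h2
  simp only [smul_mul_assoc, lmn_mul, map_smul, socle_lmn, socleWeight_exp] at h2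
  simpa using h2

instance : Nontrivial (SocleRing k) := by
  refine Ideal.Quotient.nontrivial_iff.mpr fun h => ?_
  have h1 : (1 : MvPolynomial (Fin 3) k) ∈ socleIdeal k := by rw [h]; trivial
  have h2 := h1 (lmn 4 0 0)
  rw [one_mul, socle_lmn] at h2
  simp [socleWeight] at h2

end Model

/-! ### The points of the fiber and the lengths of their local rings. -/

section FermatRingPoints

variable {k : Type u} [Field k]

open FermatRing

/-- To bound `s · FermatRing k` by a subspace it is enough to contain `s` and be stable under the
generators; this supplies the spanning hypothesis of `length_localization_atPrime`. -/
lemma FermatRing.mul_mem {M : Submodule k (FermatRing k)} {s : FermatRing k} (hs : s ∈ M)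
    (h : ∀ i x, s * x ∈ M → s * (gen i * x) ∈ M) (x : FermatRing k) : s * x ∈ M := by
  obtain ⟨p, rfl⟩ := Ideal.Quotient.mk_surjective x
  induction p using MvPolynomial.induction_on with
  | C r =>
    have h1 : r • s = s * Ideal.Quotient.mk _ (C r) :=
      (Algebra.smul_def r s).trans (mul_comm _ _)
    exact (congrArg (· ∈ M) h1).mp (M.smul_mem r hs)
  | add p q hp hq => rw [map_add, mul_add]; exact M.add_mem hp hq
  | mul_X p i hp =>
    rw [map_mul, mul_comm (Ideal.Quotient.mk _ p)]
    exact h i _ hp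

/-- The point of the fiber given by the Fermat quartic. -/
def fermatEv (k : Type u) [Field k] : FermatRing k →ₐ[k] k := (fermatRel_zero k).lift

/-- The points of the fiber given by the quartics `C₀`, `C₁`, `C₂`, `C₃`. -/
def companionEv (k : Type u) [Field k] (j : Fin 4) : FermatRing k →ₐ[k] k :=
  (fermatRel_signs k j).lift

lemma FermatRing.sub_mem {S : Type*} [CommRing S] [Algebra k S] (I : Ideal S)
    (φ : FermatRing k →ₐ[k] S) (ev : FermatRing k →ₐ[k] k)
    (h : ∀ i, φ (gen i) - algebraMap k S (ev (gen i)) ∈ I) (x : FermatRing k) :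
    φ x - algebraMap k S (ev x) ∈ I := by
  have h1 : (Ideal.Quotient.mkₐ k I).comp φ = (Algebra.ofId k (S ⧸ I)).comp ev :=
    FermatRing.algHom_ext fun i => Ideal.Quotient.eq.mpr (h i)
  exact Ideal.Quotient.eq.mp (DFunLike.congr_fun h1 x)

/-- If the generators have rational values modulo `p`, then `p` contains the kernel of the
evaluation, which is maximal. -/
lemma ker_eq_of_mk_gen (ev : FermatRing k →ₐ[k] k) (p : Ideal (FermatRing k)) [hp : p.IsPrime]
    (h : ∀ i, Ideal.Quotient.mk p (gen i) =
      Ideal.Quotient.mk p (algebraMap k (FermatRing k) (ev (gen i)))) :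
    p = RingHom.ker ev := by
  have hle : RingHom.ker ev ≤ p := fun x hx => by
    have h1 := FermatRing.sub_mem p (AlgHom.id k _) ev (fun i => Ideal.Quotient.eq.mp (h i)) x
    rw [RingHom.mem_ker.mp hx, map_zero, sub_zero] at h1
    exact h1
  have hmax : (RingHom.ker ev).IsMaximal :=
    RingHom.ker_isMaximal_of_surjective ev fun r => ⟨algebraMap k _ r, ev.commutes r⟩
  exact (hmax.eq_of_le hp.ne_top hle).symm

lemma eq_one_or_eq_neg_one_of_sq_eq_one {D : Type*} [CommRing D] [IsDomain D] {x : D}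
    (h : x ^ 2 = 1) : x = 1 ∨ x = -1 := by
  rwa [← sq_eq_sq_iff_eq_or_eq_neg, one_pow]

lemma FermatRel.map {R S : Type*} [CommRing R] [CommRing S] (φ : R →+* S) {a b c l m n : R}
    (h : FermatRel a b c l m n) : FermatRel (φ a) (φ b) (φ c) (φ l) (φ m) (φ n) := by
  obtain ⟨ab, bc, an, am, bn, bl, cm, cl, nn, mm, ll, al, bm, cn⟩ := h
  exact
    { ab := by simpa using congrArg φ ab
      bc := by simpa using congrArg φ bc
      an := by simpa using congrArg φ an
      am := by simpa using congrArg φ am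
      bn := by simpa using congrArg φ bn
      bl := by simpa using congrArg φ bl
      cm := by simpa using congrArg φ cm
      cl := by simpa using congrArg φ cl
      nn := by simpa [_root_.map_ofNat] using congrArg φ nn
      mm := by simpa [_root_.map_ofNat] using congrArg φ mm
      ll := by simpa [_root_.map_ofNat] using congrArg φ ll
      al := by simpa [_root_.map_ofNat] using congrArg φ al
      bm := by simpa [_root_.map_ofNat] using congrArg φ bm
      cn := by simpa [_root_.map_ofNat] using congrArg φ cn }

lemma fermatEv_gen (i : Fin 6) : fermatEv k (gen i) = 0 := by
  rw [fermatEv, FermatRel.lift_gen]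
  fin_cases i <;> rfl

variable (k) in
/-- The projection from the fiber's coordinate ring to its localization at the Fermat quartic. -/
def toSocleRing : FermatRing k →ₐ[k] SocleRing k := socleRing_fermatRel.lift

lemma toSocleRing_surjective : Function.Surjective (toSocleRing k) := by
  rw [← AlgHom.range_eq_top, eq_top_iff]
  rintro x -
  obtain ⟨p, rfl⟩ := Ideal.Quotient.mk_surjective x
  induction p using MvPolynomial.induction_on with
  | C r => exact (toSocleRing k).range.algebraMap_mem r
  | add p q hp hq => rw [map_add]; exact add_mem hp hq
  | mul_X p i hp =>
    rw [map_mul]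
    refine mul_mem hp ?_
    fin_cases i
    · exact ⟨gen 3, FermatRel.lift_gen _ _⟩
    · exact ⟨gen 4, FermatRel.lift_gen _ _⟩
    · exact ⟨gen 5, FermatRel.lift_gen _ _⟩

lemma isNilpotent_toSocleRing (x : FermatRing k) :
    IsNilpotent (toSocleRing k x - algebraMap k _ (fermatEv k x)) := by
  have hmem (i : Fin 3) : (socleGen i : SocleRing k) ∈ nilradical (SocleRing k) :=
    isNilpotent_socleGen i
  refine FermatRing.sub_mem (nilradical (SocleRing k)) (toSocleRing k) (fermatEv k)
    (fun i => ?_) x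
  rw [fermatEv_gen, map_zero, sub_zero, toSocleRing, FermatRel.lift_gen]
  fin_cases i
  · exact Ideal.mul_mem_left _ _ (Ideal.pow_mem_of_mem _ (hmem 0) 2 two_pos)
  · exact Ideal.mul_mem_left _ _ (Ideal.pow_mem_of_mem _ (hmem 1) 2 two_pos)
  · exact Ideal.mul_mem_left _ _ (Ideal.pow_mem_of_mem _ (hmem 2) 2 two_pos)
  · exact hmem 0
  · exact hmem 1
  · exact hmem 2

variable [CharZero k]

/-- The solutions of `FermatRel` in a domain. -/
lemma FermatRel.cases {D : Type*} [CommRing D] [IsDomain D] [Algebra k D] {a b c l m n : D}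
    (h : FermatRel a b c l m n) : l = 0 ∧ m = 0 ∧ n = 0 ∧
      (a = 0 ∧ b = 0 ∧ c = 0 ∨ a = -1 ∧ b = -1 ∧ c = -1 ∨ a = 1 ∧ b = 1 ∧ c = -1 ∨
        a = 1 ∧ b = -1 ∧ c = 1 ∨ a = -1 ∧ b = 1 ∧ c = 1) := by
  have h2 : (2 : D) ≠ 0 := by
    have h6 : IsUnit (6 : D) := isUnit_six (k := k)
    intro h2
    exact h6.ne_zero (by linear_combination 3 * h2)
  have h6 := h.pow_six
  obtain ⟨ab, bc, an, am, bn, bl, cm, cl, nn, mm, ll, al, bm, cn⟩ := h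
  have ha : a = 0 ∨ a ^ 2 = 1 := by
    by_cases ha : a = 0
    · exact .inl ha
    · right
      refine mul_left_cancel₀ (pow_ne_zero 4 ha) ?_
      linear_combination h6
  rcases ha with rfl | ha
  · obtain rfl : b = 0 := by simpa using ab.symm
    obtain rfl : c = 0 := by simpa using bc.symm
    simp_all
  · have ha0 : a ≠ 0 := by rintro rfl; simp at ha
    have hb : b ^ 2 = 1 := ab.symm.trans ha
    have hb0 : b ≠ 0 := by rintro rfl; simp at hb
    obtain rfl : n = 0 := by simpa [ha0] using an
    obtain rfl : m = 0 := by simpa [ha0] using am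
    obtain rfl : l = 0 := by simpa [hb0] using bl
    obtain rfl : c = -(a * b) := by linear_combination nn
    rcases eq_one_or_eq_neg_one_of_sq_eq_one ha with rfl | rfl <;>
    rcases eq_one_or_eq_neg_one_of_sq_eq_one hb with rfl | rfl <;> simp

/-- The points of the spectrum of `FermatRing k`. -/
theorem FermatRing.eq_ker (p : Ideal (FermatRing k)) [hp : p.IsPrime] :
    p = RingHom.ker (fermatEv k) ∨ ∃ j, p = RingHom.ker (companionEv k j) := by
  have hrel : FermatRel (Ideal.Quotient.mk p (gen 0)) (Ideal.Quotient.mk p (gen 1))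
      (Ideal.Quotient.mk p (gen 2)) (Ideal.Quotient.mk p (gen 3)) (Ideal.Quotient.mk p (gen 4))
      (Ideal.Quotient.mk p (gen 5)) := FermatRing.fermatRel.map _
  obtain ⟨hl, hm, hn, h | h | h | h | h⟩ := hrel.cases (k := k)
  · refine .inl (ker_eq_of_mk_gen _ _ fun i => ?_)
    rw [fermatEv, FermatRel.lift_gen]
    fin_cases i <;> simp [*]
  · refine .inr ⟨0, ker_eq_of_mk_gen _ _ fun i => ?_⟩
    rw [companionEv, FermatRel.lift_gen]
    fin_cases i <;> simp [signs, *]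
  · refine .inr ⟨1, ker_eq_of_mk_gen _ _ fun i => ?_⟩
    rw [companionEv, FermatRel.lift_gen]
    fin_cases i <;> simp [signs, *]
  · refine .inr ⟨2, ker_eq_of_mk_gen _ _ fun i => ?_⟩
    rw [companionEv, FermatRel.lift_gen]
    fin_cases i <;> simp [signs, *]
  · refine .inr ⟨3, ker_eq_of_mk_gen _ _ fun i => ?_⟩
    rw [companionEv, FermatRel.lift_gen]
    fin_cases i <;> simp [signs, *]

/-- The local ring of the fiber at `C₀`, `C₁`, `C₂`, `C₃` has length one. -/
theorem length_companion (j : Fin 4) (p : Ideal (FermatRing k)) [p.IsPrime]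
    (hp : p = RingHom.ker (companionEv k j)) :
    Module.length (Localization.AtPrime p) (Localization.AtPrime p) = 1 := by
  obtain ⟨α, hα⟩ : ∃ α, α = (signs k j).1 := ⟨_, rfl⟩
  obtain ⟨β, hβ⟩ : ∃ β, β = (signs k j).2.1 := ⟨_, rfl⟩
  have hγ : (signs k j).2.2 = -(α * β) := by
    subst hα hβ; fin_cases j <;> simp [signs]
  have hα1 : α ^ 2 = 1 := by subst hα; fin_cases j <;> simp [signs]
  have hβ1 : β ^ 2 = 1 := by subst hβ; fin_cases j <;> simp [signs]
  have hev (i : Fin 6) : companionEv k j (gen i) = ![α, β, -(α * β), 0, 0, 0] i := by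
    rw [companionEv, FermatRel.lift_gen, hγ, hα, hβ]
  have hrel := FermatRing.fermatRel (k := k)
  have h6 := hrel.pow_six
  have hab := hrel.mul_eq_pow_mul
  obtain ⟨ab, bc, an, am, bn, bl, cm, cl, nn, mm, ll, al, bm, cn⟩ := hrel
  set A : FermatRing k := algebraMap k _ α
  set B : FermatRing k := algebraMap k _ β
  have hA : A ^ 2 = 1 := by rw [← map_pow, hα1, map_one]
  have hB : B ^ 2 = 1 := by rw [← map_pow, hβ1, map_one]
  set a : FermatRing k := gen 0
  set b : FermatRing k := gen 1
  set c : FermatRing k := gen 2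
  set l : FermatRing k := gen 3
  set m : FermatRing k := gen 4
  set n : FermatRing k := gen 5
  -- Four times the idempotent of the chosen point: `a⁴` selects `a² = b² = 1`, and the other two
  -- factors vanish unless `a` and `b` have the signs `α` and `β`. Every generator then acts on `s`
  -- by its value at the point, so `s` spans a line.
  set s : FermatRing k := a ^ 4 * (1 + A * a) * (1 + B * b) with hs
  have hsa : s * a = A * s := by
    linear_combination (1 + B * b) * A * h6 - (1 + B * b) * a ^ 5 * hA
  have hsb : s * b = B * s := by
    linear_combination (1 + A * a) * (B * (h6 - a ^ 4 * ab) - a ^ 4 * b * hB)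
  have hs2 : s * a ^ 2 = s := by
    linear_combination (1 + A * a) * (1 + B * b) * h6
  have hsc : s * c = -(A * B) * s := by
    have h1 : a * b + a ^ 2 * c = 0 := by linear_combination b * ll - 2 * l * bl + c * ab
    linear_combination (-c) * hs2 + s * h1 - b * hsa - A * hsb
  have hsl : s * l = 0 := by
    rw [hs]; linear_combination a ^ 2 * (1 + A * a) * (1 + B * b) * (l * ab + b * bl)
  have hsm : s * m = 0 := by
    rw [hs]; linear_combination a ^ 3 * (1 + A * a) * (1 + B * b) * am
  have hsn : s * n = 0 := by
    rw [hs]; linear_combination a ^ 3 * (1 + A * a) * (1 + B * b) * an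
  have hsev : companionEv k j s = 4 := by
    rw [hs]
    simp only [map_mul, map_pow, map_add, map_one, a, b, A, B, hev, AlgHom.commutes]
    simp only [Matrix.cons_val, Algebra.algebraMap_self, RingHom.id_apply]
    linear_combination (1 + β ^ 2) * (α ^ 4 + 2 * α ^ 2 + 2) * hα1 + 2 * hβ1
  refine (length_localization_atPrime (ι := Fin 1) p (companionEv k j) (fun x => by rw [hp]; rfl)
    (companionEv k j) (fun r => ⟨algebraMap k _ r, AlgHom.commutes _ r⟩)
    (fun x => by simp) s ?_ 1 ?_ ?_).trans ?_
  · rw [hsev]; norm_num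
  · exact LinearIndependent.of_subsingleton 0 (by simp)
  · refine FermatRing.mul_mem (Submodule.subset_span ⟨0, by simp⟩) fun i x hx => ?_
    have key : s * gen i = algebraMap k _ (companionEv k j (gen i)) * s := by
      rw [hev]
      fin_cases i
      · exact hsa
      · exact hsb
      · simpa using hsc
      · simpa using hsl
      · simpa using hsm
      · simpa using hsn
    rw [← mul_assoc, key, mul_assoc, ← Algebra.smul_def]
    exact Submodule.smul_mem _ _ hx
  · simp

/-- The local ring of the fiber at the Fermat quartic has length eleven. -/
theorem length_fermat (p : Ideal (FermatRing k)) [p.IsPrime]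
    (hp : p = RingHom.ker (fermatEv k)) :
    Module.length (Localization.AtPrime p) (Localization.AtPrime p) = 11 := by
  have hrel := FermatRing.fermatRel (k := k)
  obtain ⟨i2, hi2⟩ : ∃ x : FermatRing k, 2 * x = 1 :=
    (isUnit_of_dvd_unit ⟨3, by norm_num⟩ (isUnit_six (k := k))).exists_right_inv
  have h6 := hrel.pow_six
  have hab := hrel.mul_eq_pow_mul
  obtain ⟨ab, bc, an, am, bn, bl, cm, cl, nn, mm, ll, al, bm, cn⟩ := hrel
  have hgens : ∀ i, (gen i : FermatRing k) = ![gen 0, gen 1, gen 2, gen 3, gen 4, gen 5] i := by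
    intro i; fin_cases i <;> rfl
  set a : FermatRing k := gen 0 with ha
  set b : FermatRing k := gen 1 with hb
  set c : FermatRing k := gen 2 with hc
  set l : FermatRing k := gen 3 with hl
  set m : FermatRing k := gen 4 with hm
  set n : FermatRing k := gen 5 with hn
  have h35 : a ^ 3 = a ^ 5 := by linear_combination b * hab + (a - a ^ 3) * ab
  have hbc : b * c + a ^ 3 = 0 := by linear_combination b * nn - 2 * n * bn + a * ab
  have hac : a * c + a ^ 2 * b = 0 := by linear_combination a * nn - 2 * n * an
  -- The idempotent `1 - a⁴` selects the part where `a` is nilpotent. It kills `b c`, `a c` and `a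
  -- b`, so the relations `ll`, `mm`, `nn` express `a`, `b`, `c` by squares of `l`, `m`, `n`.
  have hsa : (1 - a ^ 4) * a = -2 * (1 - a ^ 4) * l ^ 2 := by
    linear_combination (1 - a ^ 4) * ll - (1 - a ^ 4) * hbc + (1 + a ^ 2) * h35
  have hsb : (1 - a ^ 4) * b = -2 * (1 - a ^ 4) * m ^ 2 := by
    linear_combination (1 - a ^ 4) * mm - (1 - a ^ 4) * hac + a * (1 + a ^ 2) * hab
  have hsc : (1 - a ^ 4) * c = -2 * (1 - a ^ 4) * n ^ 2 := by
    linear_combination (1 - a ^ 4) * nn - (1 + a ^ 2) * hab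
  -- The relation `ll` gives `2 l² = -(a + b c)`, and both terms are killed by `m`; the next five
  -- are analogous.
  have llm : l ^ 2 * m = 0 := by
    linear_combination (-l ^ 2 * m) * hi2 + i2 * (m * ll - am - b * cm)
  have lln : l ^ 2 * n = 0 := by
    linear_combination (-l ^ 2 * n) * hi2 + i2 * (n * ll - an - c * bn)
  have lmm : l * m ^ 2 = 0 := by
    linear_combination (-l * m ^ 2) * hi2 + i2 * (l * mm - bl - a * cl)
  have mmn : m ^ 2 * n = 0 := by
    linear_combination (-m ^ 2 * n) * hi2 + i2 * (n * mm - bn - c * an)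
  have lnn : l * n ^ 2 = 0 := by
    linear_combination (-l * n ^ 2) * hi2 + i2 * (l * nn - cl - a * bl)
  have mnn : m * n ^ 2 = 0 := by
    linear_combination (-m * n ^ 2) * hi2 + i2 * (m * nn - cm - b * am)
  have slm : (1 - a ^ 4) * (l * m) = -4 * ((1 - a ^ 4) * n ^ 3) := by
    linear_combination 2 * n * hsc - (1 - a ^ 4) * cn
  have sln : (1 - a ^ 4) * (l * n) = -4 * ((1 - a ^ 4) * m ^ 3) := by
    linear_combination 2 * m * hsb - (1 - a ^ 4) * bm
  have smn : (1 - a ^ 4) * (m * n) = -4 * ((1 - a ^ 4) * l ^ 3) := by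
    linear_combination 2 * l * hsa - (1 - a ^ 4) * al
  -- Both sides are `-1/4` of `(1 - a⁴) l m n`, by the cubic formulas for the products of two
  -- variables; likewise for `n`.
  have sm4 : (1 - a ^ 4) * m ^ 4 = (1 - a ^ 4) * l ^ 4 := by
    linear_combination (-i2 ^ 2) * (l * smn - m * sln) -
      ((1 - a ^ 4) * m ^ 4 - (1 - a ^ 4) * l ^ 4) * (2 * i2 + 1) * hi2
  have sn4 : (1 - a ^ 4) * n ^ 4 = (1 - a ^ 4) * l ^ 4 := by
    linear_combination (-i2 ^ 2) * (l * smn - n * slm) -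
      ((1 - a ^ 4) * n ^ 4 - (1 - a ^ 4) * l ^ 4) * (2 * i2 + 1) * hi2
  set s : FermatRing k := 1 - a ^ 4 with hs
  have hsev : fermatEv k s = 1 := by
    rw [hs, map_sub, map_one, map_pow, ha, fermatEv_gen]; simp
  let f : Fin 11 → FermatRing k := fun i =>
    l ^ (socleExp i).1 * m ^ (socleExp i).2.1 * n ^ (socleExp i).2.2
  have hval (i : Fin 11) :
      f i = ![1, l, m, n, l ^ 2, m ^ 2, n ^ 2, l ^ 3, m ^ 3, n ^ 3, l ^ 4] i := by
    fin_cases i <;> simp [f, socleExp]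
  refine (length_localization_atPrime (ι := Fin 11) p (fermatEv k) (fun x => by rw [hp]; rfl)
    (toSocleRing k) toSocleRing_surjective isNilpotent_toSocleRing s ?_ f ?_ ?_).trans ?_
  · rw [hsev]; exact one_ne_zero
  · have (i : Fin 11) : toSocleRing k (f i) = socleGen 0 ^ (socleExp i).1 *
        socleGen 1 ^ (socleExp i).2.1 * socleGen 2 ^ (socleExp i).2.2 := by
      simp only [f, map_mul, map_pow]
      congr 2
      · exact congrArg (· ^ _) (FermatRel.lift_gen _ _)
      · exact congrArg (· ^ _) (FermatRel.lift_gen _ _)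
      · exact FermatRel.lift_gen _ _
    simp only [this]
    exact linearIndependent_socleExp
  · set M := Submodule.span k (Set.range fun i => s * f i) with hM
    have hmem (i : Fin 11) : s * ![1, l, m, n, l ^ 2, m ^ 2, n ^ 2, l ^ 3, m ^ 3, n ^ 3, l ^ 4] i ∈
        M :=
      Submodule.subset_span ⟨i, by rw [← hval]⟩
    have hsmul (r : ℤ) (y) (hy : y ∈ M) : r * y ∈ M := by
      rw [← zsmul_eq_mul]
      exact M.smul_of_tower_mem r hy
    have of_eq {y z : FermatRing k} (hz : z ∈ M) (h : y = z) : y ∈ M := h ▸ hz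
    have hlin (g : FermatRing k) (hg : ∀ i, g * (s * f i) ∈ M) (y) (hy : y ∈ M) : g * y ∈ M := by
      have : M ≤ M.comap (LinearMap.mulLeft k g) := by
        rw [hM, Submodule.span_le]
        rintro _ ⟨i, rfl⟩
        exact hg i
      exact this hy
    -- Multiplication by a variable raises its own powers, turns another variable into `-4` times
    -- the cube of the third, and kills the remaining mixed products. Fifth powers vanish, as in the
    -- model.
    have hlM : ∀ y ∈ M, l * y ∈ M := by
      refine hlin l fun i => ?_
      rw [hval]
      fin_cases i
      · exact of_eq (hmem 1) (show l * (s * 1) = s * l by ring)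
      · exact of_eq (hmem 4) (show l * (s * l) = s * l ^ 2 by ring)
      · exact of_eq (hsmul (-4) _ (hmem 9))
          (show l * (s * m) = ((-4 : ℤ) : FermatRing k) * (s * n ^ 3) by
            push_cast; linear_combination slm)
      · exact of_eq (hsmul (-4) _ (hmem 8))
          (show l * (s * n) = ((-4 : ℤ) : FermatRing k) * (s * m ^ 3) by
            push_cast; linear_combination sln)
      · exact of_eq (hmem 7) (show l * (s * l ^ 2) = s * l ^ 3 by ring)
      · exact of_eq M.zero_mem (show l * (s * m ^ 2) = 0 by linear_combination s * lmm)
      · exact of_eq M.zero_mem (show l * (s * n ^ 2) = 0 by linear_combination s * lnn)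
      · exact of_eq (hmem 10) (show l * (s * l ^ 3) = s * l ^ 4 by ring)
      · exact of_eq M.zero_mem (show l * (s * m ^ 3) = 0 by linear_combination s * m * lmm)
      · exact of_eq M.zero_mem (show l * (s * n ^ 3) = 0 by linear_combination s * n * lnn)
      · exact of_eq M.zero_mem
          (show l * (s * l ^ 4) = 0 by linear_combination (-l) * sm4 + s * m ^ 2 * lmm)
    have hmM : ∀ y ∈ M, m * y ∈ M := by
      refine hlin m fun i => ?_
      rw [hval]
      fin_cases i
      · exact of_eq (hmem 2) (show m * (s * 1) = s * m by ring)
      · exact of_eq (hsmul (-4) _ (hmem 9))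
          (show m * (s * l) = ((-4 : ℤ) : FermatRing k) * (s * n ^ 3) by
            push_cast; linear_combination slm)
      · exact of_eq (hmem 5) (show m * (s * m) = s * m ^ 2 by ring)
      · exact of_eq (hsmul (-4) _ (hmem 7))
          (show m * (s * n) = ((-4 : ℤ) : FermatRing k) * (s * l ^ 3) by
            push_cast; linear_combination smn)
      · exact of_eq M.zero_mem (show m * (s * l ^ 2) = 0 by linear_combination s * llm)
      · exact of_eq (hmem 8) (show m * (s * m ^ 2) = s * m ^ 3 by ring)
      · exact of_eq M.zero_mem (show m * (s * n ^ 2) = 0 by linear_combination s * mnn)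
      · exact of_eq M.zero_mem (show m * (s * l ^ 3) = 0 by linear_combination s * l * llm)
      · exact of_eq (hmem 10) (show m * (s * m ^ 3) = s * l ^ 4 by linear_combination sm4)
      · exact of_eq M.zero_mem (show m * (s * n ^ 3) = 0 by linear_combination s * n * mnn)
      · exact of_eq M.zero_mem (show m * (s * l ^ 4) = 0 by linear_combination s * l ^ 2 * llm)
    have hnM : ∀ y ∈ M, n * y ∈ M := by
      refine hlin n fun i => ?_
      rw [hval]
      fin_cases i
      · exact of_eq (hmem 3) (show n * (s * 1) = s * n by ring)
      · exact of_eq (hsmul (-4) _ (hmem 8))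
          (show n * (s * l) = ((-4 : ℤ) : FermatRing k) * (s * m ^ 3) by
            push_cast; linear_combination sln)
      · exact of_eq (hsmul (-4) _ (hmem 7))
          (show n * (s * m) = ((-4 : ℤ) : FermatRing k) * (s * l ^ 3) by
            push_cast; linear_combination smn)
      · exact of_eq (hmem 6) (show n * (s * n) = s * n ^ 2 by ring)
      · exact of_eq M.zero_mem (show n * (s * l ^ 2) = 0 by linear_combination s * lln)
      · exact of_eq M.zero_mem (show n * (s * m ^ 2) = 0 by linear_combination s * mmn)
      · exact of_eq (hmem 9) (show n * (s * n ^ 2) = s * n ^ 3 by ring)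
      · exact of_eq M.zero_mem (show n * (s * l ^ 3) = 0 by linear_combination s * l * lln)
      · exact of_eq M.zero_mem (show n * (s * m ^ 3) = 0 by linear_combination s * m * mmn)
      · exact of_eq (hmem 10) (show n * (s * n ^ 3) = s * l ^ 4 by linear_combination sn4)
      · exact of_eq M.zero_mem (show n * (s * l ^ 4) = 0 by linear_combination s * l ^ 2 * lln)
    -- On multiples of `s`, the generators `a`, `b`, `c` act as `-2l²`, `-2m²`, `-2n²`, so stability
    -- under `l`, `m`, `n` is enough.
    have h2M (y) (hy : y ∈ M) : -2 * y ∈ M := by simpa using hsmul (-2) y hy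
    refine FermatRing.mul_mem (by simpa using hmem 0) fun i x hx => ?_
    rw [hgens]
    fin_cases i
    · have := h2M _ (hlM _ (hlM _ hx))
      refine (congrArg (· ∈ M) ?_).mp this
      change _ = s * (a * x)
      linear_combination (-x) * hsa
    · have := h2M _ (hmM _ (hmM _ hx))
      refine (congrArg (· ∈ M) ?_).mp this
      change _ = s * (b * x)
      linear_combination (-x) * hsb
    · have := h2M _ (hnM _ (hnM _ hx))
      refine (congrArg (· ∈ M) ?_).mp this
      change _ = s * (c * x)
      linear_combination (-x) * hsc
    · exact (congrArg (· ∈ M) (mul_left_comm _ _ _)).mp (hlM _ hx)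
    · exact (congrArg (· ∈ M) (mul_left_comm _ _ _)).mp (hmM _ hx)
    · exact (congrArg (· ∈ M) (mul_left_comm _ _ _)).mp (hnM _ hx)
  · simp

end FermatRingPoints

/-! ### Transport of points and multiplicities to the fiber. -/

section MainTheorem

variable {k : Type u} [Field k]

open FermatRing

lemma multiplicity_of_isIso {X Z : Scheme.{u}} (e : X ⟶ Z) [IsIso e] (x : X) :
    multiplicity (e x) = multiplicity x :=
  length_eq_of_ringEquiv (asIso (e.stalkMap x)).commRingCatIsoToRingEquiv

lemma multiplicity_spec {R : Type u} [CommRing R] {Z : Scheme.{u}} (e : Spec (.of R) ⟶ Z)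
    [IsIso e] (x : PrimeSpectrum R) : multiplicity (e x) =
      Module.length (Localization.AtPrime x.asIdeal) (Localization.AtPrime x.asIdeal) :=
  (multiplicity_of_isIso e x).trans
    (length_eq_of_ringEquiv (Spec.stalkIso (.of R) x).commRingCatIsoToRingEquiv)

/-- The `k`-rational point of the spectrum of `FermatRing k` given by a solution. -/
def ratPoint (ev : FermatRing k →ₐ[k] k) : PrimeSpectrum (FermatRing k) :=
  Spec.map (CommRingCat.ofHom ev.toRingHom) (IsLocalRing.closedPoint k)

lemma ratPoint_asIdeal (ev : FermatRing k →ₐ[k] k) : (ratPoint ev).asIdeal = RingHom.ker ev := by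
  ext x
  change ev x ∈ IsLocalRing.maximalIdeal k ↔ _
  rw [IsLocalRing.mem_maximalIdeal, mem_nonunits_iff, isUnit_iff_ne_zero, not_not]
  rfl

lemma eq_ratPoint {x : PrimeSpectrum (FermatRing k)} {ev : FermatRing k →ₐ[k] k}
    (h : x.asIdeal = RingHom.ker ev) : x = ratPoint ev :=
  PrimeSpectrum.ext (h.trans (ratPoint_asIdeal ev).symm)

/-- Each `x` minus the scalar `ev x` lies in the kernel of `ev`, so a `k`-valued point is determined
by its kernel. -/
lemma ratPoint_injective : Function.Injective (ratPoint (k := k)) := fun ev ev' h => by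
  have hker : RingHom.ker ev = RingHom.ker ev' := by
    rw [← ratPoint_asIdeal, ← ratPoint_asIdeal, h]
  ext x
  have hx : x - algebraMap k _ (ev x) ∈ RingHom.ker ev := by
    rw [RingHom.mem_ker, map_sub, AlgHom.commutes]
    exact sub_self _
  rw [hker, RingHom.mem_ker, map_sub, AlgHom.commutes, sub_eq_zero] at hx
  exact hx.symm

/-- Specializing the universal quartic along a `k`-valued solution gives the quartic of that
solution; this identifies the curves under the five points. -/
lemma projPoint_ratPoint {a b c l m n : k} (h : FermatRel a b c l m n)
    {v : Mon → k} {hc : Ideal.span (Set.range v) = ⊤} (hv : v = sixVec a b c l m n) :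
    projPoint (k := k) (sixVec (gen 0 : FermatRing k) (gen 1) (gen 2) (gen 3) (gen 4) (gen 5))
        (span_range_eq_top_of_isUnit (m := mon 4 0 0) (by simp [sixVec_400])) (ratPoint h.lift) =
      projPoint v hc (IsLocalRing.closedPoint k) := by
  have h1 := specMap_projPoint (k := k) (h.lift (k := k))
    (sixVec (gen 0 : FermatRing k) (gen 1) (gen 2) (gen 3) (gen 4) (gen 5))
    (span_range_eq_top_of_isUnit (m := mon 4 0 0) (by simp [sixVec_400])) (m := mon 4 0 0)
    (by simp [sixVec_400])
  have h2 : (fun u => h.lift (k := k)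
      (sixVec (gen 0 : FermatRing k) (gen 1) (gen 2) (gen 3) (gen 4) (gen 5) u)) = v := by
    rw [hv]
    funext u
    refine (map_sixVec (h.lift (k := k)).toRingHom _ _ _ _ _ _ u).trans ?_
    congr 1 <;> exact h.lift_gen _
  subst h2
  exact congr($h1 (IsLocalRing.closedPoint k))

variable [CharZero k]

lemma signs_injective : Function.Injective (signs k) := by
  have h1 : (1 : k) ≠ -1 := by
    intro h
    exact two_ne_zero (α := k) (by linear_combination h)
  intro i j h
  fin_cases i <;> fin_cases j <;> simp_all [signs, eq_comm]

lemma companionEv_injective : Function.Injective (companionEv k) := fun i j h => by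
  have h' (t : Fin 6) := DFunLike.congr_fun h (gen t)
  have h0 := h' 0
  have h1 := h' 1
  have h2 := h' 2
  simp only [companionEv, FermatRel.lift_gen] at h0 h1 h2
  exact signs_injective (k := k) (Prod.ext h0 (Prod.ext h1 h2))

lemma companionEv_ne_fermatEv (j : Fin 4) : companionEv k j ≠ fermatEv k := fun h => by
  have h0 := DFunLike.congr_fun h (gen 0)
  simp only [companionEv, fermatEv, FermatRel.lift_gen] at h0
  fin_cases j <;> simp [signs] at h0

end MainTheorem

end

end HarmonicQuartic

open HarmonicQuartic MvPolynomial in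
theorem theorem2p1 (k : Type u) [Field k] [CharZero k] :
    -- the harmonic forms of the five quartics define the Fermat quartic of the dual plane, so that
    -- the rational map is defined at the five quartics
    (∃ c : k, c ≠ 0 ∧ harmonicForm (fermat k) = C c * fermat k) ∧
    (∀ j : Fin 4, ∃ c : k, c ≠ 0 ∧ harmonicForm (companion k j) = C c * fermat k) ∧
    -- the scheme-theoretic fiber consists of five points, with the stated multiplicities
    ∃ (P : FermatFiber k) (Q : Fin 4 → FermatFiber k),
      Function.Injective Q ∧ (∀ j, Q j ≠ P) ∧ (∀ x : FermatFiber k, x = P ∨ ∃ j, x = Q j) ∧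
      curveOf P = fermatPoint k ∧ (∀ j, curveOf (Q j) = companionPoint k j) ∧
      multiplicity P = 11 ∧ (∀ j, multiplicity (Q j) = 1) := by
  obtain ⟨e, he, hcurve⟩ := exists_fiber_iso (k := k)
  have hinj : Function.Injective e := e.homeomorph.injective
  refine ⟨harmonicForm_fermat k, harmonicForm_companion k, e (ratPoint (fermatEv k)),
    fun j => e (ratPoint (companionEv k j)),
    fun i j h => companionEv_injective (ratPoint_injective (hinj h)),
    fun j h => companionEv_ne_fermatEv j (ratPoint_injective (hinj h)), fun x => ?_, ?_,
    fun j => ?_, ?_, fun j => ?_⟩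
  · obtain ⟨y : PrimeSpectrum (FermatRing k), rfl⟩ := e.homeomorph.surjective x
    rcases FermatRing.eq_ker (PrimeSpectrum.asIdeal y) with h | ⟨j, h⟩
    · exact .inl (congrArg e (eq_ratPoint h))
    · exact .inr ⟨j, congrArg e (eq_ratPoint h)⟩
  · exact congr($hcurve (ratPoint (fermatEv k))).trans
      (projPoint_ratPoint _ (by rw [sixVec_zero, coeffs_fermat]))
  · exact congr($hcurve (ratPoint (companionEv k j))).trans
      (projPoint_ratPoint _ (by rw [coeffs_companion, companionVec]))
  · rw [multiplicity_spec]
    exact length_fermat _ (ratPoint_asIdeal _)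
  · rw [multiplicity_spec]
    exact length_companion j _ (ratPoint_asIdeal _)
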